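/- **Setting.** Let $\|\cdot\|_{\mathcal X}$ be a norm on $\mathbb R^d$ with dual norm $\|\cdot\|_{\mathcal X^*}$, and let $\|\cdot\|_{\mathcal Y}$ be an $\ell_\rho$-norm on $\mathbb R^n$ with $\rho\in[1,2]$. Let $\mathcal X\subseteq\mathbb R^d$, $\mathcal Y\subseteq\mathbb R^n$ be convex and consider $$\min_{x\in\mathcal X}\max_{y\in\mathcal Y}\ \mathcal L(x,y):=\langle y,f(x)\rangle-\psi(y)+\phi(x),\qquad f=(f_1,\dots,f_n),$$ where each $f_j:\mathbb R^d\to\mathbb R$ is convex and differentiable at the points of $\mathcal X$, and $y_j\ge 0$ for all $y\in\mathcal Y$ whenever $f_j$ is not affine. The indices $1,\dots,n$ are partitioned into blocks $B_1,\dots,B_N$, and there are constants $\boldsymbol G_J,\boldsymbol L_J\ge 0$ such that for all $J$, all $x,x'\in\mathcal X$, $y\in\mathcal Y$ and $z\in\mathbb R^{B_J}$ $$\Big\|\sum_{j\in B_J}z_j\nabla f_j(x)\Big\|_{\mathcal X^*}\le \boldsymbol G_J\|z\|_2,\qquad \Big\|\sum_{j\in B_J}y_j(\nabla f_j(x)-\nabla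 f_j(x'))\Big\|_{\mathcal X^*}\le \boldsymbol L_J\|x-x'\|_{\mathcal X}.$$ The function $\phi$ is proper, closed and $\mu$-strongly convex ($\mu\ge0$) with respect to $\|\cdot\|_{\mathcal X}$, with $\mathcal X\subseteq\operatorname{dom}\phi$ and $\mathcal X\cap\operatorname{ri}(\operatorname{dom}\phi)\neq\varnothing$; likewise $\psi$ on $\mathcal Y$ with $\nu\ge0$ and $\|\cdot\|_{\mathcal Y}$. Let $\omega_{\mathcal X}$ be proper, closed and $1$-strongly convex with respect to $\|\cdot\|_{\mathcal X}$, with $\mathcal X\subseteq\operatorname{dom}\omega_{\mathcal X}$ and $\mathcal X\cap\operatorname{ri}(\operatorname{dom}\omega_{\mathcal X})\ne\varnothing$, and let $\Delta_{\mathcal X}(x,x')=\omega_{\mathcal X}(x)-\omega_{\mathcal X}(x')-\langle\xi',x-x'\rangle$, where $\xi'\in\partial\omega_{\mathcal X}(x')$ is the subgradient chosen at $x'\in\operatorname{ri}(\operatorname{dom}\omega_{\mathcal X})$. Assume that $\phi$ is $\mu$-strongly convex relative to $\omega_{\mathcal X}$ on $\mathcal X$ ($\Delta_\phi\ge\mu\Delta_{\mathcal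 X}$, for some choice of the subgradients), and that for all $a,c>0$, all linear forms $g$, all $x'\in\mathcal X\cap\operatorname{ri}(\operatorname{dom}\omega_{\mathcal X})$ and all $\xi'\in\partial\omega_{\mathcal X}(x')$, the function $a\langle g,x\rangle+a\phi(x)+c\Delta_{\mathcal X}(x,x')$ has a minimizer over $\mathcal X$ that lies in $\operatorname{ri}(\operatorname{dom}\omega_{\mathcal X})$. Let $\omega_{\mathcal Y}$, $\Delta_{\mathcal Y}$ satisfy the same conditions for $\mathcal Y,\psi,\nu$. **Algorithm.** Let $p,q,r,s$ be probability vectors on $\{1,\dots,N\}$ with $p_I,q_I>0$ and $\min_I r_I\ge\frac1{2N}$, $\min_I s_I\ge\frac1{2N}$; let $\mu_0,\nu_0>0$, $x_0\in\mathcal X\cap\operatorname{ri}(\operatorname{dom}\omega_{\mathcal X})$, $y_0\in\mathcal Y\cap\operatorname{ri}(\operatorname{dom}\omega_{\mathcal Y})$, with arbitrary chosen subgradients of the generators there. Let $P_k\sim p$, $Q_k\sim q$, $R_k\sim r$, $S_k\sim s$ ($k\ge1$) be independent. Given weights $a_0=0$, $a_k>0$ ($k\ge1$), put $A_k=\sum_{i\le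 k}a_i$, $\hat x_{0,I}=\hat x_{-1,I}=x_0$, $\hat y_0=\hat y_{-1}=y_0$, and for $k=1,2,\dots$ $$\bar g_{k-1}=\sum_{I}\sum_{i\in B_I}\hat y_{k-1,i}\nabla f_i(\hat x_{k-1,I})+\frac{a_{k-1}}{p_{P_k}a_k}\sum_{i\in B_{P_k}}\big(y_{k-1,i}\nabla f_i(x_{k-1})-\hat y_{k-2,i}\nabla f_i(\hat x_{k-2,P_k})\big),$$ $$x_k=\operatorname*{argmin}_{x\in\mathcal X}\Big\{a_k\langle\bar g_{k-1},x\rangle+a_k\phi(x)+\tfrac{A_{k-1}\mu+\mu_0}{2}\Delta_{\mathcal X}(x,x_{k-1})\Big\};$$ set $\hat x_{k,R_k}=x_k$ and $\hat x_{k,I}=\hat x_{k-1,I}$ for $I\ne R_k$; let $\bar f_{k-1/2}\in\mathbb R^n$ have the coordinates $$\bar f_{k-1/2,j}=f_j(\hat x_{k,J})+\frac{a_{k-1}}{q_{Q_k}a_k}\mathbf 1\{J=Q_k\}\big(f_j(x_{k-1})-f_j(\hat x_{k-1,J})\big)\qquad(j\in B_J),$$ $$y_k=\operatorname*{argmax}_{y\in\mathcal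 Y}\Big\{a_k\langle y,\bar f_{k-1/2}\rangle-a_k\psi(y)-\tfrac{A_{k-1}\nu+\nu_0}{2}\Delta_{\mathcal Y}(y,y_{k-1})\Big\};$$ finally replace block $S_k$ of $\hat y_{k-1}$ by that of $y_k$ to get $\hat y_k$. After every update a subgradient of the generator at the new iterate is chosen, as a function of the data of the proximal subproblem just solved. The output after $t$ iterations is $(\tilde x_t,\tilde y_t)=A_t^{-1}\sum_{k=1}^t a_k(x_k,y_k)$. **Constants.** For $u\in\mathcal X$, $v\in\mathcal Y$ let $\operatorname{Gap}^{u,v}(x,y)=\mathcal L(x,v)-\mathcal L(u,y)$, $$D_0=\sqrt{\tfrac{\mu_0}{\nu_0}}\Delta_{\mathcal X}(u,x_0)+\sqrt{\tfrac{\nu_0}{\mu_0}}\Delta_{\mathcal Y}(v,y_0),\quad \bar L=\Big(\sum_I\tfrac{\boldsymbol L_I^2}{p_Ir_I^2}\Big)^{1/2},\quad \bar G=\max\Big\{\Big(\max_I\tfrac{\boldsymbol G_I^2}{p_Is_I^2}\Big)^{1/2},\Big(\sum_I\tfrac{\boldsymbol G_I^2}{q_Ir_I^2}\Big)^{1/2}\Big\},$$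 $C_0=(\bar L\sqrt{\nu_0/\mu_0}+\bar G)D_0$ and $\Lambda=\max\{1,\ln(C_0/\epsilon)\}$ (with $\Lambda=1$ if $C_0=0$). **Theorem.** There is a universal constant $C>0$ such that the following holds in the above setting. The subgradients of the generators at the iterates can be chosen, independently of $u,v,\epsilon$, such that for all $u\in\mathcal X$, $v\in\mathcal Y$, $\epsilon>0$ there are deterministic weights $(a_k)_{k\ge1}$ with which, for all $t\ge C\,T$, the output satisfies $(\tilde x_t,\tilde y_t)\in\mathcal X\times\mathcal Y$ and $$\mathbb E\big[\operatorname{Gap}^{u,v}(\tilde x_t,\tilde y_t)\big]\le\epsilon$$ (the expectation exists), where $$T=\begin{cases}\big(N+\frac{\bar L}{\mu}+\frac{\bar G}{\sqrt{\mu\nu}}\big)\Lambda & \mu>0,\ \nu>0,\\[2pt] \big(N+\frac{\bar L}{\mu}\big)\Lambda+\bar G\sqrt{\frac{\sqrt{\mu_0/\nu_0}\,D_0}{\mu\epsilon}} & \mu>0,\ \nu=0,\\[2pt] N\Lambda+\frac{\bar L\sqrt{\nu_0/\mu_0}\,D_0}{\epsilon}+\bar G\sqrt{\frac{\sqrt{\nu_0/\mu_0}\,D_0}{\nu\epsilon}}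 & \mu=0,\ \nu>0,\\[2pt] N\Lambda+\frac{(\bar L\sqrt{\nu_0/\mu_0}+\bar G)D_0}{\epsilon} & \mu=0,\ \nu=0.\end{cases}$$ If moreover the generators are differentiable relative to the feasible sets (at every $z\in\mathcal X\cap\operatorname{ri}(\operatorname{dom}\omega_{\mathcal X})$, each $\xi\in\partial\omega_{\mathcal X}(z)$ gives the one-sided derivative $\langle\xi,u-z\rangle$ of $\omega_{\mathcal X}$ at $z$ in the direction $u-z$, for all $u\in\mathcal X$, and likewise for $\omega_{\mathcal Y}$ on $\mathcal Y$), then this holds for every such choice of the subgradients. -/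

import Mathlib

open MeasureTheory ProbabilityTheory
open scoped ENNReal

universe v w

noncomputable section

namespace DualLinear

/-! ### Extended-valued convex functions and Bregman divergences -/

/-- A function `V → ℝ ∪ {+∞}`: it takes the finite value `val x` for `x ∈ dom` and the value `+∞`
off `dom` (the numbers `val x` with `x ∉ dom` carry no meaning). -/
structure ExtFun (V : Type*) where
  /-- the effective domain -/
  dom : Set V
  /-- the finite values on the effective domain -/
  val : V → ℝ

section Convex

variable {V : Type*} [NormedAddCommGroup V] [NormedSpace ℝ V]

/-- Closedness: the epigraph is closed. -/
def ExtFun.IsClosedFun (F : ExtFun V) : Prop :=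
  IsClosed {q : V × ℝ | q.1 ∈ F.dom ∧ F.val q.1 ≤ q.2}

/-- The relative interior of the effective domain. -/
def ExtFun.ri (F : ExtFun V) : Set V := intrinsicInterior ℝ F.dom

/-- `ξ ∈ ∂F(z)`. -/
def ExtFun.IsSubgrad (F : ExtFun V) (z : V) (ξ : V →L[ℝ] ℝ) : Prop :=
  z ∈ F.dom ∧ ∀ u ∈ F.dom, F.val z + ξ (u - z) ≤ F.val u

/-- The Bregman divergence `F(u) - F(z) - ⟨ξ, u - z⟩` at a centre `w = (z, ξ)`, which consists of a
point `z` and of the subgradient `ξ ∈ ∂F(z)` that has been chosen at this point. -/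
def ExtFun.breg (F : ExtFun V) (u : V) (w : V × (V →L[ℝ] ℝ)) : ℝ :=
  F.val u - F.val w.1 - w.2 (u - w.1)

/-- `F` is proper, closed, `m`-strongly convex with respect to the norm of `V`, finite on `Z`, and
`Z` meets the relative interior of its domain. -/
structure ExtFun.IsStronglyConvexFor (F : ExtFun V) (Z : Set V) (m : ℝ) : Prop where
  subset_dom : Z ⊆ F.dom
  meets_ri : (Z ∩ F.ri).Nonempty
  closed : F.IsClosedFun
  strongConvex : StrongConvexOn F.dom m F.val

/-- `F` is relatively `m`-strongly convex with respect to the generator `gen` on `Z`, that is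
`Δ_F ≥ m Δ_gen` (for some choice of the subgradients). -/
def RelStronglyConvex (Z : Set V) (F gen : ExtFun V) (m : ℝ) : Prop :=
  ∀ z ∈ Z ∩ F.ri ∩ gen.ri, ∃ s ξ : V →L[ℝ] ℝ, F.IsSubgrad z s ∧ gen.IsSubgrad z ξ ∧
    ∀ u ∈ Z, m * gen.breg u (z, ξ) ≤ F.breg u (z, s)

/-- An admissible centre: a point of `Z` in the relative interior of the domain of the generator,
with a subgradient of the generator at this point. -/
def IsCentre (Z : Set V) (gen : ExtFun V) (w : V × (V →L[ℝ] ℝ)) : Prop :=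
  w.1 ∈ Z ∩ gen.ri ∧ gen.IsSubgrad w.1 w.2

/-- The objective `a ⟨g, z⟩ + a F(z) + c Δ_gen(z, w)` of a proximal step. -/
def proxObj (F gen : ExtFun V) (a c : ℝ) (g : V →L[ℝ] ℝ) (w : V × (V →L[ℝ] ℝ)) (z : V) : ℝ :=
  a * g z + a * F.val z + c * gen.breg z w

/-- Every proximal problem over `Z` has a solution in the relative interior of the domain of the
generator. -/
def ProxSolvable (Z : Set V) (F gen : ExtFun V) : Prop :=
  ∀ (a c : ℝ) (g : V →L[ℝ] ℝ) (w : V × (V →L[ℝ] ℝ)), 0 < a → 0 < c → IsCentre Z gen w →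
    ∃ z ∈ Z ∩ gen.ri, IsMinOn (proxObj F gen a c g w) Z z

/-- A way to carry out proximal steps: given `a`, `c`, `g` and a centre, it returns the (unique)
solution of the proximal problem together with a subgradient of the generator at the solution. -/
def IsProxRule (Z : Set V) (F gen : ExtFun V)
    (rule : ℝ → ℝ → (V →L[ℝ] ℝ) → V × (V →L[ℝ] ℝ) → V × (V →L[ℝ] ℝ)) : Prop :=
  ∀ (a c : ℝ) (g : V →L[ℝ] ℝ) (w : V × (V →L[ℝ] ℝ)), 0 < a → 0 < c → IsCentre Z gen w →
    IsCentre Z gen (rule a c g w) ∧ IsMinOn (proxObj F gen a c g w) Z (rule a c g w).1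

/-- The generator is differentiable relative to `Z`: at the points of `Z` in the relative interior
of its domain, every subgradient yields the one-sided derivatives in the feasible directions. -/
def DifferentiableAlong (Z : Set V) (gen : ExtFun V) : Prop :=
  ∀ z ∈ Z ∩ gen.ri, ∀ ξ : V →L[ℝ] ℝ, gen.IsSubgrad z ξ → ∀ u ∈ Z,
    HasDerivWithinAt (fun τ : ℝ => gen.val (z + τ • (u - z))) (ξ (u - z)) (Set.Ici 0) 0

end Convex

/-! ### The saddle point problem -/

/-- `ℝⁿ` with the `ℓ_ρ`-norm. -/
abbrev LpVec (n : ℕ) (ρ : ℝ≥0∞) : Type := PiLp ρ (fun _ : Fin n => ℝ)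

/-- The linear functional `y ↦ ⟨c, y⟩`. -/
def pairing {n : ℕ} (ρ : ℝ≥0∞) [Fact (1 ≤ ρ)] (c : Fin n → ℝ) : LpVec n ρ →L[ℝ] ℝ :=
  ∑ j, c j • (PiLp.proj ρ (fun _ : Fin n => ℝ) j : LpVec n ρ →L[ℝ] ℝ)

/-- The data of `min_{x ∈ X} max_{y ∈ Y} ⟨y, f(x)⟩ - ψ(y) + φ(x)`, where the indices `1, …, n` are
partitioned into the `N` blocks `B_J = {j | blk j = J}`. The primal space is `ℝᵈ` with an arbitrary
norm, presented as a finite-dimensional normed space `E`; gradients live in its dual. -/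
structure Problem (E : Type*) [NormedAddCommGroup E] [NormedSpace ℝ E]
    (n N : ℕ) (ρ : ℝ≥0∞) where
  /-- primal feasible set -/
  X : Set E
  /-- dual feasible set -/
  Y : Set (LpVec n ρ)
  /-- components of the coupling -/
  f : Fin n → E → ℝ
  /-- the block of an index -/
  blk : Fin n → Fin N
  /-- primal uncoupled component -/
  φ : ExtFun E
  /-- dual uncoupled component -/
  ψ : ExtFun (LpVec n ρ)
  /-- generator of the primal Bregman divergence -/
  genX : ExtFun E
  /-- generator of the dual Bregman divergence -/
  genY : ExtFun (LpVec n ρ)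
  /-- primal strong convexity modulus -/
  μ : ℝ
  /-- dual strong convexity modulus -/
  ν : ℝ
  /-- blockwise Lipschitz constants -/
  G : Fin N → ℝ
  /-- blockwise smoothness constants -/
  L : Fin N → ℝ

section Problem

variable {E : Type*} [NormedAddCommGroup E] [NormedSpace ℝ E]
variable {n N : ℕ} {ρ : ℝ≥0∞} [Fact (1 ≤ ρ)]

/-- The standing assumptions on the problem. -/
structure Problem.IsAdmissible (pb : Problem E n N ρ) : Prop where
  convex_X : Convex ℝ pb.X
  convex_Y : Convex ℝ pb.Y
  convex_f : ∀ j, ConvexOn ℝ Set.univ (pb.f j)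
  differentiable_f : ∀ j, ∀ x ∈ pb.X, DifferentiableAt ℝ (pb.f j) x
  /-- dual coordinates that belong to non-affine components are nonnegative -/
  sign : ∀ j, (∃ (l : E →L[ℝ] ℝ) (b : ℝ), ∀ x, pb.f j x = l x + b) ∨ ∀ y ∈ pb.Y, 0 ≤ y j
  G_nonneg : ∀ J, 0 ≤ pb.G J
  L_nonneg : ∀ J, 0 ≤ pb.L J
  lipschitz : ∀ J, ∀ x ∈ pb.X, ∀ z : Fin n → ℝ,
    ‖∑ j with pb.blk j = J, z j • fderiv ℝ (pb.f j) x‖ ≤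
      pb.G J * √(∑ j with pb.blk j = J, z j ^ 2)
  smooth : ∀ J, ∀ y ∈ pb.Y, ∀ x ∈ pb.X, ∀ x' ∈ pb.X,
    ‖∑ j with pb.blk j = J, y j • (fderiv ℝ (pb.f j) x - fderiv ℝ (pb.f j) x')‖ ≤
      pb.L J * ‖x - x'‖
  μ_nonneg : 0 ≤ pb.μ
  ν_nonneg : 0 ≤ pb.ν
  φ_convex : pb.φ.IsStronglyConvexFor pb.X pb.μ
  ψ_convex : pb.ψ.IsStronglyConvexFor pb.Y pb.ν
  genX_convex : pb.genX.IsStronglyConvexFor pb.X 1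
  genY_convex : pb.genY.IsStronglyConvexFor pb.Y 1
  φ_relative : RelStronglyConvex pb.X pb.φ pb.genX pb.μ
  ψ_relative : RelStronglyConvex pb.Y pb.ψ pb.genY pb.ν
  prox_X : ProxSolvable pb.X pb.φ pb.genX
  prox_Y : ProxSolvable pb.Y pb.ψ pb.genY

/-- The objective `⟨y, f(x)⟩ - ψ(y) + φ(x)`. -/
def Problem.lagr (pb : Problem E n N ρ) (x : E) (y : LpVec n ρ) : ℝ :=
  ∑ j, y j * pb.f j x - pb.ψ.val y + pb.φ.val x

/-- The primal-dual gap at `(x, y)` with respect to `(u, v)`. -/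
def Problem.gap (pb : Problem E n N ρ) (u : E) (v : LpVec n ρ) (x : E) (y : LpVec n ρ) : ℝ :=
  pb.lagr x v - pb.lagr u y

end Problem

/-! ### The stochastic block algorithm -/

/-- The parameters of the method (which uses no historical regularization): the probabilities `p`, `q` of the blocks in the primal and dual
gradient estimates, the replacement probabilities `r`, `s` of the blocks of the primal and dual
tables, the constants `μ₀`, `ν₀`, and the initial points (with chosen subgradients of the
generators). -/
structure Params (E : Type*) [NormedAddCommGroup E] [NormedSpace ℝ E]
    (n N : ℕ) (ρ : ℝ≥0∞) where
  p : Fin N → ℝ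
  q : Fin N → ℝ
  r : Fin N → ℝ
  s : Fin N → ℝ
  μ₀ : ℝ
  ν₀ : ℝ
  x₀ : E × (E →L[ℝ] ℝ)
  y₀ : LpVec n ρ × (LpVec n ρ →L[ℝ] ℝ)

section Algorithm

variable {E : Type*} [NormedAddCommGroup E] [NormedSpace ℝ E]
variable {n N : ℕ} {ρ : ℝ≥0∞} [Fact (1 ≤ ρ)]

/-- `p`, `q`, `r`, `s` are probability vectors, `p`, `q` are positive, `r`, `s` are at least
`1/(2N)`, and the initial points are admissible. -/
structure Params.IsAdmissible (pm : Params E n N ρ) (pb : Problem E n N ρ) : Prop where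
  p_pos : ∀ I, 0 < pm.p I
  q_pos : ∀ I, 0 < pm.q I
  r_ge : ∀ I, 1 / (2 * (N : ℝ)) ≤ pm.r I
  s_ge : ∀ I, 1 / (2 * (N : ℝ)) ≤ pm.s I
  p_sum : ∑ I, pm.p I = 1
  q_sum : ∑ I, pm.q I = 1
  r_sum : ∑ I, pm.r I = 1
  s_sum : ∑ I, pm.s I = 1
  μ₀_pos : 0 < pm.μ₀
  ν₀_pos : 0 < pm.ν₀
  x₀_centre : IsCentre pb.X pb.genX pm.x₀
  y₀_centre : IsCentre pb.Y pb.genY pm.y₀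

/-- The state of the method after iteration `k`: the iterates `x_k`, `y_k` with the chosen
subgradients, the tables `x̂_{k,I}`, `ŷ_k`, and the previous tables `x̂_{k-1,I}`, `ŷ_{k-1}`. -/
structure AlgState (E : Type*) [NormedAddCommGroup E] [NormedSpace ℝ E]
    (n N : ℕ) (ρ : ℝ≥0∞) where
  x : E × (E →L[ℝ] ℝ)
  y : LpVec n ρ × (LpVec n ρ →L[ℝ] ℝ)
  xhat : Fin N → E
  yhat : LpVec n ρ
  xhatPrev : Fin N → E
  yhatPrev : LpVec n ρ

/-- `A_k = a_0 + ⋯ + a_k`. -/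
def cumSum (a : ℕ → ℝ) (k : ℕ) : ℝ := ∑ i ∈ Finset.range (k + 1), a i

/-- The primal gradient estimate of iteration `k + 1`, where `P` is the sampled block and `st` is
the state after iteration `k`. -/
def gradEst (pb : Problem E n N ρ) (pm : Params E n N ρ) (a : ℕ → ℝ) (k : ℕ) (P : Fin N)
    (st : AlgState E n N ρ) : E →L[ℝ] ℝ :=
  ∑ i, st.yhat i • fderiv ℝ (pb.f i) (st.xhat (pb.blk i)) +
    (a k / (pm.p P * a (k + 1))) •
      ∑ i with pb.blk i = P, (st.y.1 i • fderiv ℝ (pb.f i) st.x.1 -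
        st.yhatPrev i • fderiv ℝ (pb.f i) (st.xhatPrev (pb.blk i)))

/-- The dual estimate of iteration `k + 1`, where `Q` is the sampled block, `st` is the state after
iteration `k`, and `xhatNew` is the primal table after its update in iteration `k + 1`. -/
def valEst (pb : Problem E n N ρ) (pm : Params E n N ρ) (a : ℕ → ℝ) (k : ℕ) (Q : Fin N)
    (st : AlgState E n N ρ) (xhatNew : Fin N → E) (j : Fin n) : ℝ :=
  pb.f j (xhatNew (pb.blk j)) +
    (a k / (pm.q Q * a (k + 1))) *
      (if pb.blk j = Q then pb.f j st.x.1 - pb.f j (st.xhat (pb.blk j)) else 0)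

/-- Iteration `k + 1` of the method with sampled blocks `P`, `Q`, `R`, `S`. The maximization that
defines the dual iterate is written as the minimization of the negative objective. -/
def algStep (pb : Problem E n N ρ) (pm : Params E n N ρ)
    (ruleX : ℝ → ℝ → (E →L[ℝ] ℝ) → E × (E →L[ℝ] ℝ) → E × (E →L[ℝ] ℝ))
    (ruleY : ℝ → ℝ → (LpVec n ρ →L[ℝ] ℝ) → LpVec n ρ × (LpVec n ρ →L[ℝ] ℝ) →
      LpVec n ρ × (LpVec n ρ →L[ℝ] ℝ))
    (a : ℕ → ℝ) (k : ℕ) (P Q R S : Fin N) (st : AlgState E n N ρ) : AlgState E n N ρ :=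
  let xNew := ruleX (a (k + 1)) ((cumSum a k * pb.μ + pm.μ₀) / 2) (gradEst pb pm a k P st) st.x
  let xhatNew : Fin N → E := fun I => if I = R then xNew.1 else st.xhat I
  let yNew := ruleY (a (k + 1)) ((cumSum a k * pb.ν + pm.ν₀) / 2)
    (-pairing ρ (valEst pb pm a k Q st xhatNew)) st.y
  { x := xNew
    y := yNew
    xhat := xhatNew
    yhat := WithLp.toLp ρ (fun j => if pb.blk j = S then yNew.1 j else st.yhat j)
    xhatPrev := st.xhat
    yhatPrev := st.yhat }

/-- The state after `k` iterations, where `P k, Q k, R k, S k` are the blocks that are sampled in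
iteration `k + 1`. -/
def algRun (pb : Problem E n N ρ) (pm : Params E n N ρ)
    (ruleX : ℝ → ℝ → (E →L[ℝ] ℝ) → E × (E →L[ℝ] ℝ) → E × (E →L[ℝ] ℝ))
    (ruleY : ℝ → ℝ → (LpVec n ρ →L[ℝ] ℝ) → LpVec n ρ × (LpVec n ρ →L[ℝ] ℝ) →
      LpVec n ρ × (LpVec n ρ →L[ℝ] ℝ))
    (a : ℕ → ℝ) (P Q R S : ℕ → Fin N) : ℕ → AlgState E n N ρ
  | 0 =>
    { x := pm.x₀, y := pm.y₀, xhat := fun _ => pm.x₀.1, yhat := pm.y₀.1,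
      xhatPrev := fun _ => pm.x₀.1, yhatPrev := pm.y₀.1 }
  | k + 1 => algStep pb pm ruleX ruleY a k (P k) (Q k) (R k) (S k)
      (algRun pb pm ruleX ruleY a P Q R S k)

/-- The output `A_t⁻¹ ∑_{k=1}^t a_k (x_k, y_k)`, computed from the states after each iteration. -/
def output (a : ℕ → ℝ) (run : ℕ → AlgState E n N ρ) (t : ℕ) : E × LpVec n ρ :=
  ((cumSum a t)⁻¹ • ∑ k ∈ Finset.Icc 1 t, a k • (run k).x.1,
    (cumSum a t)⁻¹ • ∑ k ∈ Finset.Icc 1 t, a k • (run k).y.1)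

/-- All sampled blocks `P_k, Q_k, R_k, S_k` are independent, with laws `p, q, r, s`. -/
structure IsSampling {Ω : Type*} [MeasurableSpace Ω] (prob : Measure Ω) (pm : Params E n N ρ)
    (P Q R S : ℕ → Ω → Fin N) : Prop where
  measurable_P : ∀ k, Measurable (P k)
  measurable_Q : ∀ k, Measurable (Q k)
  measurable_R : ∀ k, Measurable (R k)
  measurable_S : ∀ k, Measurable (S k)
  law_P : ∀ k I, prob {o | P k o = I} = ENNReal.ofReal (pm.p I)
  law_Q : ∀ k I, prob {o | Q k o = I} = ENNReal.ofReal (pm.q I)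
  law_R : ∀ k I, prob {o | R k o = I} = ENNReal.ofReal (pm.r I)
  law_S : ∀ k I, prob {o | S k o = I} = ENNReal.ofReal (pm.s I)
  indep : iIndepFun (fun (i : ℕ × Fin 4) => ![P i.1, Q i.1, R i.1, S i.1] i.2) prob

/-! ### Iteration complexity -/

/-- `G_{p,s} ∨ G_{q,r}` with `G_{p,s}² = max_I G_I² / (p_I s_I²)` and
`G_{q,r}² = ∑_I G_I² / (q_I r_I²)`. -/
def constG (pb : Problem E n N ρ) (pm : Params E n N ρ) : ℝ :=
  max (√(⨆ I, pb.G I ^ 2 / (pm.p I * pm.s I ^ 2))) (√(∑ I, pb.G I ^ 2 / (pm.q I * pm.r I ^ 2)))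

/-- `L_{p,r}` with `L_{p,r}² = ∑_I L_I² / (p_I r_I²)`. -/
def constL (pb : Problem E n N ρ) (pm : Params E n N ρ) : ℝ :=
  √(∑ I, pb.L I ^ 2 / (pm.p I * pm.r I ^ 2))

/-- The initial distance `D₀`. -/
def initDist (pb : Problem E n N ρ) (pm : Params E n N ρ) (u : E) (v : LpVec n ρ) : ℝ :=
  √(pm.μ₀ / pm.ν₀) * pb.genX.breg u pm.x₀ + √(pm.ν₀ / pm.μ₀) * pb.genY.breg v pm.y₀

/-- The constant `C₀`. -/
def initConst (pb : Problem E n N ρ) (pm : Params E n N ρ) (u : E) (v : LpVec n ρ) : ℝ :=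
  (constL pb pm * √(pm.ν₀ / pm.μ₀) + constG pb pm) * initDist pb pm u v

/-- `ln(C₀/ε)`, replaced by `1` where it is smaller. -/
def logTerm (pb : Problem E n N ρ) (pm : Params E n N ρ) (u : E) (v : LpVec n ρ) (ε : ℝ) : ℝ :=
  max 1 (Real.log (initConst pb pm u v / ε))

open Classical in
/-- The iteration complexity, up to a universal factor. -/
def iterBound (pb : Problem E n N ρ) (pm : Params E n N ρ) (u : E) (v : LpVec n ρ) (ε : ℝ) : ℝ :=
  if 0 < pb.μ then
    if 0 < pb.ν then
      (N + constL pb pm / pb.μ + constG pb pm / √(pb.μ * pb.ν)) * logTerm pb pm u v ε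
    else
      (N + constL pb pm / pb.μ) * logTerm pb pm u v ε +
        constG pb pm * √(√(pm.μ₀ / pm.ν₀) * initDist pb pm u v / (pb.μ * ε))
  else
    if 0 < pb.ν then
      N * logTerm pb pm u v ε +
        constL pb pm * √(pm.ν₀ / pm.μ₀) * initDist pb pm u v / ε +
        constG pb pm * √(√(pm.ν₀ / pm.μ₀) * initDist pb pm u v / (pb.ν * ε))
    else
      N * logTerm pb pm u v ε +
        (constL pb pm * √(pm.ν₀ / pm.μ₀) + constG pb pm) * initDist pb pm u v / ε

/-- The method with the given proximal rules reaches expected gap at most `ε` with respect to every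
fixed `(u, v)`, with suitable (deterministic) weights `a`, after `C * iterBound` iterations. -/
def AchievesComplexity.{v', w'} {E : Type v'} [NormedAddCommGroup E] [NormedSpace ℝ E]
    {n N : ℕ} {ρ : ℝ≥0∞} [Fact (1 ≤ ρ)]
    (C : ℝ) (pb : Problem E n N ρ) (pm : Params E n N ρ)
    (ruleX : ℝ → ℝ → (E →L[ℝ] ℝ) → E × (E →L[ℝ] ℝ) → E × (E →L[ℝ] ℝ))
    (ruleY : ℝ → ℝ → (LpVec n ρ →L[ℝ] ℝ) → LpVec n ρ × (LpVec n ρ →L[ℝ] ℝ) →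
      LpVec n ρ × (LpVec n ρ →L[ℝ] ℝ)) : Prop :=
  ∀ u ∈ pb.X, ∀ v ∈ pb.Y, ∀ ε : ℝ, 0 < ε →
    ∃ a : ℕ → ℝ, a 0 = 0 ∧ (∀ k, 1 ≤ k → 0 < a k) ∧
      ∀ (Ω : Type w') [MeasurableSpace Ω] (prob : Measure Ω) [IsProbabilityMeasure prob]
        (P Q R S : ℕ → Ω → Fin N), IsSampling prob pm P Q R S →
      ∀ t : ℕ, C * iterBound pb pm u v ε ≤ t →
        let out : Ω → E × LpVec n ρ := fun o =>
          output a (algRun pb pm ruleX ruleY a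
            (fun k => P k o) (fun k => Q k o) (fun k => R k o) (fun k => S k o)) t
        (∀ o, (out o).1 ∈ pb.X ∧ (out o).2 ∈ pb.Y) ∧
        Integrable (fun o => pb.gap u v (out o).1 (out o).2) prob ∧
        ∫ o, pb.gap u v (out o).1 (out o).2 ∂prob ≤ ε

end Algorithm

end DualLinear

end

open DualLinear

noncomputable section

namespace DualLinear

/-! ### Convex analysis of a single proximal step -/

section Convex

variable {V : Type*} [NormedAddCommGroup V] [NormedSpace ℝ V]

open Filter Topology

/-! Each proximal step obeys a three-point inequality. Adding the primal and the dual one, and using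
the convexity of the coupling in x, bounds a_k Gap(x_k, y_k) by the decrease of the weighted Bregman
distances to (u, v), plus the errors made by reading gradients and values from the tables. The
corrections in the two estimates carry the importance weights 1/p and 1/q, so these errors telescope
on average. What is left is the product of the old error with the movement of the iterates in the
current step; Young's inequality trades it for squared errors and half of the negative movement
terms that the three-point inequalities provide.

The squared errors are controlled by how far the table entries lag behind the iterates. `lyapErr`
charges a stale block I with a coefficient proportional to 1/r_I or 1/s_I. The block is refreshed
with probability r_I or s_I, so this potential contracts enough to pay for the squared errors and
for the slow growth of the weights. Movement of the iterates costs an amount of order 1/r_I² or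
1/s_I², which the other half of the negative movement terms covers. A primal movement makes all
blocks stale at once, hence the sums over I in the constants; a dual movement splits orthogonally
over the blocks, hence the maximum. The outcome is `lyap_step`, a supermartingale-type inequality
for a Lyapunov function that is nonnegative by `lyap_nonneg`. Telescoping and Jensen's inequality
give `expected_gap_le`: the expected gap is at most √(μ₀ν₀) D₀ / (2 A_t).

It remains to let A_t grow as fast as the argument permits: a_{k+1} may exceed a_k by a factor 1 +
1/(20N) only, and, up to constants, L̄ a_{k+1} ≤ A_k μ + μ₀ and (Ḡ a_{k+1})² ≤ (A_k μ + μ₀)(A_k ν +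
ν₀). The choice a_{k+1} = A_k / (τ + l A_k + g √A_k) works in all four regimes, and a potential in
A_k (`one_le_potential_sub`) shows that a level B is reached from M within about τ ln(B/M) + l B + g
√B steps.

The generators need not be differentiable, so the three-point inequality needs an argument of its
own. Relative strong convexity makes F - m ω convex on the feasible set
(`RelStronglyConvex.convexOn_sub`), so the proximal objective is (a m + c) ω plus a convex function.
A sandwich argument at the minimizer, which lies in the relative interior of dom ω, yields a
subgradient of ω for which the inequality holds (`exists_common_subgrad`). This is the subgradient
to be chosen; if ω is differentiable along the feasible set, every choice works. -/

lemma exists_ball_of_mem_intrinsicInterior {D : Set V} {z : V}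
    (hz : z ∈ intrinsicInterior ℝ D) :
    ∃ ε > 0, ∀ d ∈ vectorSpan ℝ D, ‖d‖ < ε → z + d ∈ D := by
  obtain ⟨y, hy, rfl⟩ := mem_intrinsicInterior.1 hz
  obtain ⟨ε, hε, hb⟩ := Metric.isOpen_iff.1 isOpen_interior y hy
  refine ⟨ε, hε, fun d hd hdn => ?_⟩
  have hmem : (y : V) + d ∈ affineSpan ℝ D := by
    have := AffineSubspace.vadd_mem_of_mem_direction
      (s := affineSpan ℝ D) (by rwa [direction_affineSpan]) y.2
    rwa [vadd_eq_add, add_comm] at this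
  have : (⟨(y : V) + d, hmem⟩ : affineSpan ℝ D) ∈ Metric.ball y ε := by
    rw [Metric.mem_ball, Subtype.dist_eq]
    simpa [dist_eq_norm] using hdn
  have h2 := interior_subset (hb this)
  exact h2

lemma mem_intrinsicInterior_of_ball {D : Set V} {z : V} (hz : z ∈ D) {ε : ℝ} (hε : 0 < ε)
    (h : ∀ d ∈ vectorSpan ℝ D, ‖d‖ < ε → z + d ∈ D) : z ∈ intrinsicInterior ℝ D := by
  refine mem_intrinsicInterior.2 ⟨⟨z, subset_affineSpan ℝ D hz⟩, ?_, rfl⟩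
  rw [mem_interior]
  refine ⟨Metric.ball _ ε, fun y hy => ?_, Metric.isOpen_ball, Metric.mem_ball_self hε⟩
  have hd : (y : V) - z ∈ vectorSpan ℝ D := by
    rw [← direction_affineSpan]
    exact AffineSubspace.vsub_mem_direction y.2 (subset_affineSpan ℝ D hz)
  have := h _ hd (by
    rw [Metric.mem_ball, Subtype.dist_eq] at hy
    simpa [dist_eq_norm] using hy)
  simpa using this

lemma combo_mem_intrinsicInterior {D : Set V} (hD : Convex ℝ D) {z w : V}
    (hz : z ∈ intrinsicInterior ℝ D) (hw : w ∈ D) {a b : ℝ} (ha : 0 < a) (hb : 0 ≤ b)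
    (hab : a + b = 1) : a • z + b • w ∈ intrinsicInterior ℝ D := by
  obtain ⟨ε, hε, h⟩ := exists_ball_of_mem_intrinsicInterior hz
  have hzD := intrinsicInterior_subset hz
  refine mem_intrinsicInterior_of_ball (hD hzD hw ha.le hb hab) (mul_pos ha hε) fun d hd hdn => ?_
  have h1 : z + a⁻¹ • d ∈ D := by
    refine h _ (Submodule.smul_mem _ _ hd) ?_
    rw [norm_smul, Real.norm_of_nonneg (inv_nonneg.2 ha.le), inv_mul_lt_iff₀ ha]
    exact hdn
  have h2 := hD h1 hw ha.le hb hab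
  rw [smul_add, smul_inv_smul₀ ha.ne'] at h2
  convert h2 using 1
  abel

/-- A common subgradient for a sum `ω + K` that is minimal at a relative interior point of the
domain of `ω`. -/
lemma exists_common_subgrad [FiniteDimensional ℝ V] {D X : Set V} {ω K : V → ℝ} {z : V}
    (hω : ConvexOn ℝ D ω) (hK : ConvexOn ℝ X K) (hXD : X ⊆ D)
    (hz : z ∈ intrinsicInterior ℝ D) (hzX : z ∈ X)
    (hmin : ∀ u ∈ X, ω z + K z ≤ ω u + K u) :
    ∃ ξ : V →L[ℝ] ℝ, (∀ u ∈ D, ω z + ξ (u - z) ≤ ω u) ∧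
      ∀ u ∈ X, K z ≤ K u + ξ (u - z) := by
  have hzD := intrinsicInterior_subset hz
  let T := vectorSpan ℝ D
  -- The cone generated by the pairs (u - w, t) with t ≥ (ω u - ω z) + (K w - K z). A functional
  -- that is nonnegative on it and equals t on {0} × ℝ has the form t - ξ(d); its nonnegativity
  -- contains both desired inequalities, at w = z and at u = z.
  let s : PointedCone ℝ (T × ℝ) :=
    { carrier := {q | ∃ l : ℝ, 0 ≤ l ∧ ∃ u ∈ D, ∃ w ∈ X, (q.1 : V) = l • (u - w) ∧
        l * (ω u - ω z + K w - K z) ≤ q.2}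
      zero_mem' := ⟨0, le_rfl, z, hzD, z, hzX, by simp, by simp⟩
      add_mem' := by
        rintro ⟨d, t⟩ ⟨d', t'⟩ ⟨l, hl, u, hu, w, hw, hd, ht⟩ ⟨l', hl', u', hu', w', hw', hd', ht'⟩
        simp only at hd hd' ht ht'
        rcases (add_nonneg hl hl').eq_or_lt with h0 | h0
        · have e1 : l = 0 := by linarith
          have e2 : l' = 0 := by linarith
          subst e1 e2
          refine ⟨0, le_rfl, z, hzD, z, hzX, by simp [hd, hd'], ?_⟩
          simp at ht ht' ⊢
          linarith
        · have ha : 0 ≤ l / (l + l') := by positivity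
          have hb : 0 ≤ l' / (l + l') := by positivity
          have hab : l / (l + l') + l' / (l + l') = 1 := by field_simp
          have h1 := hω.2 hu hu' ha hb hab
          have h2 := hK.2 hw hw' ha hb hab
          refine ⟨l + l', h0.le, _, hω.1 hu hu' ha hb hab, _, hK.1 hw hw' ha hb hab, ?_, ?_⟩
          · simp only [Prod.fst_add, Submodule.coe_add, hd, hd', smul_sub, smul_add, smul_smul]
            rw [mul_div_cancel₀ _ h0.ne', mul_div_cancel₀ _ h0.ne']
            abel
          · simp only [smul_eq_mul, Prod.snd_add] at h1 h2 ⊢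
            have h3 := mul_le_mul_of_nonneg_left (add_le_add h1 h2) h0.le
            have h4 : (l + l') * (l / (l + l') * ω u + l' / (l + l') * ω u' +
                (l / (l + l') * K w + l' / (l + l') * K w')) =
                l * ω u + l' * ω u' + l * K w + l' * K w' := by
              field_simp
              ring
            rw [h4] at h3
            linarith
      smul_mem' := by
        rintro ⟨c, hc⟩ ⟨d, t⟩ ⟨l, hl, u, hu, w, hw, hd, ht⟩
        refine ⟨c * l, mul_nonneg hc hl, u, hu, w, hw, ?_, ?_⟩
        · simp only at hd
          simp [hd, mul_smul]
        · have := mul_le_mul_of_nonneg_left ht hc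
          rw [mul_assoc]
          exact this }
  have hmem : ∀ q : T × ℝ, q ∈ s ↔ ∃ l : ℝ, 0 ≤ l ∧ ∃ u ∈ D, ∃ w ∈ X,
      (q.1 : V) = l • (u - w) ∧ l * (ω u - ω z + K w - K z) ≤ q.2 := fun q => Iff.rfl
  have hne : ((0 : T), (1 : ℝ)) ≠ 0 := by simp
  let f : (T × ℝ) →ₗ.[ℝ] ℝ := LinearPMap.mkSpanSingleton ((0 : T), (1 : ℝ)) (1 : ℝ) hne
  have hfdom : ∀ x : f.domain, ∃ c : ℝ, (x : T × ℝ) = (0, c) ∧ f x = c := by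
    rintro ⟨x, hx⟩
    obtain ⟨c, rfl⟩ := Submodule.mem_span_singleton.1 hx
    refine ⟨c, by simp, ?_⟩
    have := LinearPMap.mkSpanSingleton'_apply ((0 : T), (1 : ℝ)) (1 : ℝ)
      (fun c hc => by simpa using Or.resolve_right (smul_eq_zero.1 hc) hne) c hx
    exact this.trans (by simp)
  obtain ⟨g, hgf, hgs⟩ := riesz_extension s f
    (by
      intro x hx
      obtain ⟨c, hxc, hfc⟩ := hfdom x
      rw [hfc]
      rw [hxc, hmem] at hx
      obtain ⟨l, hl, u, hu, w, hw, hd, ht⟩ := hx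
      simp only [ZeroMemClass.coe_zero] at hd ht
      rcases smul_eq_zero.1 hd.symm with h | h
      · simpa [h] using ht
      · rw [sub_eq_zero] at h
        subst h
        have := hmin u hw
        refine le_trans (mul_nonneg hl ?_) ht
        linarith)
    (by
      rintro ⟨d, t⟩
      -- Relative interiority enters here: every direction of `T` is a positive multiple of u - z
      -- with u ∈ D, so adding a multiple of (0, 1) moves any (d, t) into the cone.
      obtain ⟨ε, hε, hball⟩ := exists_ball_of_mem_intrinsicInterior hz
      obtain ⟨l, hl, hld⟩ : ∃ l : ℝ, 0 < l ∧ ‖l • (d : V)‖ < ε := by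
        refine ⟨ε / (2 * (‖(d : V)‖ + 1)), by positivity, ?_⟩
        rw [norm_smul, Real.norm_of_nonneg (by positivity), div_mul_eq_mul_div,
          div_lt_iff₀ (by positivity)]
        nlinarith [norm_nonneg (d : V)]
      have hu := hball _ (Submodule.smul_mem _ l d.2) hld
      refine ⟨⟨(l⁻¹ * (ω (z + l • (d : V)) - ω z + K z - K z) - t) • ((0 : T), (1 : ℝ)),
        Submodule.smul_mem _ _ (Submodule.mem_span_singleton_self _)⟩, ?_⟩
      rw [hmem]
      refine ⟨l⁻¹, by positivity, _, hu, z, hzX, ?_, ?_⟩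
      · simp [smul_smul, inv_mul_cancel₀ hl.ne']
      · simp)
  have hg1 : ∀ c : ℝ, g (0, c) = c := by
    intro c
    have hx : c • ((0 : T), (1 : ℝ)) ∈ f.domain :=
      Submodule.smul_mem _ _ (Submodule.mem_span_singleton_self _)
    obtain ⟨c', hc', hf'⟩ := hfdom ⟨_, hx⟩
    have h1 := hgf ⟨_, hx⟩
    have : c' = c := by simpa using (congrArg Prod.snd hc').symm
    rw [hf', this] at h1
    simpa using h1
  obtain ⟨ξ₀, hξ₀⟩ := LinearMap.exists_extend (p := T) (-(g.comp (LinearMap.inl ℝ T ℝ)))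
  have key : ∀ u ∈ D, ∀ w ∈ X, ξ₀ (u - w) ≤ ω u - ω z + K w - K z := by
    intro u hu w hw
    have hd : u - w ∈ T := vsub_mem_vectorSpan ℝ hu (hXD hw)
    have h1 := hgs (⟨u - w, hd⟩, ω u - ω z + K w - K z)
      ((hmem _).2 ⟨1, zero_le_one, u, hu, w, hw, by simp, by simp⟩)
    have h2 : ξ₀ (u - w) = -g (⟨u - w, hd⟩, 0) := by
      have := LinearMap.congr_fun hξ₀ ⟨u - w, hd⟩
      simpa using this
    have h3 : g (⟨u - w, hd⟩, ω u - ω z + K w - K z) =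
        g (⟨u - w, hd⟩, 0) + g (0, ω u - ω z + K w - K z) := by
      rw [← map_add]
      simp
    rw [h3, hg1] at h1
    linarith
  refine ⟨LinearMap.toContinuousLinearMap ξ₀, fun u hu => ?_, fun u hu => ?_⟩
  · have := key u hu z hzX
    simp only [LinearMap.coe_toContinuousLinearMap']
    linarith
  · have := key z hzD u hu
    have e : u - z = -(z - u) := by abel
    simp only [LinearMap.coe_toContinuousLinearMap']
    rw [e, map_neg]
    linarith

/-- Convexity on the segment bounds the limit from above, closedness of the epigraph from below.
This allows arguments at relative interior points to pass to boundary points. -/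
lemma ExtFun.tendsto_segment {F : ExtFun V} (hc : F.IsClosedFun) (hF : ConvexOn ℝ F.dom F.val)
    {z w : V} (hz : z ∈ F.dom) (hw : w ∈ F.dom) :
    Tendsto (fun τ : ℝ => F.val ((1 - τ) • z + τ • w)) (𝓝[>] 0) (𝓝 (F.val z)) := by
  have hτ : ∀ᶠ τ : ℝ in 𝓝[>] 0, 0 < τ ∧ τ < 1 := by
    filter_upwards [Ioo_mem_nhdsGT (zero_lt_one' ℝ)] with τ h using h
  have hup : Tendsto (fun τ : ℝ => (1 - τ) * F.val z + τ * F.val w) (𝓝[>] 0) (𝓝 (F.val z)) := by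
    have : Continuous fun τ : ℝ => (1 - τ) * F.val z + τ * F.val w := by fun_prop
    have h := this.tendsto 0
    simp only [sub_zero, one_mul, zero_mul, add_zero] at h
    exact h.mono_left nhdsWithin_le_nhds
  have hpt : Tendsto (fun τ : ℝ => (1 - τ) • z + τ • w) (𝓝[>] 0) (𝓝 z) := by
    have : Continuous fun τ : ℝ => (1 - τ) • z + τ • w := by fun_prop
    have h := this.tendsto 0
    simp only [sub_zero, one_smul, zero_smul, add_zero] at h
    exact h.mono_left nhdsWithin_le_nhds
  rw [tendsto_order]
  constructor
  · intro α hα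
    by_contra hcon
    have hfr : ∃ᶠ τ : ℝ in 𝓝[>] 0, ((1 - τ) • z + τ • w, α) ∈
        {q : V × ℝ | q.1 ∈ F.dom ∧ F.val q.1 ≤ q.2} := by
      rw [Filter.not_eventually] at hcon
      refine (hcon.and_eventually hτ).mono fun τ h => ⟨?_, not_lt.1 h.1⟩
      exact hF.1 hz hw (by linarith [h.2.2]) h.2.1.le (by ring)
    have := IsClosed.mem_of_frequently_of_tendsto hc hfr (hpt.prodMk_nhds tendsto_const_nhds)
    exact absurd this.2 (not_le.2 hα)
  · intro α hα
    filter_upwards [hτ, hup.eventually_lt_const hα] with τ h h2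
    refine lt_of_le_of_lt ?_ h2
    exact hF.2 hz hw (by linarith [h.2]) h.1.le (by ring)

lemma ExtFun.IsStronglyConvexFor.convexOn {F : ExtFun V} {Z : Set V} {m : ℝ} (hm : 0 ≤ m)
    (h : F.IsStronglyConvexFor Z m) : ConvexOn ℝ F.dom F.val :=
  UniformConvexOn.convexOn h.strongConvex fun r =>
    mul_nonneg (div_nonneg hm zero_le_two) (sq_nonneg r)

/-- Relative strong convexity makes `F - m gen` convex on the feasible set. -/
lemma RelStronglyConvex.convexOn_sub {Z : Set V} {F gen : ExtFun V} {m : ℝ} (hZ : Convex ℝ Z)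
    (hm : 0 ≤ m) (hF : F.IsStronglyConvexFor Z m) (hg : gen.IsStronglyConvexFor Z 1)
    (hrel : RelStronglyConvex Z F gen m) :
    ConvexOn ℝ Z (fun x => F.val x - m * gen.val x) := by
  have hFc := hF.convexOn hm
  have hgc := hg.convexOn zero_le_one
  obtain ⟨x₁, hx₁, hx₁r⟩ := hF.meets_ri
  obtain ⟨x₂, hx₂, hx₂r⟩ := hg.meets_ri
  have hhalf : (0 : ℝ) < 1 / 2 := by norm_num
  -- A point of Z in both relative interiors. Moving a point of Z slightly towards y brings it to
  -- where relative strong convexity provides an affine support of F - m gen; Jensen's inequality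
  -- there survives the limit τ → 0.
  set y : V := (1 / 2 : ℝ) • x₁ + (1 / 2 : ℝ) • x₂ with hy
  have hyZ : y ∈ Z := hZ hx₁ hx₂ hhalf.le hhalf.le (by norm_num)
  have hyF : y ∈ F.ri :=
    combo_mem_intrinsicInterior hFc.1 hx₁r (hF.subset_dom hx₂) hhalf hhalf.le (by norm_num)
  have hyg : y ∈ gen.ri := by
    rw [hy, add_comm]
    exact combo_mem_intrinsicInterior hgc.1 hx₂r (hg.subset_dom hx₁) hhalf hhalf.le (by norm_num)
  have hseg : ∀ x ∈ Z, ∀ τ : ℝ, 0 < τ → τ < 1 →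
      (1 - τ) • x + τ • y ∈ Z ∩ F.ri ∩ gen.ri := by
    intro x hx τ h0 h1
    refine ⟨⟨hZ hx hyZ (by linarith) h0.le (by ring), ?_⟩, ?_⟩
    · rw [add_comm]
      exact combo_mem_intrinsicInterior hFc.1 hyF (hF.subset_dom hx) h0 (by linarith) (by ring)
    · rw [add_comm]
      exact combo_mem_intrinsicInterior hgc.1 hyg (hg.subset_dom hx) h0 (by linarith) (by ring)
  set h : V → ℝ := fun x => F.val x - m * gen.val x with hh
  have hlim : ∀ x ∈ Z, Tendsto (fun τ : ℝ => h ((1 - τ) • x + τ • y)) (𝓝[>] 0) (𝓝 (h x)) := by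
    intro x hx
    exact (F.tendsto_segment hF.closed hFc (hF.subset_dom hx) (hF.subset_dom hyZ)).sub
      ((gen.tendsto_segment hg.closed hgc (hg.subset_dom hx) (hg.subset_dom hyZ)).const_mul m)
  refine ⟨hZ, fun x₁ h1 x₂ h2 a b ha hb hab => ?_⟩
  have hx := hZ h1 h2 ha hb hab
  refine le_of_tendsto_of_tendsto (hlim _ hx)
    (((hlim _ h1).const_smul a).add ((hlim _ h2).const_smul b)) ?_
  filter_upwards [Ioo_mem_nhdsGT (zero_lt_one' ℝ)] with τ hτ
  obtain ⟨s, ξ, -, -, hsup⟩ := hrel _ (hseg _ hx τ hτ.1 hτ.2)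
  have e1 := hsup _ (hseg _ h1 τ hτ.1 hτ.2).1.1
  have e2 := hsup _ (hseg _ h2 τ hτ.1 hτ.2).1.1
  set p := (1 - τ) • (a • x₁ + b • x₂) + τ • y with hp
  set p₁ := (1 - τ) • x₁ + τ • y with hp₁
  set p₂ := (1 - τ) • x₂ + τ • y with hp₂
  have hcomb : a • (p₁ - p) + b • (p₂ - p) = 0 := by
    have hb' : b = 1 - a := by linarith
    rw [hp, hp₁, hp₂, hb']
    module
  have hs := congrArg s hcomb
  have hξ := congrArg ξ hcomb
  simp only [map_add, map_smul, smul_eq_mul, map_zero] at hs hξ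
  simp only [ExtFun.breg] at e1 e2
  simp only [hh, smul_eq_mul]
  have e3 := add_le_add (mul_le_mul_of_nonneg_left e1 ha) (mul_le_mul_of_nonneg_left e2 hb)
  have hb' : b = 1 - a := by linarith
  have e4 : m * (a * ξ (p₁ - p) + b * ξ (p₂ - p)) = 0 := by rw [hξ, mul_zero]
  rw [hb'] at e3 e4 hs ⊢
  linarith

/-- The three-point property of a proximal rule. -/
def HasThreePoint (Z : Set V) (F gen : ExtFun V) (m : ℝ)
    (rule : ℝ → ℝ → (V →L[ℝ] ℝ) → V × (V →L[ℝ] ℝ) → V × (V →L[ℝ] ℝ)) : Prop :=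
  ∀ (a c : ℝ) (g : V →L[ℝ] ℝ) (w : V × (V →L[ℝ] ℝ)), 0 < a → 0 < c → IsCentre Z gen w →
    ∀ u ∈ Z, proxObj F gen a c g w (rule a c g w).1 + (a * m + c) * gen.breg u (rule a c g w) ≤
      proxObj F gen a c g w u

/-- Shifting m · gen from F to the Bregman term leaves gen plus a remainder that is convex on Z, the
form required by `exists_common_subgrad`; the factor a m + c is the one of the three-point
inequality. -/
lemma proxObj_split {F gen : ExtFun V} (m a c : ℝ) (g : V →L[ℝ] ℝ) (w : V × (V →L[ℝ] ℝ)) (x : V)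
    (hκ : a * m + c ≠ 0) :
    proxObj F gen a c g w x = (a * m + c) * (gen.val x + (a * m + c)⁻¹ *
      (a * g x + a * (F.val x - m * gen.val x) - c * (gen.val w.1 + w.2 (x - w.1)))) := by
  rw [mul_add, mul_inv_cancel_left₀ hκ]
  simp only [proxObj, ExtFun.breg]
  ring

lemma convexOn_proxRemainder {Z : Set V} {F gen : ExtFun V} {m a c κ : ℝ} (g : V →L[ℝ] ℝ)
    (w : V × (V →L[ℝ] ℝ)) (h : ConvexOn ℝ Z (fun x => F.val x - m * gen.val x)) (ha : 0 ≤ a)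
    (hκ : 0 ≤ κ) :
    ConvexOn ℝ Z fun x => κ * (a * g x + a * (F.val x - m * gen.val x) -
      c * (gen.val w.1 + w.2 (x - w.1))) := by
  refine ⟨h.1, fun x hx y hy s t hs ht hst => ?_⟩
  have h1 := h.2 hx hy hs ht hst
  have h2 := mul_le_mul_of_nonneg_left (mul_le_mul_of_nonneg_left h1 ha) hκ
  simp only [smul_eq_mul, map_add, map_smul, map_sub] at h2 ⊢
  have ht' : t = 1 - s := by linarith
  rw [ht'] at h2 ⊢
  linarith

/-- With K the convex remainder and z the minimizer, the rule returns a subgradient ξ of gen at z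
with K z ≤ K u + ξ(u - z) on Z. Adding gen u - ξ(u - z) to both sides is the three-point inequality.
-/
theorem exists_proxRule_threePoint [FiniteDimensional ℝ V] {Z : Set V} {F gen : ExtFun V} {m : ℝ}
    (hZ : Convex ℝ Z)
    (hm : 0 ≤ m) (hF : F.IsStronglyConvexFor Z m) (hg : gen.IsStronglyConvexFor Z 1)
    (hrel : RelStronglyConvex Z F gen m) (hprox : ProxSolvable Z F gen) :
    ∃ rule, IsProxRule Z F gen rule ∧ HasThreePoint Z F gen m rule := by
  have hconv := hrel.convexOn_sub hZ hm hF hg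
  have hgc := hg.convexOn zero_le_one
  have key : ∀ (a c : ℝ) (g : V →L[ℝ] ℝ) (w : V × (V →L[ℝ] ℝ)),
      ∃ q : V × (V →L[ℝ] ℝ), 0 < a → 0 < c → IsCentre Z gen w →
        (IsCentre Z gen q ∧ IsMinOn (proxObj F gen a c g w) Z q.1) ∧
        ∀ u ∈ Z, proxObj F gen a c g w q.1 + (a * m + c) * gen.breg u q ≤
          proxObj F gen a c g w u := by
    intro a c g w
    by_cases hh : 0 < a ∧ 0 < c ∧ IsCentre Z gen w
    swap
    · exact ⟨w, fun h1 h2 h3 => absurd ⟨h1, h2, h3⟩ hh⟩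
    obtain ⟨ha, hc, hw⟩ := hh
    obtain ⟨z, hz, hzmin⟩ := hprox a c g w ha hc hw
    have hκ : 0 < a * m + c := by positivity
    obtain ⟨ξ, h1, h2⟩ := exists_common_subgrad hgc
      (convexOn_proxRemainder (c := c) (κ := (a * m + c)⁻¹) g w hconv ha.le (by positivity))
      hg.subset_dom hz.2 hz.1 (fun u hu => by
        have := hzmin hu
        simp only [Set.mem_ofPred_eq] at this
        rw [proxObj_split m a c g w z hκ.ne', proxObj_split m a c g w u hκ.ne'] at this
        exact le_of_mul_le_mul_left this hκ)
    refine ⟨(z, ξ), fun _ _ _ => ⟨⟨⟨hz, hg.subset_dom hz.1, h1⟩, hzmin⟩, fun u hu => ?_⟩⟩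
    rw [proxObj_split m a c g w z hκ.ne', proxObj_split m a c g w u hκ.ne', ← mul_add]
    refine mul_le_mul_of_nonneg_left ?_ hκ.le
    have := h2 u hu
    simp only [ExtFun.breg]
    linarith
  choose rule hrule using key
  exact ⟨rule, fun a c g w ha hc hw => (hrule a c g w ha hc hw).1,
    fun a c g w ha hc hw => (hrule a c g w ha hc hw).2⟩

/-- Along the segment from the minimizer q to u, minimality bounds the slopes of gen from below by
those of -K, which are at least K q - K u by convexity. The slopes of gen tend to ξ(u - q) for
whichever subgradient ξ was chosen. -/
theorem IsProxRule.hasThreePoint {Z : Set V} {F gen : ExtFun V} {m : ℝ}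
    (hZ : Convex ℝ Z)
    (hm : 0 ≤ m) (hF : F.IsStronglyConvexFor Z m) (hg : gen.IsStronglyConvexFor Z 1)
    (hrel : RelStronglyConvex Z F gen m) (hdiff : DifferentiableAlong Z gen)
    {rule : ℝ → ℝ → (V →L[ℝ] ℝ) → V × (V →L[ℝ] ℝ) → V × (V →L[ℝ] ℝ)}
    (hr : IsProxRule Z F gen rule) : HasThreePoint Z F gen m rule := by
  intro a c g w ha hc hw u hu
  obtain ⟨hq, hmin⟩ := hr a c g w ha hc hw
  set q := rule a c g w
  have hκ : 0 < a * m + c := by positivity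
  have hK := convexOn_proxRemainder (c := c) (κ := (a * m + c)⁻¹) g w
    (hrel.convexOn_sub hZ hm hF hg) ha.le (by positivity)
  have hd := hdiff q.1 hq.1 q.2 hq.2 u hu
  rw [proxObj_split m a c g w _ hκ.ne', proxObj_split m a c g w u hκ.ne', ← mul_add]
  refine mul_le_mul_of_nonneg_left ?_ hκ.le
  set K : V → ℝ := fun x => (a * m + c)⁻¹ * (a * g x + a * (F.val x - m * gen.val x) -
      c * (gen.val w.1 + w.2 (x - w.1))) with hKdef
  suffices h : K q.1 - K u ≤ q.2 (u - q.1) by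
    simp only [hKdef] at h
    simp only [ExtFun.breg]
    linarith
  have hd' := (hasDerivWithinAt_iff_tendsto_slope.1 hd)
  have : Set.Ici (0 : ℝ) \ {0} = Set.Ioi 0 := Set.Ici_sdiff_left
  rw [this] at hd'
  refine ge_of_tendsto hd' ?_
  filter_upwards [Ioo_mem_nhdsGT (zero_lt_one' ℝ)] with τ hτ
  have e : q.1 + τ • (u - q.1) = (1 - τ) • q.1 + τ • u := by module
  have hmem : q.1 + τ • (u - q.1) ∈ Z := by
    rw [e]
    exact hZ hq.1.1 hu (by linarith [hτ.2]) hτ.1.le (by ring)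
  have h1 := hmin hmem
  simp only [Set.mem_ofPred_eq] at h1
  rw [proxObj_split m a c g w _ hκ.ne', proxObj_split m a c g w (q.1 + _) hκ.ne'] at h1
  have h2 := le_of_mul_le_mul_left h1 hκ
  have h3 := hK.2 hq.1.1 hu (by linarith [hτ.2]) hτ.1.le (by ring : (1 - τ) + τ = 1)
  rw [← e] at h3
  simp only [smul_eq_mul] at h3
  rw [slope_def_field, le_div_iff₀ (by linarith [hτ.1])]
  simp only [hKdef, zero_smul, add_zero, sub_zero]
  linarith

/-- The subgradient inequality is tested at τ u + (1 - τ) w, where strong convexity supplies the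
quadratic term; then one divides by τ and lets τ → 0. -/
lemma ExtFun.IsStronglyConvexFor.sq_le_breg {gen : ExtFun V} {Z : Set V}
    (hg : gen.IsStronglyConvexFor Z 1) {w : V × (V →L[ℝ] ℝ)} (hw : IsCentre Z gen w) {u : V}
    (hu : u ∈ Z) : ‖u - w.1‖ ^ 2 / 2 ≤ gen.breg u w := by
  have hud := hg.subset_dom hu
  obtain ⟨hwd, hsub⟩ := hw.2
  have key : ∀ τ : ℝ, 0 < τ → τ < 1 →
      (1 - τ) * (1 / 2 * ‖u - w.1‖ ^ 2) ≤ gen.breg u w := by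
    intro τ h0 h1
    have hab : τ + (1 - τ) = 1 := by ring
    have h2 := hg.strongConvex.2 hud hwd h0.le (by linarith) hab
    have h3 := hsub _ (hg.strongConvex.1 hud hwd h0.le (by linarith : 0 ≤ 1 - τ) hab)
    have e : τ • u + (1 - τ) • w.1 - w.1 = τ • (u - w.1) := by module
    rw [e, map_smul] at h3
    simp only [smul_eq_mul] at h2 h3
    have h4 : τ * ((1 - τ) * (1 / 2 * ‖u - w.1‖ ^ 2)) ≤ τ * gen.breg u w := by
      simp only [ExtFun.breg]
      linarith
    exact le_of_mul_le_mul_left h4 h0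
  have hlim : Tendsto (fun τ : ℝ => (1 - τ) * (1 / 2 * ‖u - w.1‖ ^ 2)) (𝓝[>] 0)
      (𝓝 (‖u - w.1‖ ^ 2 / 2)) := by
    have : Continuous fun τ : ℝ => (1 - τ) * (1 / 2 * ‖u - w.1‖ ^ 2) := by fun_prop
    have h := this.tendsto 0
    simp only [sub_zero, one_mul] at h
    rw [show ‖u - w.1‖ ^ 2 / 2 = 1 / 2 * ‖u - w.1‖ ^ 2 by ring]
    exact h.mono_left nhdsWithin_le_nhds
  refine le_of_tendsto hlim ?_
  filter_upwards [Ioo_mem_nhdsGT (zero_lt_one' ℝ)] with τ hτ using key τ hτ.1 hτ.2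

end Convex

/-! ### Norm estimates for the coupling -/

section Norms

/-- Write y_j² = |y_j|^ρ |y_j|^(2-ρ) and bound the last factor by ‖y‖^(2-ρ). The strong convexity of
the dual generator thereby controls Euclidean norms, whose squares add up over the blocks. -/
lemma LpVec.sum_sq_le_norm_sq {n : ℕ} {ρ : ℝ≥0∞} [Fact (1 ≤ ρ)] (hρ : ρ ≤ 2) (y : LpVec n ρ) :
    ∑ j, y j ^ 2 ≤ ‖y‖ ^ 2 := by
  have hρ1 : (1 : ℝ≥0∞) ≤ ρ := Fact.out
  have htop : ρ ≠ ∞ := ne_top_of_le_ne_top (by simp) hρ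
  have h1 : 1 ≤ ρ.toReal := by
    simpa using ENNReal.toReal_mono htop hρ1
  have h2 : ρ.toReal ≤ 2 := by
    simpa using ENNReal.toReal_mono (by simp) hρ
  have hpos : 0 < ρ.toReal := by linarith
  have hsum : ‖y‖ ^ ρ.toReal = ∑ j, |y j| ^ ρ.toReal := by
    rw [PiLp.norm_eq_sum hpos, ← Real.rpow_mul (Finset.sum_nonneg fun _ _ => by positivity)]
    simp [hpos.ne']
  have hle : ∀ j, |y j| ≤ ‖y‖ := fun j => by simpa using PiLp.norm_apply_le y j
  have hterm : ∀ j, y j ^ 2 ≤ |y j| ^ ρ.toReal * ‖y‖ ^ (2 - ρ.toReal) := by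
    intro j
    have e : y j ^ 2 = |y j| ^ ρ.toReal * |y j| ^ (2 - ρ.toReal) := by
      rw [← Real.rpow_add_of_nonneg (abs_nonneg _) hpos.le (by linarith), add_sub_cancel]
      norm_num
    rw [e]
    gcongr
    exact hle j
  calc ∑ j, y j ^ 2 ≤ ∑ j, |y j| ^ ρ.toReal * ‖y‖ ^ (2 - ρ.toReal) :=
        Finset.sum_le_sum fun j _ => hterm j
    _ = ‖y‖ ^ 2 := by
        rw [← Finset.sum_mul, ← hsum,
          ← Real.rpow_add_of_nonneg (norm_nonneg _) hpos.le (by linarith), add_sub_cancel]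
        norm_num

variable {E : Type*} [NormedAddCommGroup E] [NormedSpace ℝ E]

lemma ConvexOn.add_fderiv_le {f : E → ℝ} (hf : ConvexOn ℝ Set.univ f) {x : E}
    (hx : DifferentiableAt ℝ f x) (u : E) : f x + fderiv ℝ f x (u - x) ≤ f u := by
  have hd : HasDerivWithinAt (fun τ : ℝ => f (x + τ • (u - x))) (fderiv ℝ f x (u - x))
      (Set.Ioi 0) 0 := by
    have h1 : HasDerivAt (fun τ : ℝ => x + τ • (u - x)) (u - x) 0 := by
      simpa using ((hasDerivAt_id (0 : ℝ)).smul_const (u - x)).const_add x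
    have h2 : HasFDerivAt f (fderiv ℝ f x) (x + (0 : ℝ) • (u - x)) := by
      simpa using hx.hasFDerivAt
    exact (h2.comp_hasDerivAt (0 : ℝ) h1).hasDerivWithinAt
  have hd' := hasDerivWithinAt_iff_tendsto_slope.1 hd
  rw [Set.sdiff_singleton_eq_self (by simp)] at hd'
  suffices h : fderiv ℝ f x (u - x) ≤ f u - f x by linarith
  refine le_of_tendsto hd' ?_
  filter_upwards [Ioo_mem_nhdsGT (zero_lt_one' ℝ)] with τ hτ
  have e : x + τ • (u - x) = (1 - τ) • x + τ • u := by module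
  have h3 := hf.2 (Set.mem_univ x) (Set.mem_univ u) (by linarith [hτ.2]) hτ.1.le
    (by ring : (1 - τ) + τ = 1)
  rw [← e] at h3
  simp only [smul_eq_mul] at h3
  rw [slope_def_field, div_le_iff₀ (by linarith [hτ.1])]
  simp only [zero_smul, add_zero, sub_zero]
  linarith

variable {n N : ℕ} {ρ : ℝ≥0∞} [Fact (1 ≤ ρ)]

/-- The gradient inequality of f_j may be multiplied by y_j ≥ 0; where the sign of y_j is unknown,
f_j is affine and equality holds. -/
lemma Problem.IsAdmissible.coupling_le {pb : Problem E n N ρ} (hpb : pb.IsAdmissible) {x : E}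
    (hx : x ∈ pb.X) {y : LpVec n ρ} (hy : y ∈ pb.Y) (u : E) :
    ∑ j, y j * pb.f j x + ∑ j, y j * fderiv ℝ (pb.f j) x (u - x) ≤ ∑ j, y j * pb.f j u := by
  rw [← Finset.sum_add_distrib]
  refine Finset.sum_le_sum fun j _ => ?_
  rcases hpb.sign j with ⟨l, b, hl⟩ | hs
  · have hfd : HasFDerivAt (pb.f j) l x := by
      have : pb.f j = fun x => l x + b := funext hl
      rw [this]
      exact l.hasFDerivAt.add_const b
    rw [hfd.fderiv, hl, hl, map_sub]
    apply le_of_eq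
    ring
  · have := ConvexOn.add_fderiv_le (hpb.convex_f j) (hpb.differentiable_f j x hx) u
    have := mul_le_mul_of_nonneg_left this (hs y hy)
    linarith

/-- The mean value inequality for the scalar function ∑ z_j f_j with the frozen coefficients z =
f(x) - f(x') reads σ ≤ G √σ ‖x - x'‖, where σ is the left-hand side; then √σ cancels. -/
lemma Problem.IsAdmissible.sum_sq_sub_le {pb : Problem E n N ρ} (hpb : pb.IsAdmissible) (J : Fin N)
    {x x' : E} (hx : x ∈ pb.X) (hx' : x' ∈ pb.X) :
    ∑ j with pb.blk j = J, (pb.f j x - pb.f j x') ^ 2 ≤ pb.G J ^ 2 * ‖x - x'‖ ^ 2 := by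
  set z : Fin n → ℝ := fun j => pb.f j x - pb.f j x' with hz
  set σ := ∑ j with pb.blk j = J, z j ^ 2 with hσ
  have hσ0 : 0 ≤ σ := Finset.sum_nonneg fun _ _ => sq_nonneg _
  have hder : ∀ w ∈ pb.X, HasFDerivWithinAt (fun w => ∑ j with pb.blk j = J, z j * pb.f j w)
      (∑ j with pb.blk j = J, z j • fderiv ℝ (pb.f j) w) pb.X w := by
    intro w hw
    refine HasFDerivAt.hasFDerivWithinAt ?_
    refine HasFDerivAt.fun_sum fun j _ => ?_
    exact (hpb.differentiable_f j w hw).hasFDerivAt.const_mul (z j)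
  have h := hpb.convex_X.norm_image_sub_le_of_norm_hasFDerivWithin_le hder
    (fun w hw => hpb.lipschitz J w hw z) hx' hx
  have e : ∑ j with pb.blk j = J, z j * pb.f j x - ∑ j with pb.blk j = J, z j * pb.f j x' = σ := by
    rw [← Finset.sum_sub_distrib]
    refine Finset.sum_congr rfl fun j _ => ?_
    simp only [hz]
    ring
  rw [e, Real.norm_of_nonneg hσ0] at h
  have h1 : √σ * √σ = σ := Real.mul_self_sqrt hσ0
  have h2 : √σ ≤ pb.G J * ‖x - x'‖ := by
    rcases hσ0.eq_or_lt with h0 | h0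
    · rw [← h0, Real.sqrt_zero]
      exact mul_nonneg (hpb.G_nonneg J) (norm_nonneg _)
    · have hs : 0 < √σ := Real.sqrt_pos.2 h0
      have : √σ * √σ ≤ (pb.G J * ‖x - x'‖) * √σ := by
        rw [h1]
        linarith
      exact le_of_mul_le_mul_right this hs
  calc σ = √σ ^ 2 := by rw [sq, h1]
    _ ≤ (pb.G J * ‖x - x'‖) ^ 2 := by gcongr
    _ = _ := by ring

/-- The difference is split so that smoothness is applied with y ∈ Y only. The vector y' stands for
the dual table, whose blocks come from different iterates and which need not lie in Y; it enters
only through the bound by G, valid for all coefficients. -/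
lemma Problem.IsAdmissible.norm_grad_sub_sq_le {pb : Problem E n N ρ} (hpb : pb.IsAdmissible)
    (J : Fin N) {x : E} {xh : Fin N → E} (hx : x ∈ pb.X) (hx' : xh J ∈ pb.X) {y : LpVec n ρ}
    (hy : y ∈ pb.Y) (y' : LpVec n ρ) :
    ‖∑ j with pb.blk j = J, (y j • fderiv ℝ (pb.f j) x -
        y' j • fderiv ℝ (pb.f j) (xh (pb.blk j)))‖ ^ 2 ≤
      2 * pb.L J ^ 2 * ‖x - xh J‖ ^ 2 +
        2 * pb.G J ^ 2 * ∑ j with pb.blk j = J, (y j - y' j) ^ 2 := by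
  have e : ∑ j with pb.blk j = J, (y j • fderiv ℝ (pb.f j) x -
        y' j • fderiv ℝ (pb.f j) (xh (pb.blk j))) =
      (∑ j with pb.blk j = J, y j • (fderiv ℝ (pb.f j) x - fderiv ℝ (pb.f j) (xh J))) +
      ∑ j with pb.blk j = J, (y j - y' j) • fderiv ℝ (pb.f j) (xh J) := by
    rw [← Finset.sum_add_distrib]
    refine Finset.sum_congr rfl fun j hj => ?_
    rw [(Finset.mem_filter.1 hj).2]
    module
  have h1 := hpb.smooth J y hy x hx (xh J) hx'
  have h2 := hpb.lipschitz J (xh J) hx' (fun j => y j - y' j)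
  set σ := ∑ j with pb.blk j = J, (y j - y' j) ^ 2
  have hσ0 : 0 ≤ σ := Finset.sum_nonneg fun _ _ => sq_nonneg _
  have h3 : √σ ^ 2 = σ := Real.sq_sqrt hσ0
  rw [e]
  calc _ ≤ (pb.L J * ‖x - xh J‖ + pb.G J * √σ) ^ 2 := by
        gcongr
        exact (norm_add_le _ _).trans (add_le_add h1 h2)
    _ ≤ 2 * (pb.L J * ‖x - xh J‖) ^ 2 + 2 * (pb.G J * √σ) ^ 2 := by
        nlinarith [sq_nonneg (pb.L J * ‖x - xh J‖ - pb.G J * √σ)]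
    _ = _ := by rw [mul_pow, mul_pow, h3]; ring

end Norms

/-! ### Averages over sampled blocks and the drift of stale entries -/

section Averages

variable {N : ℕ}

lemma sum_mul_le_of_le {w : Fin N → ℝ} (hw : ∀ i, 0 ≤ w i) (hs : ∑ i, w i = 1) {φ ψ : Fin N → ℝ}
    {C : ℝ} (h : ∀ i, φ i ≤ ψ i + C) : ∑ i, w i * φ i ≤ ∑ i, w i * ψ i + C := by
  calc ∑ i, w i * φ i ≤ ∑ i, w i * (ψ i + C) :=
        Finset.sum_le_sum fun i _ => mul_le_mul_of_nonneg_left (h i) (hw i)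
    _ = _ := by simp_rw [mul_add, Finset.sum_add_distrib, ← Finset.sum_mul, hs, one_mul]

lemma sum_mul_const {w : Fin N → ℝ} (hs : ∑ i, w i = 1) (C : ℝ) : ∑ i, w i * C = C := by
  rw [← Finset.sum_mul, hs, one_mul]

/-- Block I stays stale unless it is sampled, which has probability 1 - w I. This factor is the
contraction behind the whole argument. -/
lemma sum_mul_stale {w : Fin N → ℝ} (hs : ∑ i, w i = 1) (W Z : Fin N → ℝ) :
    ∑ R, w R * ∑ I, W I * (if I = R then 0 else Z I) = ∑ I, W I * (1 - w I) * Z I := by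
  simp_rw [Finset.mul_sum]
  rw [Finset.sum_comm]
  refine Finset.sum_congr rfl fun I _ => ?_
  have : ∀ R, w R * (W I * (if I = R then 0 else Z I)) =
      W I * Z I * w R - (if I = R then W I * Z I * w R else 0) := by
    intro R
    split_ifs <;> ring
  simp_rw [this]
  rw [Finset.sum_sub_distrib, ← Finset.mul_sum, hs, Finset.sum_ite_eq Finset.univ I]
  simp
  ring

/-- Averaging a one-step bound over the four sampled blocks. -/
lemma sum_four_le {p q r s : Fin N → ℝ} (hp : ∀ i, 0 ≤ p i) (hq : ∀ i, 0 ≤ q i)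
    (hr : ∀ i, 0 ≤ r i) (hs : ∀ i, 0 ≤ s i) (hp1 : ∑ i, p i = 1) (hq1 : ∑ i, q i = 1)
    (hr1 : ∑ i, r i = 1) (hs1 : ∑ i, s i = 1) {Ψ : Fin N → Fin N → Fin N → Fin N → ℝ}
    {A B DX : Fin N → ℝ} {DY : Fin N → Fin N → Fin N → ℝ} {ZX : Fin N → Fin N → ℝ}
    {ZY : Fin N → Fin N → Fin N → Fin N → ℝ} {α β WX WY : Fin N → ℝ} {CX CY : ℝ}
    (hΨ : ∀ P Q R S, Ψ P Q R S ≤ A P + B Q - DX P - DY P Q R + ∑ I, α I * ZX P I +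
      ∑ I, WX I * (if I = R then 0 else ZX P I) + ∑ I, β I * ZY P Q R I +
      ∑ I, WY I * (if I = S then 0 else ZY P Q R I))
    (hX : ∀ P, ∑ I, (α I + WX I * (1 - r I)) * ZX P I - DX P ≤ CX)
    (hY : ∀ P Q R, ∑ I, (β I + WY I * (1 - s I)) * ZY P Q R I - DY P Q R ≤ CY) :
    ∑ P, p P * ∑ Q, q Q * ∑ R, r R * ∑ S, s S * Ψ P Q R S ≤
      ∑ P, p P * A P + ∑ Q, q Q * B Q + CX + CY := by
  -- Averaging proceeds from S outwards to P. The primal lag `ZX` depends on P alone and the dual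
  -- lag `ZY` on P, Q, R, so each is constant in the sample that refreshes its table.
  have h1 : ∀ P Q R, ∑ S, s S * Ψ P Q R S ≤ ∑ I, WX I * (if I = R then 0 else ZX P I) +
      (A P + B Q - DX P + ∑ I, α I * ZX P I + CY) := by
    intro P Q R
    refine (sum_mul_le_of_le hs hs1 (C := A P + B Q - DX P - DY P Q R + ∑ I, α I * ZX P I +
      ∑ I, WX I * (if I = R then 0 else ZX P I) + ∑ I, β I * ZY P Q R I)
      (ψ := fun S => ∑ I, WY I * (if I = S then 0 else ZY P Q R I))
      fun S => (hΨ P Q R S).trans (by linarith)).trans ?_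
    rw [sum_mul_stale hs1]
    have := hY P Q R
    simp_rw [add_mul, Finset.sum_add_distrib] at this
    linarith
  have h2 : ∀ P Q, ∑ R, r R * ∑ S, s S * Ψ P Q R S ≤ B Q + (A P + CX + CY) := by
    intro P Q
    refine (sum_mul_le_of_le hr hr1 fun R => h1 P Q R).trans ?_
    rw [sum_mul_stale hr1]
    have := hX P
    simp_rw [add_mul, Finset.sum_add_distrib] at this
    linarith
  have h3 : ∀ P, ∑ Q, q Q * ∑ R, r R * ∑ S, s S * Ψ P Q R S ≤ A P + (∑ Q, q Q * B Q + CX + CY) :=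
    fun P => (sum_mul_le_of_le hq hq1 fun Q => h2 P Q).trans (by linarith)
  exact (sum_mul_le_of_le hp hp1 h3).trans (by linarith)

/-- The growth of a staleness potential with coefficient `15 κ / r`. -/
lemma stale_growth {r δ κ κ' Z H D : ℝ} (hr : 0 < r) (hr1 : r ≤ 1) (hδ0 : 0 ≤ δ)
    (hδ : δ ≤ r / 4) (hκ' : 0 ≤ κ') (hκ : κ' ≤ (1 + δ) * κ) (hH : 0 ≤ H) (hD : 0 ≤ D)
    (hZ : Z ≤ (1 + r / 2) * H + (1 + 2 / r) * D) :
    (2 * κ' + 15 * κ' / r * (1 - r)) * Z ≤ 15 * κ / r * H + 36 * κ' / r ^ 2 * D := by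
  have h1r : 0 ≤ 1 - r := by linarith
  have hc : 0 ≤ 2 * κ' + 15 * κ' / r * (1 - r) := by positivity
  have hκ0 : 0 ≤ κ := by
    by_contra h
    nlinarith
  refine (mul_le_mul_of_nonneg_left hZ hc).trans ?_
  rw [mul_add, ← mul_assoc, ← mul_assoc]
  refine add_le_add (mul_le_mul_of_nonneg_right ?_ hH) (mul_le_mul_of_nonneg_right ?_ hD)
  · have e : (2 * κ' + 15 * κ' / r * (1 - r)) * (1 + r / 2) =
        κ' * ((2 * r + 15 * (1 - r)) * (1 + r / 2)) / r := by
      field_simp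
    rw [e]
    refine div_le_div_of_nonneg_right ?_ hr.le
    -- The refresh factor 1 - r beats the factors 1 + r/2 (Young) and 1 + r/4 (growth of κ): 15 (1 -
    -- r)(1 + r/2)(1 + r/4) falls below 15 by at least 15 r/4, which leaves room for the term with 2
    -- r.
    have h2 : (2 * r + 15 * (1 - r)) * (1 + r / 2) * (1 + δ) ≤ 15 := by
      have h3 : 0 ≤ (2 * r + 15 * (1 - r)) * (1 + r / 2) := by
        apply mul_nonneg <;> nlinarith
      calc _ ≤ (2 * r + 15 * (1 - r)) * (1 + r / 2) * (1 + r / 4) := by gcongr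
        _ ≤ 15 := by nlinarith [mul_nonneg hr.le h1r, mul_nonneg (mul_nonneg hr.le hr.le) hr.le]
    have h3 : 0 ≤ (2 * r + 15 * (1 - r)) * (1 + r / 2) := by
      apply mul_nonneg <;> nlinarith
    calc _ ≤ (1 + δ) * κ * ((2 * r + 15 * (1 - r)) * (1 + r / 2)) := by gcongr
      _ = κ * ((2 * r + 15 * (1 - r)) * (1 + r / 2) * (1 + δ)) := by ring
      _ ≤ κ * 15 := by gcongr
      _ = _ := by ring
  · have e : (2 * κ' + 15 * κ' / r * (1 - r)) * (1 + 2 / r) =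
        κ' * ((2 * r + 15 * (1 - r)) * (r + 2)) / r ^ 2 := by
      field_simp
    rw [e]
    refine div_le_div_of_nonneg_right ?_ (by positivity)
    have : (2 * r + 15 * (1 - r)) * (r + 2) ≤ 36 := by nlinarith
    nlinarith

/-- The growth of a staleness potential with coefficient `4 κ / r`. -/
lemma stale_growth' {r δ κ κ' Z H D : ℝ} (hr : 0 < r) (hr1 : r ≤ 1) (hδ0 : 0 ≤ δ)
    (hδ : δ ≤ r / 4) (hκ' : 0 ≤ κ') (hκ : κ' ≤ (1 + δ) * κ) (hH : 0 ≤ H) (hD : 0 ≤ D)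
    (hZ : Z ≤ (1 + r / 2) * H + (1 + 2 / r) * D) :
    4 * κ' / r * (1 - r) * Z + κ * H ≤ 4 * κ / r * H + 8 * κ' / r ^ 2 * D := by
  have h1r : 0 ≤ 1 - r := by linarith
  have hc : 0 ≤ 4 * κ' / r * (1 - r) := by positivity
  have hκ0 : 0 ≤ κ := by
    by_contra h
    nlinarith
  have h := mul_le_mul_of_nonneg_left hZ hc
  rw [mul_add, ← mul_assoc, ← mul_assoc] at h
  have hA : 4 * κ' / r * (1 - r) * (1 + r / 2) + κ ≤ 4 * κ / r := by
    have e : 4 * κ' / r * (1 - r) * (1 + r / 2) + κ =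
        (κ' * (4 * (1 - r) * (1 + r / 2)) + κ * r) / r := by
      field_simp
    rw [e]
    refine div_le_div_of_nonneg_right ?_ hr.le
    have h3 : 0 ≤ 4 * (1 - r) * (1 + r / 2) := by positivity
    -- Since 4 (1 - r)(1 + r/2)(1 + r/4) ≤ 4 - r, the drift pays for the additional κ H. In
    -- `lyap_step` that term cancels the squared value errors of the current iteration.
    have h2 : (4 * (1 - r) * (1 + r / 2)) * (1 + δ) + r ≤ 4 := by
      calc _ ≤ (4 * (1 - r) * (1 + r / 2)) * (1 + r / 4) + r := by gcongr
        _ ≤ 4 := by nlinarith [mul_nonneg hr.le h1r, mul_nonneg (mul_nonneg hr.le hr.le) hr.le]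
    calc _ ≤ (1 + δ) * κ * (4 * (1 - r) * (1 + r / 2)) + κ * r := by gcongr
      _ = κ * ((4 * (1 - r) * (1 + r / 2)) * (1 + δ) + r) := by ring
      _ ≤ κ * 4 := by gcongr
      _ = _ := by ring
  have hB : 4 * κ' / r * (1 - r) * (1 + 2 / r) ≤ 8 * κ' / r ^ 2 := by
    have e : 4 * κ' / r * (1 - r) * (1 + 2 / r) = κ' * (4 * (1 - r) * (r + 2)) / r ^ 2 := by
      field_simp
    rw [e]
    refine div_le_div_of_nonneg_right ?_ (by positivity)
    have : 4 * (1 - r) * (r + 2) ≤ 8 := by nlinarith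
    nlinarith
  have h1 := mul_le_mul_of_nonneg_right hA hH
  have h2 := mul_le_mul_of_nonneg_right hB hD
  linarith

/-- Young's inequality for a squared sum, in the form used for stale entries. -/
lemma add_sq_le_stale {r a b : ℝ} (hr : 0 < r) :
    (a + b) ^ 2 ≤ (1 + r / 2) * a ^ 2 + (1 + 2 / r) * b ^ 2 := by
  have h : 0 ≤ (r / 2 * a - b) ^ 2 * (2 / r) := by positivity
  have e : (r / 2 * a - b) ^ 2 * (2 / r) = r / 2 * a ^ 2 - 2 * a * b + 2 / r * b ^ 2 := by
    field_simp
    ring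
  nlinarith

end Averages

/-! ### One iteration with fixed samples -/

section Step

variable {E : Type*} [NormedAddCommGroup E] [NormedSpace ℝ E]
variable {n N : ℕ} {ρ : ℝ≥0∞} [Fact (1 ≤ ρ)]

/-- The error of the gradient of block `I` that enters the gradient estimate. -/
def gradErr (pb : Problem E n N ρ) (st : AlgState E n N ρ) (I : Fin N) : E →L[ℝ] ℝ :=
  ∑ i with pb.blk i = I, (st.y.1 i • fderiv ℝ (pb.f i) st.x.1 -
    st.yhatPrev i • fderiv ℝ (pb.f i) (st.xhatPrev (pb.blk i)))

/-- The error of the `j`-th value in the primal table. -/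
def valErr (pb : Problem E n N ρ) (st : AlgState E n N ρ) (j : Fin n) : ℝ :=
  pb.f j st.x.1 - pb.f j (st.xhat (pb.blk j))

/-- The coefficient of the Bregman divergence in iteration `k + 1`. -/
def proxCoef (a : ℕ → ℝ) (m m₀ : ℝ) (k : ℕ) : ℝ := (cumSum a k * m + m₀) / 2

/-- The part of the Lyapunov function that telescopes without averaging. -/
def lyapMain (pb : Problem E n N ρ) (u : E) (v : LpVec n ρ) (a c d : ℝ)
    (st : AlgState E n N ρ) : ℝ :=
  c * pb.genX.breg u st.x + d * pb.genY.breg v st.y +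
    a * (∑ I, gradErr pb st I) (u - st.x.1) - a * ∑ j, (v j - st.y.1 j) * valErr pb st j

/-- The feasibility invariant of the method. -/
structure AlgState.IsFeasible (st : AlgState E n N ρ) (pb : Problem E n N ρ) : Prop where
  x_centre : IsCentre pb.X pb.genX st.x
  y_centre : IsCentre pb.Y pb.genY st.y
  xhat_mem : ∀ I, st.xhat I ∈ pb.X

lemma cumSum_succ (a : ℕ → ℝ) (k : ℕ) : cumSum a (k + 1) = cumSum a k + a (k + 1) := by
  rw [cumSum, Finset.sum_range_succ]
  rfl

lemma cumSum_nonneg {a : ℕ → ℝ} (h0 : a 0 = 0) (ha : ∀ k, 1 ≤ k → 0 < a k) (k : ℕ) :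
    0 ≤ cumSum a k := by
  refine Finset.sum_nonneg fun i _ => ?_
  rcases Nat.eq_zero_or_pos i with rfl | h
  · exact h0.ge
  · exact (ha i h).le

lemma proxCoef_succ (a : ℕ → ℝ) (m m₀ : ℝ) (k : ℕ) :
    proxCoef a m m₀ (k + 1) = proxCoef a m m₀ k + a (k + 1) * m / 2 := by
  rw [proxCoef, proxCoef, cumSum_succ]
  ring

lemma proxCoef_pos {a : ℕ → ℝ} (h0 : a 0 = 0) (ha : ∀ k, 1 ≤ k → 0 < a k) {m m₀ : ℝ}
    (hm : 0 ≤ m) (hm₀ : 0 < m₀) (k : ℕ) : 0 < proxCoef a m m₀ k := by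
  have := mul_nonneg (cumSum_nonneg h0 ha k) hm
  rw [proxCoef]
  linarith

lemma proxCoef_le_succ {a : ℕ → ℝ} (ha : ∀ k, 1 ≤ k → 0 < a k) {m m₀ : ℝ}
    (hm : 0 ≤ m) (k : ℕ) : proxCoef a m m₀ k ≤ proxCoef a m m₀ (k + 1) := by
  rw [proxCoef_succ]
  have := mul_nonneg (ha (k + 1) (by omega)).le hm
  linarith

variable {pb : Problem E n N ρ} {pm : Params E n N ρ}
  {ruleX : ℝ → ℝ → (E →L[ℝ] ℝ) → E × (E →L[ℝ] ℝ) → E × (E →L[ℝ] ℝ)}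
  {ruleY : ℝ → ℝ → (LpVec n ρ →L[ℝ] ℝ) → LpVec n ρ × (LpVec n ρ →L[ℝ] ℝ) →
    LpVec n ρ × (LpVec n ρ →L[ℝ] ℝ)}
  {a : ℕ → ℝ}

lemma isFeasible_algStep (hm : 0 ≤ pb.μ) (hn : 0 ≤ pb.ν)
    (hm₀ : 0 < pm.μ₀) (hn₀ : 0 < pm.ν₀)
    (hrX : IsProxRule pb.X pb.φ pb.genX ruleX) (hrY : IsProxRule pb.Y pb.ψ pb.genY ruleY)
    (h0 : a 0 = 0) (ha : ∀ k, 1 ≤ k → 0 < a k)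
    (k : ℕ) (P Q R S : Fin N) {st : AlgState E n N ρ} (hst : st.IsFeasible pb) :
    (algStep pb pm ruleX ruleY a k P Q R S st).IsFeasible pb := by
  have hx : IsCentre pb.X pb.genX (algStep pb pm ruleX ruleY a k P Q R S st).x :=
    (hrX _ _ _ _ (ha (k + 1) (by omega)) (proxCoef_pos h0 ha hm hm₀ k) hst.x_centre).1
  refine ⟨hx, (hrY _ _ _ _ (ha (k + 1) (by omega)) (proxCoef_pos h0 ha hn hn₀ k)
    hst.y_centre).1, fun I => ?_⟩
  change (if I = R then (algStep pb pm ruleX ruleY a k P Q R S st).x.1 else st.xhat I) ∈ pb.X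
  split_ifs
  · exact hx.1.1
  · exact hst.xhat_mem I

lemma pairing_apply (c : Fin n → ℝ) (y : LpVec n ρ) : pairing ρ c y = ∑ j, c j * y j := by
  simp [pairing]

lemma gradEst_eq (k : ℕ) (P : Fin N) (st : AlgState E n N ρ) :
    gradEst pb pm a k P st = ∑ i, st.yhat i • fderiv ℝ (pb.f i) (st.xhat (pb.blk i)) +
      (a k / (pm.p P * a (k + 1))) • gradErr pb st P := rfl

lemma sum_gradErr (st : AlgState E n N ρ) : ∑ I, gradErr pb st I =
    ∑ i, st.y.1 i • fderiv ℝ (pb.f i) st.x.1 -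
      ∑ i, st.yhatPrev i • fderiv ℝ (pb.f i) (st.xhatPrev (pb.blk i)) := by
  rw [← Finset.sum_sub_distrib]
  exact Finset.sum_fiberwise (s := Finset.univ) (g := pb.blk) _

/-- The bound on the gap that one iteration yields before the error terms are estimated. -/
lemma gap_step_le (hpb : pb.IsAdmissible) (hpm : pm.IsAdmissible pb)
    (hrX : IsProxRule pb.X pb.φ pb.genX ruleX) (hrY : IsProxRule pb.Y pb.ψ pb.genY ruleY)
    (htX : HasThreePoint pb.X pb.φ pb.genX pb.μ ruleX)
    (htY : HasThreePoint pb.Y pb.ψ pb.genY pb.ν ruleY)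
    (h0 : a 0 = 0) (ha : ∀ k, 1 ≤ k → 0 < a k)
    {u : E} (hu : u ∈ pb.X) {v : LpVec n ρ} (hv : v ∈ pb.Y)
    (k : ℕ) (P Q R S : Fin N) {st st' : AlgState E n N ρ} (hst : st.IsFeasible pb)
    (hst' : st' = algStep pb pm ruleX ruleY a k P Q R S st) :
    a (k + 1) * pb.gap u v st'.x.1 st'.y.1 + lyapMain pb u v (a (k + 1))
        (proxCoef a pb.μ pm.μ₀ (k + 1)) (proxCoef a pb.ν pm.ν₀ (k + 1)) st' ≤
      proxCoef a pb.μ pm.μ₀ k * pb.genX.breg u st.x +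
      proxCoef a pb.ν pm.ν₀ k * pb.genY.breg v st.y +
      a k / pm.p P * gradErr pb st P (u - st'.x.1) -
      a k / pm.q Q * ∑ j with pb.blk j = Q, (v j - st'.y.1 j) * valErr pb st j -
      proxCoef a pb.μ pm.μ₀ k * pb.genX.breg st'.x.1 st.x -
      proxCoef a pb.ν pm.ν₀ k * pb.genY.breg st'.y.1 st.y := by
  have ha1 : 0 < a (k + 1) := ha (k + 1) (by omega)
  have hc := proxCoef_pos h0 ha hpb.μ_nonneg hpm.μ₀_pos k
  have hd := proxCoef_pos h0 ha hpb.ν_nonneg hpm.ν₀_pos k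
  have hfe : st'.IsFeasible pb := by
    rw [hst']
    exact isFeasible_algStep hpb.μ_nonneg hpb.ν_nonneg hpm.μ₀_pos hpm.ν₀_pos hrX hrY h0 ha
      k P Q R S hst
  have hX := htX (a (k + 1)) (proxCoef a pb.μ pm.μ₀ k) (gradEst pb pm a k P st) st.x ha1 hc
    hst.x_centre u hu
  have hY := htY (a (k + 1)) (proxCoef a pb.ν pm.ν₀ k)
    (-pairing ρ (valEst pb pm a k Q st st'.xhat)) st.y ha1 hd hst.y_centre v hv
  have ex : ruleX (a (k + 1)) (proxCoef a pb.μ pm.μ₀ k) (gradEst pb pm a k P st) st.x = st'.x := by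
    rw [hst']; rfl
  have ey : ruleY (a (k + 1)) (proxCoef a pb.ν pm.ν₀ k)
      (-pairing ρ (valEst pb pm a k Q st st'.xhat)) st.y = st'.y := by
    rw [hst']; rfl
  rw [ex] at hX
  rw [ey] at hY
  have hxp : st'.xhatPrev = st.xhat := by rw [hst']; rfl
  have hyp : st'.yhatPrev = st.yhat := by rw [hst']; rfl
  have hcpl := hpb.coupling_le hfe.x_centre.1.1 hfe.y_centre.1.1 u
  have hbx : 0 ≤ pb.genX.breg u st'.x :=
    le_trans (by positivity) (hpb.genX_convex.sq_le_breg hfe.x_centre hu)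
  have hby : 0 ≤ pb.genY.breg v st'.y :=
    le_trans (by positivity) (hpb.genY_convex.sq_le_breg hfe.y_centre hv)
  -- The estimate equals the gradient at the new iterates, minus the error of the new state, plus
  -- the weighted old error of block P. The average of the last term over P restores the total old
  -- error when tested against a vector independent of P.
  have hg : a (k + 1) * gradEst pb pm a k P st (u - st'.x.1) =
      a (k + 1) * ∑ j, st'.y.1 j * fderiv ℝ (pb.f j) st'.x.1 (u - st'.x.1) -
      a (k + 1) * (∑ I, gradErr pb st' I) (u - st'.x.1) +
      a k / pm.p P * gradErr pb st P (u - st'.x.1) := by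
    have hp := (hpm.p_pos P).ne'
    rw [gradEst_eq, sum_gradErr, hxp, hyp]
    simp only [add_apply, sub_apply,
      sum_apply, smul_apply, smul_eq_mul]
    have : a (k + 1) * (a k / (pm.p P * a (k + 1)) * gradErr pb st P (u - st'.x.1)) =
        a k / pm.p P * gradErr pb st P (u - st'.x.1) := by
      field_simp
    rw [mul_add, this]
    ring
  have hval : a (k + 1) * ∑ j, valEst pb pm a k Q st st'.xhat j * (v j - st'.y.1 j) =
      a (k + 1) * ∑ j, (v j - st'.y.1 j) * pb.f j st'.x.1 -
      a (k + 1) * ∑ j, (v j - st'.y.1 j) * valErr pb st' j +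
      a k / pm.q Q * ∑ j with pb.blk j = Q, (v j - st'.y.1 j) * valErr pb st j := by
    have hq := (hpm.q_pos Q).ne'
    rw [Finset.sum_filter, Finset.mul_sum, Finset.mul_sum, Finset.mul_sum, Finset.mul_sum,
      ← Finset.sum_sub_distrib, ← Finset.sum_add_distrib]
    refine Finset.sum_congr rfl fun j _ => ?_
    simp only [valEst, valErr]
    split_ifs
    · field_simp
      ring
    · ring
  have e1 : gradEst pb pm a k P st (u - st'.x.1) =
      gradEst pb pm a k P st u - gradEst pb pm a k P st st'.x.1 := map_sub _ _ _
  have e2 : ∑ j, valEst pb pm a k Q st st'.xhat j * (v j - st'.y.1 j) =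
      pairing ρ (valEst pb pm a k Q st st'.xhat) v -
        pairing ρ (valEst pb pm a k Q st st'.xhat) st'.y.1 := by
    rw [pairing_apply, pairing_apply, ← Finset.sum_sub_distrib]
    exact Finset.sum_congr rfl fun j _ => by ring
  have e3 : ∑ j, (v j - st'.y.1 j) * pb.f j st'.x.1 =
      ∑ j, v j * pb.f j st'.x.1 - ∑ j, st'.y.1 j * pb.f j st'.x.1 := by
    rw [← Finset.sum_sub_distrib]
    exact Finset.sum_congr rfl fun j _ => by ring
  rw [e1] at hg
  rw [e2, e3] at hval
  simp only [proxObj, neg_apply] at hX hY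
  rw [lyapMain, proxCoef_succ, proxCoef_succ, Problem.gap, Problem.lagr, Problem.lagr]
  have hcpl' := mul_le_mul_of_nonneg_left hcpl ha1.le
  -- The three-point inequality gains a μ in the Bregman coefficient, while `proxCoef` grows by a μ
  -- / 2 only; the surplus is discarded.
  have h5 : 0 ≤ a (k + 1) * pb.μ * pb.genX.breg u st'.x :=
    mul_nonneg (mul_nonneg ha1.le hpb.μ_nonneg) hbx
  have h6 : 0 ≤ a (k + 1) * pb.ν * pb.genY.breg v st'.y :=
    mul_nonneg (mul_nonneg ha1.le hpb.ν_nonneg) hby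
  linarith

/-- The error terms of the Lyapunov function. -/
def lyapErr (pb : Problem E n N ρ) (pm : Params E n N ρ) (η ζ : ℝ) (st : AlgState E n N ρ) : ℝ :=
  η * ∑ I, ‖gradErr pb st I‖ ^ 2 / pm.p I +
    ∑ I, (15 * (η * (pb.L I ^ 2 / pm.p I)) / pm.r I + 4 * (ζ * (pb.G I ^ 2 / pm.q I)) / pm.r I) *
      ‖st.x.1 - st.xhat I‖ ^ 2 +
    ∑ I, 15 * (η * (pb.G I ^ 2 / pm.p I)) / pm.s I *
      ∑ j with pb.blk j = I, (st.y.1 j - st.yhat j) ^ 2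

/-- The one-step bound after Young's inequality. -/
lemma gap_step_le_young (hpb : pb.IsAdmissible) (hpm : pm.IsAdmissible pb) (hρ : ρ ≤ 2)
    (hrX : IsProxRule pb.X pb.φ pb.genX ruleX) (hrY : IsProxRule pb.Y pb.ψ pb.genY ruleY)
    (htX : HasThreePoint pb.X pb.φ pb.genX pb.μ ruleX)
    (htY : HasThreePoint pb.Y pb.ψ pb.genY pb.ν ruleY)
    (h0 : a 0 = 0) (ha : ∀ k, 1 ≤ k → 0 < a k)
    {u : E} (hu : u ∈ pb.X) {v : LpVec n ρ} (hv : v ∈ pb.Y)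
    (k : ℕ) (P Q R S : Fin N) {st st' : AlgState E n N ρ} (hst : st.IsFeasible pb)
    (hst' : st' = algStep pb pm ruleX ruleY a k P Q R S st) {c d : ℝ}
    (hcd : c = proxCoef a pb.μ pm.μ₀ k) (hdd : d = proxCoef a pb.ν pm.ν₀ k) :
    a (k + 1) * pb.gap u v st'.x.1 st'.y.1 + lyapMain pb u v (a (k + 1))
        (proxCoef a pb.μ pm.μ₀ (k + 1)) (proxCoef a pb.ν pm.ν₀ (k + 1)) st' ≤
      (c * pb.genX.breg u st.x + a k / pm.p P * gradErr pb st P (u - st.x.1) +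
        a k ^ 2 / c * (‖gradErr pb st P‖ ^ 2 / pm.p P ^ 2)) +
      (d * pb.genY.breg v st.y -
        a k / pm.q Q * ∑ j with pb.blk j = Q, (v j - st.y.1 j) * valErr pb st j +
        a k ^ 2 / d * ((∑ j with pb.blk j = Q, valErr pb st j ^ 2) / pm.q Q ^ 2)) -
      c / 4 * ‖st'.x.1 - st.x.1‖ ^ 2 - d / 4 * ∑ j, (st'.y.1 j - st.y.1 j) ^ 2 := by
  have h := gap_step_le hpb hpm hrX hrY htX htY h0 ha hu hv k P Q R S hst hst'
  rw [← hcd, ← hdd] at h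
  have hc : 0 < c := hcd ▸ proxCoef_pos h0 ha hpb.μ_nonneg hpm.μ₀_pos k
  have hd : 0 < d := hdd ▸ proxCoef_pos h0 ha hpb.ν_nonneg hpm.ν₀_pos k
  have hfe : st'.IsFeasible pb := by
    rw [hst']
    exact isFeasible_algStep hpb.μ_nonneg hpb.ν_nonneg hpm.μ₀_pos hpm.ν₀_pos hrX hrY h0 ha
      k P Q R S hst
  have hbx := hpb.genX_convex.sq_le_breg hst.x_centre hfe.x_centre.1.1
  have hby := hpb.genY_convex.sq_le_breg hst.y_centre hfe.y_centre.1.1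
  have hn := LpVec.sum_sq_le_norm_sq hρ (st'.y.1 - st.y.1)
  simp only [PiLp.sub_apply] at hn
  have hp := hpm.p_pos P
  have hq := hpm.q_pos Q
  have hyx : a k / pm.p P * gradErr pb st P (u - st'.x.1) ≤
      a k / pm.p P * gradErr pb st P (u - st.x.1) +
        a k ^ 2 / c * (‖gradErr pb st P‖ ^ 2 / pm.p P ^ 2) +
        c / 4 * ‖st'.x.1 - st.x.1‖ ^ 2 := by
    -- The new iterate depends on P, so only u - st.x.1 may remain next to the error in the average
    -- over P. The movement goes into Young's inequality and uses half of the c/2 ‖·‖² supplied by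
    -- the Bregman term.
    have e : u - st'.x.1 = (u - st.x.1) - (st'.x.1 - st.x.1) := by abel
    rw [e, map_sub, mul_sub]
    have h1 : |gradErr pb st P (st'.x.1 - st.x.1)| ≤ ‖gradErr pb st P‖ * ‖st'.x.1 - st.x.1‖ :=
      (gradErr pb st P).le_opNorm _
    set t := gradErr pb st P (st'.x.1 - st.x.1)
    have h2 : -(a k / pm.p P * t) ≤ a k ^ 2 / c * (‖gradErr pb st P‖ ^ 2 / pm.p P ^ 2) +
        c / 4 * ‖st'.x.1 - st.x.1‖ ^ 2 := by
      have h3 : -(a k / pm.p P * t) ≤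
          |a k / pm.p P| * (‖gradErr pb st P‖ * ‖st'.x.1 - st.x.1‖) := by
        calc _ ≤ |a k / pm.p P * t| := neg_le_abs _
          _ = |a k / pm.p P| * |t| := abs_mul _ _
          _ ≤ _ := by gcongr
      have h4 : a k ^ 2 / c * (‖gradErr pb st P‖ ^ 2 / pm.p P ^ 2) =
          (|a k / pm.p P| * ‖gradErr pb st P‖) ^ 2 / c := by
        rw [mul_pow, sq_abs]
        field_simp
      rw [h4]
      have h5 : 0 ≤ (|a k / pm.p P| * ‖gradErr pb st P‖ - c / 2 * ‖st'.x.1 - st.x.1‖) ^ 2 / c := by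
        positivity
      have h6 : (|a k / pm.p P| * ‖gradErr pb st P‖ - c / 2 * ‖st'.x.1 - st.x.1‖) ^ 2 / c =
          (|a k / pm.p P| * ‖gradErr pb st P‖) ^ 2 / c + c / 4 * ‖st'.x.1 - st.x.1‖ ^ 2 -
            |a k / pm.p P| * (‖gradErr pb st P‖ * ‖st'.x.1 - st.x.1‖) := by
        field_simp
        ring
      linarith
    linarith
  have hyy : -(a k / pm.q Q * ∑ j with pb.blk j = Q, (v j - st'.y.1 j) * valErr pb st j) ≤
      -(a k / pm.q Q * ∑ j with pb.blk j = Q, (v j - st.y.1 j) * valErr pb st j) +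
        a k ^ 2 / d * ((∑ j with pb.blk j = Q, valErr pb st j ^ 2) / pm.q Q ^ 2) +
        d / 4 * ∑ j, (st'.y.1 j - st.y.1 j) ^ 2 := by
    have h1 : d / 4 * ∑ j with pb.blk j = Q, (st'.y.1 j - st.y.1 j) ^ 2 ≤
        d / 4 * ∑ j, (st'.y.1 j - st.y.1 j) ^ 2 := by
      refine mul_le_mul_of_nonneg_left ?_ (by positivity)
      exact Finset.sum_le_sum_of_subset_of_nonneg (Finset.filter_subset _ _)
        fun _ _ _ => sq_nonneg _
    refine le_trans ?_ (add_le_add_right h1 _)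
    rw [Finset.sum_div, Finset.mul_sum, Finset.mul_sum, Finset.mul_sum, Finset.mul_sum,
      ← Finset.sum_neg_distrib, ← Finset.sum_neg_distrib, ← Finset.sum_add_distrib,
      ← Finset.sum_add_distrib]
    refine Finset.sum_le_sum fun j _ => ?_
    have h5 : 0 ≤ (a k / pm.q Q * valErr pb st j - d / 2 * (st'.y.1 j - st.y.1 j)) ^ 2 / d := by
      positivity
    have h6 : (a k / pm.q Q * valErr pb st j - d / 2 * (st'.y.1 j - st.y.1 j)) ^ 2 / d =
        a k ^ 2 / d * (valErr pb st j ^ 2 / pm.q Q ^ 2) + d / 4 * (st'.y.1 j - st.y.1 j) ^ 2 -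
          a k / pm.q Q * (st'.y.1 j - st.y.1 j) * valErr pb st j := by
      field_simp
      ring
    linarith
  have h7 : c * (‖st'.x.1 - st.x.1‖ ^ 2 / 2) ≤ c * pb.genX.breg st'.x.1 st.x :=
    mul_le_mul_of_nonneg_left hbx hc.le
  have h8 : d * (‖st'.y.1 - st.y.1‖ ^ 2 / 2) ≤ d * pb.genY.breg st'.y.1 st.y :=
    mul_le_mul_of_nonneg_left hby hd.le
  have h9 := mul_le_mul_of_nonneg_left hn hd.le
  linarith

end Step

/-! ### Expected decrease and nonnegativity of the Lyapunov function -/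

section Step

variable {E : Type*} [NormedAddCommGroup E] [NormedSpace ℝ E]
variable {n N : ℕ} {ρ : ℝ≥0∞} [Fact (1 ≤ ρ)]

lemma le_one_of_sum_eq_one {w : Fin N → ℝ} (hw : ∀ i, 0 ≤ w i) (hs : ∑ i, w i = 1) (i : Fin N) :
    w i ≤ 1 := by
  rw [← hs]
  exact Finset.single_le_sum (fun j _ => hw j) (Finset.mem_univ i)

lemma pos_of_one_div_le {r : Fin N → ℝ} (h : ∀ I, 1 / (2 * (N : ℝ)) ≤ r I) (I : Fin N) :
    0 < r I := by
  have hN : 0 < (N : ℝ) := by exact_mod_cast I.pos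
  exact lt_of_lt_of_le (by positivity) (h I)

variable {pb : Problem E n N ρ} {pm : Params E n N ρ}
  {ruleX : ℝ → ℝ → (E →L[ℝ] ℝ) → E × (E →L[ℝ] ℝ) → E × (E →L[ℝ] ℝ)}
  {ruleY : ℝ → ℝ → (LpVec n ρ →L[ℝ] ℝ) → LpVec n ρ × (LpVec n ρ →L[ℝ] ℝ) →
    LpVec n ρ × (LpVec n ρ →L[ℝ] ℝ)}
  {a : ℕ → ℝ}

/-- The error terms after an iteration, in terms of the sampled blocks. -/
lemma lyapErr_algStep_le (hpb : pb.IsAdmissible) (hpm : pm.IsAdmissible pb)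
    {η ζ : ℝ} (hη : 0 ≤ η)
    (k : ℕ) (P Q R S : Fin N) {st st' : AlgState E n N ρ} (hst : st.IsFeasible pb)
    (hst' : st' = algStep pb pm ruleX ruleY a k P Q R S st) (hfe : st'.IsFeasible pb) :
    lyapErr pb pm η ζ st' ≤
      ∑ I, 2 * (η * (pb.L I ^ 2 / pm.p I)) * ‖st'.x.1 - st.xhat I‖ ^ 2 +
      ∑ I, (15 * (η * (pb.L I ^ 2 / pm.p I)) / pm.r I +
        4 * (ζ * (pb.G I ^ 2 / pm.q I)) / pm.r I) *
        (if I = R then 0 else ‖st'.x.1 - st.xhat I‖ ^ 2) +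
      ∑ I, 2 * (η * (pb.G I ^ 2 / pm.p I)) *
        ∑ j with pb.blk j = I, (st'.y.1 j - st.yhat j) ^ 2 +
      ∑ I, 15 * (η * (pb.G I ^ 2 / pm.p I)) / pm.s I *
        (if I = S then 0 else ∑ j with pb.blk j = I, (st'.y.1 j - st.yhat j) ^ 2) := by
  have hxp : st'.xhatPrev = st.xhat := by rw [hst']; rfl
  have hyp : st'.yhatPrev = st.yhat := by rw [hst']; rfl
  have hxh : ∀ I, st'.xhat I = if I = R then st'.x.1 else st.xhat I := by
    intro I; rw [hst']; rfl
  have hyh : ∀ j, st'.yhat j = if pb.blk j = S then st'.y.1 j else st.yhat j := by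
    intro j; rw [hst']; rfl
  have h1 : η * ∑ I, ‖gradErr pb st' I‖ ^ 2 / pm.p I ≤
      ∑ I, 2 * (η * (pb.L I ^ 2 / pm.p I)) * ‖st'.x.1 - st.xhat I‖ ^ 2 +
      ∑ I, 2 * (η * (pb.G I ^ 2 / pm.p I)) *
        ∑ j with pb.blk j = I, (st'.y.1 j - st.yhat j) ^ 2 := by
    rw [Finset.mul_sum, ← Finset.sum_add_distrib]
    refine Finset.sum_le_sum fun I _ => ?_
    have hp := hpm.p_pos I
    have := hpb.norm_grad_sub_sq_le I (xh := st.xhat) hfe.x_centre.1.1 (hst.xhat_mem I)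
      hfe.y_centre.1.1 st.yhat
    rw [gradErr, hxp, hyp]
    calc _ ≤ η * ((2 * pb.L I ^ 2 * ‖st'.x.1 - st.xhat I‖ ^ 2 +
        2 * pb.G I ^ 2 * ∑ j with pb.blk j = I, (st'.y.1 j - st.yhat j) ^ 2) / pm.p I) := by
          gcongr
      _ = _ := by ring
  have h2 : ∀ I, ‖st'.x.1 - st'.xhat I‖ ^ 2 =
      if I = R then 0 else ‖st'.x.1 - st.xhat I‖ ^ 2 := by
    intro I
    rw [hxh]
    split_ifs <;> simp
  have h3 : ∀ I, ∑ j with pb.blk j = I, (st'.y.1 j - st'.yhat j) ^ 2 =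
      if I = S then 0 else ∑ j with pb.blk j = I, (st'.y.1 j - st.yhat j) ^ 2 := by
    intro I
    split_ifs with h
    · refine Finset.sum_eq_zero fun j hj => ?_
      rw [hyh, if_pos ((Finset.mem_filter.1 hj).2.trans h)]
      simp
    · refine Finset.sum_congr rfl fun j hj => ?_
      rw [hyh, if_neg fun hh => h ((Finset.mem_filter.1 hj).2.symm.trans hh)]
  rw [lyapErr]
  simp_rw [h2, h3]
  linarith

lemma norm_sub_sq_le_stale {F : Type*} [NormedAddCommGroup F] {r : ℝ} (hr : 0 < r) (x y z : F) :
    ‖x - z‖ ^ 2 ≤ (1 + r / 2) * ‖y - z‖ ^ 2 + (1 + 2 / r) * ‖x - y‖ ^ 2 := by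
  refine le_trans ?_ (add_sq_le_stale hr)
  gcongr
  rw [add_comm]
  exact norm_sub_le_norm_sub_add_norm_sub x y z

/-- The Lyapunov function decreases on average by the weighted gap. -/
theorem lyap_step (hpb : pb.IsAdmissible) (hpm : pm.IsAdmissible pb) (hρ : ρ ≤ 2)
    (hrX : IsProxRule pb.X pb.φ pb.genX ruleX) (hrY : IsProxRule pb.Y pb.ψ pb.genY ruleY)
    (htX : HasThreePoint pb.X pb.φ pb.genX pb.μ ruleX)
    (htY : HasThreePoint pb.Y pb.ψ pb.genY pb.ν ruleY)
    (h0 : a 0 = 0) (ha : ∀ k, 1 ≤ k → 0 < a k)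
    {u : E} (hu : u ∈ pb.X) {v : LpVec n ρ} (hv : v ∈ pb.Y)
    (k : ℕ) {st : AlgState E n N ρ} (hst : st.IsFeasible pb) {c d η ζ η' ζ' : ℝ}
    (hcd : c = proxCoef a pb.μ pm.μ₀ k) (hdd : d = proxCoef a pb.ν pm.ν₀ k)
    (hη : a k ^ 2 / c ≤ η) (hζ : a k ^ 2 / d ≤ ζ) (hη' : 0 ≤ η') (hζ' : 0 ≤ ζ')
    (hηη : η' ≤ (1 + 1 / (8 * N)) * η) (hζζ : ζ' ≤ (1 + 1 / (8 * N)) * ζ)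
    (hcx : 36 * η' * ∑ I, pb.L I ^ 2 / (pm.p I * pm.r I ^ 2) +
      8 * ζ' * ∑ I, pb.G I ^ 2 / (pm.q I * pm.r I ^ 2) ≤ c / 4)
    (hdy : ∀ I, 36 * η' * (pb.G I ^ 2 / (pm.p I * pm.s I ^ 2)) ≤ d / 4) :
    ∑ P, pm.p P * ∑ Q, pm.q Q * ∑ R, pm.r R * ∑ S, pm.s S *
      (a (k + 1) * pb.gap u v (algStep pb pm ruleX ruleY a k P Q R S st).x.1
          (algStep pb pm ruleX ruleY a k P Q R S st).y.1 +
        (lyapMain pb u v (a (k + 1)) (proxCoef a pb.μ pm.μ₀ (k + 1))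
          (proxCoef a pb.ν pm.ν₀ (k + 1)) (algStep pb pm ruleX ruleY a k P Q R S st) +
        lyapErr pb pm η' ζ' (algStep pb pm ruleX ruleY a k P Q R S st))) ≤
      lyapMain pb u v (a k) c d st + lyapErr pb pm η ζ st := by
  have hp := hpm.p_pos
  have hq := hpm.q_pos
  have hr := pos_of_one_div_le hpm.r_ge
  have hs := pos_of_one_div_le hpm.s_ge
  have hc : 0 < c := hcd ▸ proxCoef_pos h0 ha hpb.μ_nonneg hpm.μ₀_pos k
  have hd : 0 < d := hdd ▸ proxCoef_pos h0 ha hpb.ν_nonneg hpm.ν₀_pos k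
  have hη0 : 0 ≤ η := le_trans (by positivity) hη
  have hζ0 : 0 ≤ ζ := le_trans (by positivity) hζ
  have hδ0 : 0 ≤ 1 / (8 * (N : ℝ)) := by positivity
  have hδ : ∀ w : Fin N → ℝ, (∀ I, 1 / (2 * (N : ℝ)) ≤ w I) → ∀ I, 1 / (8 * (N : ℝ)) ≤ w I / 4 := by
    intro w hw I
    have e : 1 / (8 * (N : ℝ)) = 1 / (2 * (N : ℝ)) / 4 := by
      rw [div_div]
      ring
    rw [e]
    exact div_le_div_of_nonneg_right (hw I) (by norm_num)
  have hvs : ∑ Q, (∑ j with pb.blk j = Q, valErr pb st j ^ 2) / pm.q Q ≤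
      ∑ I, pb.G I ^ 2 / pm.q I * ‖st.x.1 - st.xhat I‖ ^ 2 := by
    refine Finset.sum_le_sum fun I _ => ?_
    have e : ∑ j with pb.blk j = I, valErr pb st j ^ 2 =
        ∑ j with pb.blk j = I, (pb.f j st.x.1 - pb.f j (st.xhat I)) ^ 2 :=
      Finset.sum_congr rfl fun j hj => by rw [valErr, (Finset.mem_filter.1 hj).2]
    rw [e, div_mul_eq_mul_div]
    exact div_le_div_of_nonneg_right
      (hpb.sum_sq_sub_le I hst.x_centre.1.1 (hst.xhat_mem I)) (hq I).le
  -- Repeated arguments are placeholders: the new primal iterate depends on P alone, the new dual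
  -- iterate on P, Q, R.
  let xN : Fin N → E := fun P => (algStep pb pm ruleX ruleY a k P P P P st).x.1
  let yN : Fin N → Fin N → Fin N → LpVec n ρ :=
    fun P Q R => (algStep pb pm ruleX ruleY a k P Q R R st).y.1
  refine (sum_four_le (fun I => (hp I).le) (fun I => (hq I).le) (fun I => (hr I).le)
    (fun I => (hs I).le) hpm.p_sum hpm.q_sum hpm.r_sum hpm.s_sum
    (A := fun P => c * pb.genX.breg u st.x + a k / pm.p P * gradErr pb st P (u - st.x.1) +
        a k ^ 2 / c * (‖gradErr pb st P‖ ^ 2 / pm.p P ^ 2))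
    (B := fun Q => d * pb.genY.breg v st.y -
        a k / pm.q Q * ∑ j with pb.blk j = Q, (v j - st.y.1 j) * valErr pb st j +
        a k ^ 2 / d * ((∑ j with pb.blk j = Q, valErr pb st j ^ 2) / pm.q Q ^ 2))
    (DX := fun P => c / 4 * ‖xN P - st.x.1‖ ^ 2)
    (DY := fun P Q R => d / 4 * ∑ j, (yN P Q R j - st.y.1 j) ^ 2)
    (ZX := fun P I => ‖xN P - st.xhat I‖ ^ 2)
    (ZY := fun P Q R I => ∑ j with pb.blk j = I, (yN P Q R j - st.yhat j) ^ 2)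
    (α := fun I => 2 * (η' * (pb.L I ^ 2 / pm.p I)))
    (β := fun I => 2 * (η' * (pb.G I ^ 2 / pm.p I)))
    (WX := fun I => 15 * (η' * (pb.L I ^ 2 / pm.p I)) / pm.r I +
        4 * (ζ' * (pb.G I ^ 2 / pm.q I)) / pm.r I)
    (WY := fun I => 15 * (η' * (pb.G I ^ 2 / pm.p I)) / pm.s I)
    (CX := ∑ I, (15 * (η * (pb.L I ^ 2 / pm.p I)) / pm.r I +
        4 * (ζ * (pb.G I ^ 2 / pm.q I)) / pm.r I) * ‖st.x.1 - st.xhat I‖ ^ 2 -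
        ζ * ∑ I, pb.G I ^ 2 / pm.q I * ‖st.x.1 - st.xhat I‖ ^ 2)
    (CY := ∑ I, 15 * (η * (pb.G I ^ 2 / pm.p I)) / pm.s I *
      ∑ j with pb.blk j = I, (st.y.1 j - st.yhat j) ^ 2) ?_ ?_ ?_).trans ?_
  · intro P Q R S
    have hfe := isFeasible_algStep hpb.μ_nonneg hpb.ν_nonneg hpm.μ₀_pos hpm.ν₀_pos hrX hrY h0 ha
      k P Q R S hst
    have h1 := gap_step_le_young hpb hpm hρ hrX hrY htX htY h0 ha hu hv k P Q R S hst rfl hcd hdd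
    have h2 := lyapErr_algStep_le (η := η') (ζ := ζ') hpb hpm hη' k P Q R S hst rfl hfe
    have e1 : (algStep pb pm ruleX ruleY a k P Q R S st).x.1 = xN P := rfl
    have e2 : (algStep pb pm ruleX ruleY a k P Q R S st).y.1 = yN P Q R := rfl
    rw [e1, e2] at h1 h2
    rw [e1, e2]
    linarith
  · intro P
    have key : ∀ I, (2 * (η' * (pb.L I ^ 2 / pm.p I)) + (15 * (η' * (pb.L I ^ 2 / pm.p I)) / pm.r I +
        4 * (ζ' * (pb.G I ^ 2 / pm.q I)) / pm.r I) * (1 - pm.r I)) * ‖xN P - st.xhat I‖ ^ 2 ≤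
        (15 * (η * (pb.L I ^ 2 / pm.p I)) / pm.r I +
        4 * (ζ * (pb.G I ^ 2 / pm.q I)) / pm.r I) * ‖st.x.1 - st.xhat I‖ ^ 2 -
        ζ * (pb.G I ^ 2 / pm.q I * ‖st.x.1 - st.xhat I‖ ^ 2) +
        (36 * η' * (pb.L I ^ 2 / (pm.p I * pm.r I ^ 2)) +
          8 * ζ' * (pb.G I ^ 2 / (pm.q I * pm.r I ^ 2))) * ‖xN P - st.x.1‖ ^ 2 := by
      intro I
      have hpI := hp I
      have hqI := hq I
      have hrI := hr I
      have hZ := norm_sub_sq_le_stale hrI (xN P) st.x.1 (st.xhat I)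
      have hr1 := le_one_of_sum_eq_one (fun I => (hr I).le) hpm.r_sum I
      have h1 := stale_growth (κ := η * (pb.L I ^ 2 / pm.p I)) (κ' := η' * (pb.L I ^ 2 / pm.p I))
        hrI hr1 hδ0 (hδ _ hpm.r_ge I)
        (by positivity) (by rw [← mul_assoc]; gcongr) (by positivity) (by positivity) hZ
      have h2 := stale_growth' (κ := ζ * (pb.G I ^ 2 / pm.q I)) (κ' := ζ' * (pb.G I ^ 2 / pm.q I))
        hrI hr1 hδ0 (hδ _ hpm.r_ge I)
        (by positivity) (by rw [← mul_assoc]; gcongr) (by positivity) (by positivity) hZ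
      have e1 : 36 * (η' * (pb.L I ^ 2 / pm.p I)) / pm.r I ^ 2 =
          36 * η' * (pb.L I ^ 2 / (pm.p I * pm.r I ^ 2)) := by
        field_simp
      have e2 : 8 * (ζ' * (pb.G I ^ 2 / pm.q I)) / pm.r I ^ 2 =
          8 * ζ' * (pb.G I ^ 2 / (pm.q I * pm.r I ^ 2)) := by
        field_simp
      rw [e1] at h1
      rw [e2] at h2
      linarith
    have h1 := Finset.sum_le_sum fun I (_ : I ∈ Finset.univ) => key I
    rw [Finset.sum_add_distrib, Finset.sum_sub_distrib, ← Finset.mul_sum, ← Finset.sum_mul,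
      Finset.sum_add_distrib, ← Finset.mul_sum, ← Finset.mul_sum] at h1
    have h2 := mul_le_mul_of_nonneg_right hcx (sq_nonneg ‖xN P - st.x.1‖)
    linarith
  · intro P Q R
    have key : ∀ I, (2 * (η' * (pb.G I ^ 2 / pm.p I)) +
        15 * (η' * (pb.G I ^ 2 / pm.p I)) / pm.s I * (1 - pm.s I)) *
        ∑ j with pb.blk j = I, (yN P Q R j - st.yhat j) ^ 2 ≤
        15 * (η * (pb.G I ^ 2 / pm.p I)) / pm.s I *
          ∑ j with pb.blk j = I, (st.y.1 j - st.yhat j) ^ 2 +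
        d / 4 * ∑ j with pb.blk j = I, (yN P Q R j - st.y.1 j) ^ 2 := by
      intro I
      have hpI := hp I
      have hsI := hs I
      have hs1 := le_one_of_sum_eq_one (fun I => (hs I).le) hpm.s_sum I
      have hZ : ∑ j with pb.blk j = I, (yN P Q R j - st.yhat j) ^ 2 ≤
          (1 + pm.s I / 2) * ∑ j with pb.blk j = I, (st.y.1 j - st.yhat j) ^ 2 +
          (1 + 2 / pm.s I) * ∑ j with pb.blk j = I, (yN P Q R j - st.y.1 j) ^ 2 := by
        rw [Finset.mul_sum, Finset.mul_sum, ← Finset.sum_add_distrib]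
        refine Finset.sum_le_sum fun j _ => ?_
        refine le_trans (le_of_eq ?_) (add_sq_le_stale hsI)
        ring
      have hH : 0 ≤ ∑ j with pb.blk j = I, (st.y.1 j - st.yhat j) ^ 2 :=
        Finset.sum_nonneg fun _ _ => sq_nonneg _
      have hD : 0 ≤ ∑ j with pb.blk j = I, (yN P Q R j - st.y.1 j) ^ 2 :=
        Finset.sum_nonneg fun _ _ => sq_nonneg _
      refine (stale_growth (κ := η * (pb.G I ^ 2 / pm.p I)) (κ' := η' * (pb.G I ^ 2 / pm.p I))
        hsI hs1 hδ0 (hδ _ hpm.s_ge I)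
        (by positivity) (by rw [← mul_assoc]; gcongr) hH hD hZ).trans ?_
      have e1 : 36 * (η' * (pb.G I ^ 2 / pm.p I)) / pm.s I ^ 2 =
          36 * η' * (pb.G I ^ 2 / (pm.p I * pm.s I ^ 2)) := by
        field_simp
      rw [e1]
      gcongr
      exact hdy I
    have h1 := Finset.sum_le_sum fun I (_ : I ∈ Finset.univ) => key I
    -- The squared block movements add up to the total dual movement, so a bound for each single
    -- block suffices, in contrast to the sum over I in `hcx`.
    rw [Finset.sum_add_distrib, ← Finset.mul_sum, Finset.sum_fiberwise] at h1
    linarith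
  · have hA : ∑ P, pm.p P * (c * pb.genX.breg u st.x + a k / pm.p P * gradErr pb st P (u - st.x.1) +
        a k ^ 2 / c * (‖gradErr pb st P‖ ^ 2 / pm.p P ^ 2)) =
        c * pb.genX.breg u st.x + a k * (∑ I, gradErr pb st I) (u - st.x.1) +
          a k ^ 2 / c * ∑ I, ‖gradErr pb st I‖ ^ 2 / pm.p I := by
      have e : ∀ P, pm.p P * (c * pb.genX.breg u st.x +
          a k / pm.p P * gradErr pb st P (u - st.x.1) +
          a k ^ 2 / c * (‖gradErr pb st P‖ ^ 2 / pm.p P ^ 2)) =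
          pm.p P * (c * pb.genX.breg u st.x) + a k * gradErr pb st P (u - st.x.1) +
          a k ^ 2 / c * (‖gradErr pb st P‖ ^ 2 / pm.p P) := by
        intro P
        have := (hp P).ne'
        field_simp
      simp_rw [e]
      rw [Finset.sum_add_distrib, Finset.sum_add_distrib, sum_mul_const hpm.p_sum,
        ← Finset.mul_sum, ← Finset.mul_sum, sum_apply]
    have hB : ∑ Q, pm.q Q * (d * pb.genY.breg v st.y -
        a k / pm.q Q * ∑ j with pb.blk j = Q, (v j - st.y.1 j) * valErr pb st j +
        a k ^ 2 / d * ((∑ j with pb.blk j = Q, valErr pb st j ^ 2) / pm.q Q ^ 2)) =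
        d * pb.genY.breg v st.y - a k * ∑ j, (v j - st.y.1 j) * valErr pb st j +
          a k ^ 2 / d * ∑ Q, (∑ j with pb.blk j = Q, valErr pb st j ^ 2) / pm.q Q := by
      have e : ∀ Q, pm.q Q * (d * pb.genY.breg v st.y -
        a k / pm.q Q * ∑ j with pb.blk j = Q, (v j - st.y.1 j) * valErr pb st j +
        a k ^ 2 / d * ((∑ j with pb.blk j = Q, valErr pb st j ^ 2) / pm.q Q ^ 2)) =
        pm.q Q * (d * pb.genY.breg v st.y) -
        a k * ∑ j with pb.blk j = Q, (v j - st.y.1 j) * valErr pb st j +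
        a k ^ 2 / d * ((∑ j with pb.blk j = Q, valErr pb st j ^ 2) / pm.q Q) := by
        intro Q
        have := (hq Q).ne'
        field_simp
      simp_rw [e]
      rw [Finset.sum_add_distrib, Finset.sum_sub_distrib, sum_mul_const hpm.q_sum,
        ← Finset.mul_sum, ← Finset.mul_sum, Finset.sum_fiberwise]
    rw [hA, hB, lyapMain, lyapErr]
    have h1 : a k ^ 2 / c * ∑ I, ‖gradErr pb st I‖ ^ 2 / pm.p I ≤
        η * ∑ I, ‖gradErr pb st I‖ ^ 2 / pm.p I :=
      mul_le_mul_of_nonneg_right hη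
        (Finset.sum_nonneg fun I _ => div_nonneg (sq_nonneg _) (hp I).le)
    -- Cancelled by the negative part of `CX`, the gain from `stale_growth'`.
    have h2 : a k ^ 2 / d * ∑ Q, (∑ j with pb.blk j = Q, valErr pb st j ^ 2) / pm.q Q ≤
        ζ * ∑ I, pb.G I ^ 2 / pm.q I * ‖st.x.1 - st.xhat I‖ ^ 2 :=
      mul_le_mul hζ hvs (Finset.sum_nonneg fun I _ =>
        div_nonneg (Finset.sum_nonneg fun _ _ => sq_nonneg _) (hq I).le) hζ0
    linarith

/-- The Lyapunov function is nonnegative. -/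
theorem lyap_nonneg (hpb : pb.IsAdmissible) (hpm : pm.IsAdmissible pb) (hρ : ρ ≤ 2)
    {u : E} (hu : u ∈ pb.X) {v : LpVec n ρ} (hv : v ∈ pb.Y)
    {st : AlgState E n N ρ} (hst : st.IsFeasible pb) {b c d η ζ : ℝ}
    (hc : 0 < c) (hd : 0 < d) (hη : b ^ 2 / c ≤ η) (hζ : b ^ 2 / d ≤ ζ) :
    0 ≤ lyapMain pb u v b c d st + lyapErr pb pm η ζ st := by
  have hp := hpm.p_pos
  have hq := hpm.q_pos
  have hr := pos_of_one_div_le hpm.r_ge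
  have hs := pos_of_one_div_le hpm.s_ge
  have hη0 : 0 ≤ η := le_trans (by positivity) hη
  have hζ0 : 0 ≤ ζ := le_trans (by positivity) hζ
  have hbx := hpb.genX_convex.sq_le_breg hst.x_centre hu
  have hby := hpb.genY_convex.sq_le_breg hst.y_centre hv
  have hn := LpVec.sum_sq_le_norm_sq hρ (v - st.y.1)
  simp only [PiLp.sub_apply] at hn
  set e := ∑ I, gradErr pb st I with he
  have hcs : ‖e‖ ^ 2 ≤ ∑ I, ‖gradErr pb st I‖ ^ 2 / pm.p I := by
    calc ‖e‖ ^ 2 ≤ (∑ I, ‖gradErr pb st I‖) ^ 2 := by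
          gcongr
          exact norm_sum_le _ _
      _ ≤ (∑ I, ‖gradErr pb st I‖ ^ 2 / pm.p I) * ∑ I, pm.p I :=
          Finset.sum_sq_le_sum_mul_sum_of_sq_le_mul _
            (fun I _ => div_nonneg (sq_nonneg _) (hp I).le) (fun I _ => (hp I).le)
            fun I _ => by rw [div_mul_cancel₀ _ (hp I).ne']
      _ = _ := by rw [hpm.p_sum, mul_one]
  have h1 : -(c / 2 * ‖u - st.x.1‖ ^ 2 + b ^ 2 / c * ‖e‖ ^ 2) ≤ b * e (u - st.x.1) := by
    have h2 : |e (u - st.x.1)| ≤ ‖e‖ * ‖u - st.x.1‖ := e.le_opNorm _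
    have h3 : |b * e (u - st.x.1)| ≤ |b| * (‖e‖ * ‖u - st.x.1‖) := by
      rw [abs_mul]
      gcongr
    have h4 : 0 ≤ (|b| * ‖e‖ - c / 2 * ‖u - st.x.1‖) ^ 2 / c := by positivity
    have h5 : (|b| * ‖e‖ - c / 2 * ‖u - st.x.1‖) ^ 2 / c =
        b ^ 2 / c * ‖e‖ ^ 2 + c / 4 * ‖u - st.x.1‖ ^ 2 - |b| * (‖e‖ * ‖u - st.x.1‖) := by
      rw [← sq_abs b]
      field_simp
      ring
    have h6 : 0 ≤ c / 4 * ‖u - st.x.1‖ ^ 2 := by positivity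
    have := neg_abs_le (b * e (u - st.x.1))
    linarith
  have h2 : b * ∑ j, (v j - st.y.1 j) * valErr pb st j ≤
      d / 2 * ∑ j, (v j - st.y.1 j) ^ 2 + b ^ 2 / d * ∑ j, valErr pb st j ^ 2 := by
    rw [Finset.mul_sum, Finset.mul_sum, Finset.mul_sum, ← Finset.sum_add_distrib]
    refine Finset.sum_le_sum fun j _ => ?_
    have h4 : 0 ≤ (b * valErr pb st j - d / 2 * (v j - st.y.1 j)) ^ 2 / d := by positivity
    have h5 : (b * valErr pb st j - d / 2 * (v j - st.y.1 j)) ^ 2 / d =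
        b ^ 2 / d * valErr pb st j ^ 2 + d / 4 * (v j - st.y.1 j) ^ 2 -
          b * ((v j - st.y.1 j) * valErr pb st j) := by
      field_simp
      ring
    have h6 : 0 ≤ d / 4 * (v j - st.y.1 j) ^ 2 := by positivity
    linarith
  have h3 : b ^ 2 / d * ∑ j, valErr pb st j ^ 2 ≤
      ∑ I, 4 * (ζ * (pb.G I ^ 2 / pm.q I)) / pm.r I * ‖st.x.1 - st.xhat I‖ ^ 2 := by
    rw [← Finset.sum_fiberwise Finset.univ pb.blk]
    rw [Finset.mul_sum]
    refine Finset.sum_le_sum fun I _ => ?_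
    have e : ∑ j with pb.blk j = I, valErr pb st j ^ 2 =
        ∑ j with pb.blk j = I, (pb.f j st.x.1 - pb.f j (st.xhat I)) ^ 2 :=
      Finset.sum_congr rfl fun j hj => by rw [valErr, (Finset.mem_filter.1 hj).2]
    have hq1 := le_one_of_sum_eq_one (fun I => (hq I).le) hpm.q_sum I
    have hr1 := le_one_of_sum_eq_one (fun I => (hr I).le) hpm.r_sum I
    have hqI := hq I
    have hrI := hr I
    -- Because q, r ≤ 1, the coefficient in `lyapErr` is more than the value errors require.
    have h4 : 1 ≤ 4 * (1 / pm.q I) * (1 / pm.r I) := by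
      have h5 : 1 ≤ 1 / pm.q I := by rwa [le_div_iff₀ hqI, one_mul]
      have h6 : 1 ≤ 1 / pm.r I := by rwa [le_div_iff₀ hrI, one_mul]
      nlinarith
    calc _ ≤ ζ * (pb.G I ^ 2 * ‖st.x.1 - st.xhat I‖ ^ 2) := by
          refine mul_le_mul hζ ?_ (Finset.sum_nonneg fun _ _ => sq_nonneg _) hζ0
          rw [e]
          exact hpb.sum_sq_sub_le I hst.x_centre.1.1 (hst.xhat_mem I)
      _ ≤ ζ * (pb.G I ^ 2 * ‖st.x.1 - st.xhat I‖ ^ 2) * (4 * (1 / pm.q I) * (1 / pm.r I)) :=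
          le_mul_of_one_le_right (by positivity) h4
      _ = _ := by ring
  have h4 : 0 ≤ ∑ I, 15 * (η * (pb.L I ^ 2 / pm.p I)) / pm.r I * ‖st.x.1 - st.xhat I‖ ^ 2 :=
    Finset.sum_nonneg fun I _ => by
      have := hp I
      have := hr I
      positivity
  have h5 : 0 ≤ ∑ I, 15 * (η * (pb.G I ^ 2 / pm.p I)) / pm.s I *
      ∑ j with pb.blk j = I, (st.y.1 j - st.yhat j) ^ 2 :=
    Finset.sum_nonneg fun I _ => by
      have := hp I
      have := hs I
      have : 0 ≤ ∑ j with pb.blk j = I, (st.y.1 j - st.yhat j) ^ 2 :=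
        Finset.sum_nonneg fun _ _ => sq_nonneg _
      positivity
  have h6 : b ^ 2 / c * ‖e‖ ^ 2 ≤ η * ∑ I, ‖gradErr pb st I‖ ^ 2 / pm.p I :=
    mul_le_mul hη hcs (sq_nonneg _) hη0
  have h7 := mul_le_mul_of_nonneg_left hbx hc.le
  have h8 := mul_le_mul_of_nonneg_left hby hd.le
  have h9 := mul_le_mul_of_nonneg_left hn hd.le
  rw [lyapMain, lyapErr]
  simp_rw [add_mul, Finset.sum_add_distrib]
  rw [← he]
  linarith

/-- The tables start at the initial points, so the coefficients η, ζ are free at time 0. -/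
lemma lyapErr_zero {η ζ : ℝ} {P Q R S : ℕ → Fin N} :
    lyapErr pb pm η ζ (algRun pb pm ruleX ruleY a P Q R S 0) = 0 := by
  simp [lyapErr, gradErr, algRun]

end Step

/-! ### Expectations over finite histories, and telescoping -/

section Expectation

variable {E : Type*} [NormedAddCommGroup E] [NormedSpace ℝ E]
variable {n N : ℕ} {ρ : ℝ≥0∞} [Fact (1 ≤ ρ)]
variable {pb : Problem E n N ρ} {pm : Params E n N ρ}
  {ruleX : ℝ → ℝ → (E →L[ℝ] ℝ) → E × (E →L[ℝ] ℝ) → E × (E →L[ℝ] ℝ)}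
  {ruleY : ℝ → ℝ → (LpVec n ρ →L[ℝ] ℝ) → LpVec n ρ × (LpVec n ρ →L[ℝ] ℝ) →
    LpVec n ρ × (LpVec n ρ →L[ℝ] ℝ)}
  {a : ℕ → ℝ}

lemma algRun_congr {P Q R S P' Q' R' S' : ℕ → Fin N} {k : ℕ} (hP : ∀ i < k, P i = P' i)
    (hQ : ∀ i < k, Q i = Q' i) (hR : ∀ i < k, R i = R' i) (hS : ∀ i < k, S i = S' i) :
    algRun pb pm ruleX ruleY a P Q R S k = algRun pb pm ruleX ruleY a P' Q' R' S' k := by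
  induction k with
  | zero => rfl
  | succ k ih =>
    rw [algRun, algRun, hP k (by omega), hQ k (by omega), hR k (by omega), hS k (by omega),
      ih (fun i hi => hP i (by omega)) (fun i hi => hQ i (by omega))
        (fun i hi => hR i (by omega)) fun i hi => hS i (by omega)]

lemma isFeasible_algRun (hpb : pb.IsAdmissible) (hpm : pm.IsAdmissible pb)
    (hrX : IsProxRule pb.X pb.φ pb.genX ruleX) (hrY : IsProxRule pb.Y pb.ψ pb.genY ruleY)
    (h0 : a 0 = 0) (ha : ∀ k, 1 ≤ k → 0 < a k) (P Q R S : ℕ → Fin N) (k : ℕ) :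
    (algRun pb pm ruleX ruleY a P Q R S k).IsFeasible pb := by
  induction k with
  | zero => exact ⟨hpm.x₀_centre, hpm.y₀_centre, fun _ => hpm.x₀_centre.1.1⟩
  | succ k ih =>
    exact isFeasible_algStep hpb.μ_nonneg hpb.ν_nonneg hpm.μ₀_pos hpm.ν₀_pos hrX hrY h0 ha
      k _ _ _ _ ih

variable {Ω : Type*} [MeasurableSpace Ω] {prob : Measure Ω} [IsProbabilityMeasure prob]
  {P Q R S : ℕ → Ω → Fin N}

/-- Integrating out a finite random variable that is independent of another one. -/
lemma integral_indep_finite {α β : Type*} [MeasurableSpace α] [MeasurableSpace β] [Finite α]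
    [Fintype β] [MeasurableSingletonClass α] [MeasurableSingletonClass β] {X : Ω → α} {Y : Ω → β}
    (hX : Measurable X) (hY : Measurable Y) (h : IndepFun X Y prob) (φ : α → β → ℝ) :
    ∫ o, φ (X o) (Y o) ∂prob = ∫ o, ∑ b, prob.real {o | Y o = b} * φ (X o) b ∂prob := by
  have hmap := (indepFun_iff_map_prod_eq_prod_map_map hX.aemeasurable hY.aemeasurable).1 h
  have : IsProbabilityMeasure (prob.map X) := Measure.isProbabilityMeasure_map hX.aemeasurable
  have : IsProbabilityMeasure (prob.map Y) := Measure.isProbabilityMeasure_map hY.aemeasurable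
  have hm : ∀ f : α × β → ℝ, StronglyMeasurable f := fun f =>
    (measurable_of_finite f).stronglyMeasurable
  have hm' : ∀ f : α → ℝ, StronglyMeasurable f := fun f =>
    (measurable_of_finite f).stronglyMeasurable
  calc ∫ o, φ (X o) (Y o) ∂prob
      = ∫ z, φ z.1 z.2 ∂(prob.map fun o => (X o, Y o)) :=
        (integral_map (hX.prodMk hY).aemeasurable
          (hm fun z => φ z.1 z.2).aestronglyMeasurable).symm
    _ = ∫ x, ∫ y, φ x y ∂(prob.map Y) ∂(prob.map X) := by
        rw [hmap, integral_prod _ Integrable.of_finite]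
    _ = ∫ x, ∑ b, prob.real {o | Y o = b} * φ x b ∂(prob.map X) := by
        refine integral_congr_ae (Filter.Eventually.of_forall fun x => ?_)
        simp only
        rw [integral_fintype Integrable.of_finite]
        refine Finset.sum_congr rfl fun b _ => ?_
        rw [map_measureReal_apply hY (measurableSet_singleton b), smul_eq_mul]
        rfl
    _ = _ := integral_map hX.aemeasurable
        (hm' fun x => ∑ b, prob.real {o | Y o = b} * φ x b).aestronglyMeasurable

/-- The blocks that are sampled before iteration `k + 1`. -/
def history (P Q R S : ℕ → Ω → Fin N) (k : ℕ) (o : Ω) :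
    (Finset.range k ×ˢ (Finset.univ : Finset (Fin 4)) : Finset (ℕ × Fin 4)) → Fin N :=
  fun i => ![P i.1.1, Q i.1.1, R i.1.1, S i.1.1] i.1.2 o

/-- A sequence of blocks that extends a history. -/
def extend {k : ℕ} (i₀ : Fin N)
    (h : (Finset.range k ×ˢ (Finset.univ : Finset (Fin 4)) : Finset (ℕ × Fin 4)) → Fin N)
    (j : Fin 4) (i : ℕ) : Fin N :=
  if hi : i < k then h ⟨(i, j), by simpa using hi⟩ else i₀

lemma IsSampling.measurable_all (hS : IsSampling prob pm P Q R S) (i : ℕ × Fin 4) :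
    Measurable (![P i.1, Q i.1, R i.1, S i.1] i.2) := by
  obtain ⟨i, j⟩ := i
  fin_cases j
  · exact hS.measurable_P i
  · exact hS.measurable_Q i
  · exact hS.measurable_R i
  · exact hS.measurable_S i

lemma IsSampling.measurable_history (hS : IsSampling prob pm P Q R S) (k : ℕ) :
    Measurable (history P Q R S k) :=
  measurable_pi_lambda _ fun i => hS.measurable_all i.1

/-- The run is a function of a history with finitely many possible values; the default block `i₀`
fills samples that are not read. -/
lemma algRun_history (i₀ : Fin N) {k t : ℕ} (hk : k ≤ t) (o : Ω) :
    algRun pb pm ruleX ruleY a (fun k => P k o) (fun k => Q k o) (fun k => R k o)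
        (fun k => S k o) k =
      algRun pb pm ruleX ruleY a (extend i₀ (history P Q R S t o) 0)
        (extend i₀ (history P Q R S t o) 1) (extend i₀ (history P Q R S t o) 2)
        (extend i₀ (history P Q R S t o) 3) k := by
  apply algRun_congr <;> intro i hi <;>
    simp [extend, history, lt_of_lt_of_le hi hk]

lemma Params.IsAdmissible.nonempty_fin (hpm : pm.IsAdmissible pb) : Nonempty (Fin N) := by
  by_contra h
  rw [not_nonempty_iff] at h
  have := hpm.p_sum
  simp at this

/-- Factoring through the finite history makes every functional of the run up to time t integrable,
with no measurability required of the proximal rules or of the problem data. -/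
lemma IsSampling.integrable_of_run (hpm : pm.IsAdmissible pb) (hS : IsSampling prob pm P Q R S)
    (t : ℕ) (ψ : (ℕ → AlgState E n N ρ) → ℝ)
    (hψ : ∀ f g : ℕ → AlgState E n N ρ, (∀ k ≤ t, f k = g k) → ψ f = ψ g) :
    Integrable (fun o => ψ (algRun pb pm ruleX ruleY a (fun k => P k o) (fun k => Q k o)
      (fun k => R k o) (fun k => S k o))) prob := by
  obtain ⟨i₀⟩ := hpm.nonempty_fin
  have : IsProbabilityMeasure (prob.map (history P Q R S t)) :=
    Measure.isProbabilityMeasure_map (hS.measurable_history t).aemeasurable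
  have e : (fun o => ψ (algRun pb pm ruleX ruleY a (fun k => P k o) (fun k => Q k o)
      (fun k => R k o) (fun k => S k o))) =
      (fun h => ψ (algRun pb pm ruleX ruleY a (extend i₀ h 0) (extend i₀ h 1) (extend i₀ h 2)
        (extend i₀ h 3))) ∘ history P Q R S t := by
    funext o
    exact hψ _ _ fun k hk => algRun_history i₀ hk o
  rw [e]
  exact (Integrable.of_finite).comp_measurable (hS.measurable_history t)

lemma IsSampling.law_four (hpm : pm.IsAdmissible pb) (hS : IsSampling prob pm P Q R S) (k : ℕ)
    (b : Fin N × Fin N × Fin N × Fin N) :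
    prob.real {o | (P k o, Q k o, R k o, S k o) = b} =
      pm.p b.1 * (pm.q b.2.1 * (pm.r b.2.2.1 * pm.s b.2.2.2)) := by
  obtain ⟨b1, b2, b3, b4⟩ := b
  have hinj : Function.Injective fun j : Fin 4 => ((k, j) : ℕ × Fin 4) := fun i j h =>
    (Prod.ext_iff.1 h).2
  have hind := hS.indep.precomp hinj
  have h := hind.meas_iInter (s := fun j => (fun o => ![P k, Q k, R k, S k] j o) ⁻¹'
      {![b1, b2, b3, b4] j})
    (fun j => ⟨{![b1, b2, b3, b4] j}, measurableSet_singleton _, rfl⟩)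
  have hset : {o | (P k o, Q k o, R k o, S k o) = (b1, b2, b3, b4)} =
      ⋂ j : Fin 4, (fun o => ![P k, Q k, R k, S k] j o) ⁻¹' {![b1, b2, b3, b4] j} := by
    ext o
    simp [Fin.forall_fin_succ]
  rw [Fin.prod_univ_four] at h
  have h1 := hS.law_P k b1
  have h2 := hS.law_Q k b2
  have h3 := hS.law_R k b3
  have h4 := hS.law_S k b4
  rw [measureReal_def, hset, h]
  have e1 : prob ((fun o => ![P k, Q k, R k, S k] 0 o) ⁻¹' {![b1, b2, b3, b4] 0}) =
      ENNReal.ofReal (pm.p b1) := h1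
  have e2 : prob ((fun o => ![P k, Q k, R k, S k] 1 o) ⁻¹' {![b1, b2, b3, b4] 1}) =
      ENNReal.ofReal (pm.q b2) := h2
  have e3 : prob ((fun o => ![P k, Q k, R k, S k] 2 o) ⁻¹' {![b1, b2, b3, b4] 2}) =
      ENNReal.ofReal (pm.r b3) := h3
  have e4 : prob ((fun o => ![P k, Q k, R k, S k] 3 o) ⁻¹' {![b1, b2, b3, b4] 3}) =
      ENNReal.ofReal (pm.s b4) := h4
  rw [e1, e2, e3, e4]
  simp only [ENNReal.toReal_mul, ENNReal.toReal_ofReal (hpm.p_pos b1).le,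
    ENNReal.toReal_ofReal (hpm.q_pos b2).le,
    ENNReal.toReal_ofReal (pos_of_one_div_le hpm.r_ge b3).le,
    ENNReal.toReal_ofReal (pos_of_one_div_le hpm.s_ge b4).le]
  ring

/-- The samples of iteration `k + 1` can be averaged out with the state frozen. -/
lemma IsSampling.integral_step (hpm : pm.IsAdmissible pb) (hS : IsSampling prob pm P Q R S)
    (k : ℕ) (Φ : AlgState E n N ρ → Fin N → Fin N → Fin N → Fin N → ℝ) :
    ∫ o, Φ (algRun pb pm ruleX ruleY a (fun k => P k o) (fun k => Q k o) (fun k => R k o)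
        (fun k => S k o) k) (P k o) (Q k o) (R k o) (S k o) ∂prob =
      ∫ o, ∑ I, pm.p I * ∑ J, pm.q J * ∑ K, pm.r K * ∑ M, pm.s M *
        Φ (algRun pb pm ruleX ruleY a (fun k => P k o) (fun k => Q k o) (fun k => R k o)
        (fun k => S k o) k) I J K M ∂prob := by
  obtain ⟨i₀⟩ := hpm.nonempty_fin
  have hdisj : Disjoint (Finset.range k ×ˢ (Finset.univ : Finset (Fin 4)))
      ({k} ×ˢ (Finset.univ : Finset (Fin 4))) := by
    rw [Finset.disjoint_left]
    rintro ⟨i, j⟩ h1 h2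
    simp at h1 h2
    omega
  have hind := hS.indep.indepFun_finset _ _ hdisj hS.measurable_all
  have hmem : ∀ j : Fin 4, (k, j) ∈ ({k} ×ˢ (Finset.univ : Finset (Fin 4)) :
      Finset (ℕ × Fin 4)) := by simp
  let g : (({k} ×ˢ (Finset.univ : Finset (Fin 4)) : Finset (ℕ × Fin 4)) → Fin N) →
      Fin N × Fin N × Fin N × Fin N := fun h =>
    (h ⟨(k, 0), hmem 0⟩, h ⟨(k, 1), hmem 1⟩, h ⟨(k, 2), hmem 2⟩, h ⟨(k, 3), hmem 3⟩)
  have hind' : IndepFun (history P Q R S k) (fun o => (P k o, Q k o, R k o, S k o)) prob :=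
    hind.comp measurable_id (measurable_of_finite g)
  have hY : Measurable fun o => (P k o, Q k o, R k o, S k o) :=
    (hS.measurable_P k).prodMk ((hS.measurable_Q k).prodMk
      ((hS.measurable_R k).prodMk (hS.measurable_S k)))
  have h := integral_indep_finite (hS.measurable_history k) hY hind'
    (fun h b => Φ (algRun pb pm ruleX ruleY a (extend i₀ h 0) (extend i₀ h 1) (extend i₀ h 2)
        (extend i₀ h 3) k) b.1 b.2.1 b.2.2.1 b.2.2.2)
  simp only [← algRun_history i₀ le_rfl] at h
  rw [h]
  refine integral_congr_ae (Filter.Eventually.of_forall fun o => ?_)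
  simp only [hS.law_four hpm, Fintype.sum_prod_type, Finset.mul_sum]
  refine Finset.sum_congr rfl fun _ _ => Finset.sum_congr rfl fun _ _ =>
    Finset.sum_congr rfl fun _ _ => Finset.sum_congr rfl fun _ _ => ?_
  ring

/-- The gap of an average is at most the average of the gaps. -/
lemma Problem.IsAdmissible.gap_sum_le (hpb : pb.IsAdmissible) (u : E)
    {v : LpVec n ρ} (hv : v ∈ pb.Y) {ι : Type*} (s : Finset ι) {w : ι → ℝ} (hw : ∀ i ∈ s, 0 ≤ w i)
    (hw1 : ∑ i ∈ s, w i = 1) {x : ι → E} (hx : ∀ i ∈ s, x i ∈ pb.X) {y : ι → LpVec n ρ}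
    (hy : ∀ i ∈ s, y i ∈ pb.Y) :
    pb.gap u v (∑ i ∈ s, w i • x i) (∑ i ∈ s, w i • y i) ≤
      ∑ i ∈ s, w i * pb.gap u v (x i) (y i) := by
  have hφ := (hpb.φ_convex.convexOn hpb.μ_nonneg).subset hpb.φ_convex.subset_dom hpb.convex_X
  have hψ := (hpb.ψ_convex.convexOn hpb.ν_nonneg).subset hpb.ψ_convex.subset_dom hpb.convex_Y
  have h1 := hφ.map_sum_le hw hw1 hx
  have h2 := hψ.map_sum_le hw hw1 hy
  have h3 : ∑ j, v j * pb.f j (∑ i ∈ s, w i • x i) ≤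
      ∑ i ∈ s, w i * ∑ j, v j * pb.f j (x i) := by
    simp_rw [Finset.mul_sum]
    rw [Finset.sum_comm]
    refine Finset.sum_le_sum fun j _ => ?_
    rcases hpb.sign j with ⟨l, b, hl⟩ | hs
    · apply le_of_eq
      simp only [hl, map_sum, map_smul, smul_eq_mul]
      have : ∑ i ∈ s, w i * (v j * b) = v j * b := by rw [← Finset.sum_mul, hw1, one_mul]
      rw [mul_add, ← this, Finset.mul_sum, ← Finset.sum_add_distrib]
      exact Finset.sum_congr rfl fun i _ => by ring
    · have := mul_le_mul_of_nonneg_left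
        ((hpb.convex_f j).map_sum_le hw hw1 fun i _ => Set.mem_univ (x i)) (hs v hv)
      refine this.trans (le_of_eq ?_)
      rw [Finset.mul_sum]
      exact Finset.sum_congr rfl fun i _ => by rw [smul_eq_mul]; ring
  have h4 : ∑ j, (∑ i ∈ s, w i • y i) j * pb.f j u = ∑ i ∈ s, w i * ∑ j, y i j * pb.f j u := by
    simp_rw [Finset.mul_sum]
    rw [Finset.sum_comm]
    refine Finset.sum_congr rfl fun j _ => ?_
    have : (∑ i ∈ s, w i • y i) j = ∑ i ∈ s, w i * y i j := by simp
    rw [this, Finset.sum_mul]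
    exact Finset.sum_congr rfl fun i _ => by ring
  have h5 : ∑ i ∈ s, w i * pb.ψ.val v = pb.ψ.val v := by rw [← Finset.sum_mul, hw1, one_mul]
  have h6 : ∑ i ∈ s, w i * pb.φ.val u = pb.φ.val u := by rw [← Finset.sum_mul, hw1, one_mul]
  simp only [smul_eq_mul] at h1 h2
  simp only [Problem.gap, Problem.lagr]
  rw [h4]
  have h7 : ∑ i ∈ s, w i * (∑ j, v j * pb.f j (x i) - pb.ψ.val v + pb.φ.val (x i) -
      (∑ j, y i j * pb.f j u - pb.ψ.val (y i) + pb.φ.val u)) =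
      ∑ i ∈ s, w i * ∑ j, v j * pb.f j (x i) - ∑ i ∈ s, w i * pb.ψ.val v +
      ∑ i ∈ s, w i * pb.φ.val (x i) - (∑ i ∈ s, w i * ∑ j, y i j * pb.f j u -
        ∑ i ∈ s, w i * pb.ψ.val (y i) + ∑ i ∈ s, w i * pb.φ.val u) := by
    simp only [← Finset.sum_sub_distrib, ← Finset.sum_add_distrib]
    exact Finset.sum_congr rfl fun i _ => by ring
  rw [h7, h5, h6]
  linarith

/-- The conditions on the weights under which the Lyapunov argument works. -/
structure WeightsAdmissible (pb : Problem E n N ρ) (pm : Params E n N ρ) (a : ℕ → ℝ) : Prop where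
  zero : a 0 = 0
  pos : ∀ k, 1 ≤ k → 0 < a k
  growth : ∀ k, 1 ≤ k → a (k + 1) ≤ (1 + 1 / (20 * N)) * a k
  smooth : ∀ k, 17 * (constL pb pm * a (k + 1)) ≤ proxCoef a pb.μ pm.μ₀ k
  coupling : ∀ k, 144 * (constG pb pm * a (k + 1)) ^ 2 ≤
    proxCoef a pb.μ pm.μ₀ k * proxCoef a pb.ν pm.ν₀ k

lemma constL_sq (hpm : pm.IsAdmissible pb) :
    ∑ I, pb.L I ^ 2 / (pm.p I * pm.r I ^ 2) = constL pb pm ^ 2 := by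
  rw [constL, Real.sq_sqrt]
  exact Finset.sum_nonneg fun I _ => by have := hpm.p_pos I; positivity

lemma le_constG_sq (hpm : pm.IsAdmissible pb) :
    ∑ I, pb.G I ^ 2 / (pm.q I * pm.r I ^ 2) ≤ constG pb pm ^ 2 := by
  have h0 : 0 ≤ ∑ I, pb.G I ^ 2 / (pm.q I * pm.r I ^ 2) :=
    Finset.sum_nonneg fun I _ => by have := hpm.q_pos I; positivity
  rw [← Real.sq_sqrt h0]
  gcongr
  exact le_max_right _ _

lemma le_constG_sq' (hpm : pm.IsAdmissible pb) (I : Fin N) :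
    pb.G I ^ 2 / (pm.p I * pm.s I ^ 2) ≤ constG pb pm ^ 2 := by
  have h0 : 0 ≤ pb.G I ^ 2 / (pm.p I * pm.s I ^ 2) := by have := hpm.p_pos I; positivity
  have h1 : pb.G I ^ 2 / (pm.p I * pm.s I ^ 2) ≤ ⨆ I, pb.G I ^ 2 / (pm.p I * pm.s I ^ 2) :=
    le_ciSup (f := fun I => pb.G I ^ 2 / (pm.p I * pm.s I ^ 2)) (Set.finite_range _).bddAbove I
  calc _ ≤ _ := h1
    _ = √(⨆ I, pb.G I ^ 2 / (pm.p I * pm.s I ^ 2)) ^ 2 := (Real.sq_sqrt (h0.trans h1)).symm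
    _ ≤ _ := by
      gcongr
      exact le_max_left _ _

/-- The expected gap of the output is at most `(μ₀ Δ_X(u, x₀) + ν₀ Δ_Y(v, y₀)) / (2 A_t)`. -/
theorem expected_gap_le (hpb : pb.IsAdmissible) (hpm : pm.IsAdmissible pb) (hρ : ρ ≤ 2)
    (hrX : IsProxRule pb.X pb.φ pb.genX ruleX) (hrY : IsProxRule pb.Y pb.ψ pb.genY ruleY)
    (htX : HasThreePoint pb.X pb.φ pb.genX pb.μ ruleX)
    (htY : HasThreePoint pb.Y pb.ψ pb.genY pb.ν ruleY)
    (ha : WeightsAdmissible pb pm a) {u : E} (hu : u ∈ pb.X) {v : LpVec n ρ} (hv : v ∈ pb.Y)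
    (hS : IsSampling prob pm P Q R S) {t : ℕ} (ht : 1 ≤ t) :
    let out : Ω → E × LpVec n ρ := fun o =>
      output a (algRun pb pm ruleX ruleY a
        (fun k => P k o) (fun k => Q k o) (fun k => R k o) (fun k => S k o)) t
    (∀ o, (out o).1 ∈ pb.X ∧ (out o).2 ∈ pb.Y) ∧
    Integrable (fun o => pb.gap u v (out o).1 (out o).2) prob ∧
    ∫ o, pb.gap u v (out o).1 (out o).2 ∂prob ≤
      (pm.μ₀ * pb.genX.breg u pm.x₀ + pm.ν₀ * pb.genY.breg v pm.y₀) / 2 / cumSum a t := by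
  intro out
  set run : Ω → ℕ → AlgState E n N ρ := fun o => algRun pb pm ruleX ruleY a
    (fun k => P k o) (fun k => Q k o) (fun k => R k o) (fun k => S k o) with hrun
  have hfe : ∀ o k, (run o k).IsFeasible pb := fun o k =>
    isFeasible_algRun hpb hpm hrX hrY ha.zero ha.pos _ _ _ _ k
  have hA : 0 < cumSum a t := by
    obtain ⟨t, rfl⟩ : ∃ t', t = t' + 1 := ⟨t - 1, by omega⟩
    rw [cumSum_succ]
    have := cumSum_nonneg ha.zero ha.pos t
    have := ha.pos (t + 1) (by omega)
    linarith
  have hAsum : ∑ k ∈ Finset.Icc 1 t, a k = cumSum a t := by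
    rw [cumSum, Finset.range_eq_Ico, Finset.sum_eq_sum_Ico_succ_bot (by omega), ha.zero, zero_add]
    rfl
  have hw0 : ∀ k ∈ Finset.Icc 1 t, 0 ≤ (cumSum a t)⁻¹ * a k := fun k hk =>
    mul_nonneg (inv_nonneg.2 hA.le) (ha.pos k (Finset.mem_Icc.1 hk).1).le
  have hw1 : ∑ k ∈ Finset.Icc 1 t, (cumSum a t)⁻¹ * a k = 1 := by
    rw [← Finset.mul_sum, hAsum, inv_mul_cancel₀ hA.ne']
  have hout : ∀ o, out o = (∑ k ∈ Finset.Icc 1 t, ((cumSum a t)⁻¹ * a k) • (run o k).x.1,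
      ∑ k ∈ Finset.Icc 1 t, ((cumSum a t)⁻¹ * a k) • (run o k).y.1) := by
    intro o
    simp only [out, output, Finset.smul_sum, smul_smul, hrun]
  have hint : Integrable (fun o => pb.gap u v (out o).1 (out o).2) prob := by
    refine hS.integrable_of_run hpm t
      (fun f => pb.gap u v (output a f t).1 (output a f t).2) fun f g hfg => ?_
    have : output a f t = output a g t := by
      simp only [output]
      rw [Finset.sum_congr rfl fun k hk => by rw [hfg k (Finset.mem_Icc.1 hk).2],
        Finset.sum_congr (f := fun k => a k • (f k).y.1) rfl
          fun k hk => by rw [hfg k (Finset.mem_Icc.1 hk).2]]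
    simp only [this]
  refine ⟨fun o => ?_, hint, ?_⟩
  · rw [hout]
    exact ⟨hpb.convex_X.sum_mem hw0 hw1 fun k _ => (hfe o k).x_centre.1.1,
      hpb.convex_Y.sum_mem hw0 hw1 fun k _ => (hfe o k).y_centre.1.1⟩
  have hintk : ∀ k, ∀ φ : AlgState E n N ρ → ℝ, Integrable (fun o => φ (run o k)) prob :=
    fun k φ => hS.integrable_of_run hpm k (fun f => φ (f k)) fun f g h => by rw [h k le_rfl]
  -- With a 0 = 0 in its place the error coefficients could not satisfy the growth condition from k
  -- = 0 to k = 1. Raising b 0 to a 1 is free because `lyapErr` vanishes initially.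
  let b : ℕ → ℝ := fun k => if k = 0 then a 1 else a k
  let V : ℕ → AlgState E n N ρ → ℝ := fun k st =>
    lyapMain pb u v (a k) (proxCoef a pb.μ pm.μ₀ k) (proxCoef a pb.ν pm.ν₀ k) st +
      lyapErr pb pm (b k ^ 2 / proxCoef a pb.μ pm.μ₀ k) (b k ^ 2 / proxCoef a pb.ν pm.ν₀ k) st
  have hc : ∀ k, 0 < proxCoef a pb.μ pm.μ₀ k :=
    proxCoef_pos ha.zero ha.pos hpb.μ_nonneg hpm.μ₀_pos
  have hd : ∀ k, 0 < proxCoef a pb.ν pm.ν₀ k :=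
    proxCoef_pos ha.zero ha.pos hpb.ν_nonneg hpm.ν₀_pos
  have hN : 0 < (N : ℝ) := by
    obtain ⟨i₀⟩ := hpm.nonempty_fin
    exact_mod_cast i₀.pos
  have hab : ∀ k, a k ^ 2 ≤ b k ^ 2 := by
    intro k
    simp only [b]
    split_ifs with h
    · rw [h, ha.zero, zero_pow two_ne_zero]
      exact sq_nonneg _
    · exact le_rfl
  have hbg : ∀ k, b (k + 1) ^ 2 ≤ (1 + 1 / (8 * N)) * b k ^ 2 := by
    intro k
    have h1 : b (k + 1) ≤ (1 + 1 / (20 * N)) * b k := by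
      rcases Nat.eq_zero_or_pos k with rfl | hk
      · have := ha.pos 1 le_rfl
        simp only [b]
        refine le_mul_of_one_le_left this.le ?_
        have : 0 < 1 / (20 * (N : ℝ)) := by positivity
        linarith
      · simp only [b, Nat.succ_ne_zero, if_false, hk.ne']
        exact ha.growth k hk
    have h0 : 0 ≤ b (k + 1) := (ha.pos (k + 1) (by omega)).le
    have hx : 1 / (20 * (N : ℝ)) ≤ 1 := by
      rw [div_le_one (by positivity)]
      have : (1 : ℝ) ≤ N := by exact_mod_cast Nat.one_le_iff_ne_zero.2 (by rintro rfl; simp at hN)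
      linarith
    have hx0 : 0 < 1 / (20 * (N : ℝ)) := by positivity
    -- For x = 1/(20N) ≤ 1/20 one has (1 + x)² ≤ 1 + 5x/2. The resulting 1/(8N) is at most r/4 and
    -- s/4, as `stale_growth` demands.
    have e : 1 / (8 * (N : ℝ)) = 5 / 2 * (1 / (20 * N)) := by
      field_simp
      norm_num
    rw [e]
    calc b (k + 1) ^ 2 ≤ ((1 + 1 / (20 * N)) * b k) ^ 2 := by gcongr
      _ = (1 + 1 / (20 * (N : ℝ))) ^ 2 * b k ^ 2 := by ring
      _ ≤ _ := by
        refine mul_le_mul_of_nonneg_right ?_ (sq_nonneg _)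
        have h20 : 1 / (20 * (N : ℝ)) ≤ 1 / 20 := by
          rw [div_le_div_iff₀ (by positivity) (by norm_num)]
          have : (1 : ℝ) ≤ N := by
            exact_mod_cast Nat.one_le_iff_ne_zero.2 (by rintro rfl; simp at hN)
          linarith
        nlinarith
  have hratio : ∀ e : ℕ → ℝ, (∀ k, 0 < e k) → (∀ k, e k ≤ e (k + 1)) → ∀ k,
      b (k + 1) ^ 2 / e (k + 1) ≤ (1 + 1 / (8 * N)) * (b k ^ 2 / e k) := by
    intro e he hmono k
    have := he k
    calc _ ≤ b (k + 1) ^ 2 / e k := by gcongr; exact hmono k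
      _ ≤ ((1 + 1 / (8 * N)) * b k ^ 2) / e k := by gcongr; exact hbg k
      _ = _ := by ring
  have hstep : ∀ k, a (k + 1) * ∫ o, pb.gap u v (run o (k + 1)).x.1 (run o (k + 1)).y.1 ∂prob +
      ∫ o, V (k + 1) (run o (k + 1)) ∂prob ≤ ∫ o, V k (run o k) ∂prob := by
    intro k
    have ha1 : 0 < a (k + 1) := ha.pos (k + 1) (by omega)
    have hb1 : b (k + 1) = a (k + 1) := if_neg (by omega)
    have hL0 : 0 ≤ constL pb pm := Real.sqrt_nonneg _
    have hηle : b (k + 1) ^ 2 / proxCoef a pb.μ pm.μ₀ (k + 1) ≤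
        a (k + 1) ^ 2 / proxCoef a pb.μ pm.μ₀ k := by
      rw [hb1]
      have := hc k
      gcongr
      exact proxCoef_le_succ ha.pos hpb.μ_nonneg k
    have hζle : b (k + 1) ^ 2 / proxCoef a pb.ν pm.ν₀ (k + 1) ≤
        a (k + 1) ^ 2 / proxCoef a pb.ν pm.ν₀ k := by
      rw [hb1]
      have := hd k
      gcongr
      exact proxCoef_le_succ ha.pos hpb.ν_nonneg k
    rw [← integral_const_mul, ← integral_add ((hintk (k + 1)
      fun st => pb.gap u v st.x.1 st.y.1).const_mul _) (hintk (k + 1) (V (k + 1)))]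
    have h := hS.integral_step (ruleX := ruleX) (ruleY := ruleY) (a := a) hpm k
      (fun st I J K M => a (k + 1) * pb.gap u v (algStep pb pm ruleX ruleY a k I J K M st).x.1
          (algStep pb pm ruleX ruleY a k I J K M st).y.1 +
        V (k + 1) (algStep pb pm ruleX ruleY a k I J K M st))
    refine (le_of_eq h).trans ?_
    refine integral_mono (hintk k fun st => ∑ I, pm.p I * ∑ J, pm.q J * ∑ K, pm.r K *
      ∑ M, pm.s M * (a (k + 1) * pb.gap u v (algStep pb pm ruleX ruleY a k I J K M st).x.1
          (algStep pb pm ruleX ruleY a k I J K M st).y.1 +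
        V (k + 1) (algStep pb pm ruleX ruleY a k I J K M st))) (hintk k (V k)) fun o => ?_
    have hck := hc k
    have hdk := hd k
    have hη0 : 0 ≤ b (k + 1) ^ 2 / proxCoef a pb.μ pm.μ₀ (k + 1) :=
      div_nonneg (sq_nonneg _) (hc _).le
    have hζ0 : 0 ≤ b (k + 1) ^ 2 / proxCoef a pb.ν pm.ν₀ (k + 1) :=
      div_nonneg (sq_nonneg _) (hd _).le
    have hcoup := ha.coupling k
    refine lyap_step hpb hpm hρ hrX hrY htX htY ha.zero ha.pos hu hv k (hfe o k) rfl rfl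
      (div_le_div_of_nonneg_right (hab k) hck.le) (div_le_div_of_nonneg_right (hab k) hdk.le)
      hη0 hζ0 (hratio _ hc (proxCoef_le_succ ha.pos hpb.μ_nonneg) k)
      (hratio _ hd (proxCoef_le_succ ha.pos hpb.ν_nonneg) k) ?_ fun I => ?_
    · rw [constL_sq hpm]
      -- The budget c/4 is divided equally between smoothness and coupling; 17² ≥ 8 · 36 explains
      -- the constant in `smooth`.
      have h1 : 36 * (b (k + 1) ^ 2 / proxCoef a pb.μ pm.μ₀ (k + 1)) * constL pb pm ^ 2 ≤
          proxCoef a pb.μ pm.μ₀ k / 8 := by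
        calc _ ≤ 36 * (a (k + 1) ^ 2 / proxCoef a pb.μ pm.μ₀ k) * constL pb pm ^ 2 := by gcongr
          _ = 36 * (constL pb pm * a (k + 1)) ^ 2 / proxCoef a pb.μ pm.μ₀ k := by ring
          _ ≤ _ := by
            rw [div_le_iff₀ hck]
            have h2 := ha.smooth k
            have h3 : 0 ≤ constL pb pm * a (k + 1) := by positivity
            nlinarith
      have h2 : 8 * (b (k + 1) ^ 2 / proxCoef a pb.ν pm.ν₀ (k + 1)) *
          ∑ I, pb.G I ^ 2 / (pm.q I * pm.r I ^ 2) ≤ proxCoef a pb.μ pm.μ₀ k / 8 := by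
        calc _ ≤ 8 * (a (k + 1) ^ 2 / proxCoef a pb.ν pm.ν₀ k) * constG pb pm ^ 2 := by
              exact mul_le_mul (by gcongr) (le_constG_sq hpm)
                (Finset.sum_nonneg fun I _ => by have := hpm.q_pos I; positivity)
                (by positivity)
          _ = 8 * (constG pb pm * a (k + 1)) ^ 2 / proxCoef a pb.ν pm.ν₀ k := by ring
          _ ≤ _ := by
            rw [div_le_iff₀ hdk]
            nlinarith [sq_nonneg (constG pb pm * a (k + 1))]
      linarith
    -- The constant 144 = 4 · 36 in `coupling` comes from this bound.
    · calc _ ≤ 36 * (a (k + 1) ^ 2 / proxCoef a pb.μ pm.μ₀ k) * constG pb pm ^ 2 := by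
            exact mul_le_mul (by gcongr) (le_constG_sq' hpm I)
              (by have := hpm.p_pos I; positivity) (by positivity)
        _ = 36 * (constG pb pm * a (k + 1)) ^ 2 / proxCoef a pb.μ pm.μ₀ k := by ring
        _ ≤ _ := by
            rw [div_le_iff₀ hck]
            linarith
  have htel : ∀ m, ∑ k ∈ Finset.range m, a (k + 1) *
      ∫ o, pb.gap u v (run o (k + 1)).x.1 (run o (k + 1)).y.1 ∂prob +
      ∫ o, V m (run o m) ∂prob ≤ ∫ o, V 0 (run o 0) ∂prob := by
    intro m
    induction m with
    | zero => simp
    | succ m ih =>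
      rw [Finset.sum_range_succ]
      have := hstep m
      linarith
  have hV0 : ∫ o, V 0 (run o 0) ∂prob =
      (pm.μ₀ * pb.genX.breg u pm.x₀ + pm.ν₀ * pb.genY.breg v pm.y₀) / 2 := by
    have : ∀ o, V 0 (run o 0) =
        (pm.μ₀ * pb.genX.breg u pm.x₀ + pm.ν₀ * pb.genY.breg v pm.y₀) / 2 := by
      intro o
      simp only [V, hrun]
      rw [lyapErr_zero, lyapMain, ha.zero]
      simp [algRun, proxCoef, cumSum, ha.zero]
      ring
    simp [this]
  have hVt : 0 ≤ ∫ o, V t (run o t) ∂prob := integral_nonneg fun o =>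
    lyap_nonneg hpb hpm hρ hu hv (hfe o t) (hc t) (hd t)
      (div_le_div_of_nonneg_right (hab t) (hc t).le) (div_le_div_of_nonneg_right (hab t) (hd t).le)
  have hjen : ∫ o, pb.gap u v (out o).1 (out o).2 ∂prob ≤
      ∫ o, ∑ k ∈ Finset.Icc 1 t, (cumSum a t)⁻¹ * a k *
        pb.gap u v (run o k).x.1 (run o k).y.1 ∂prob := by
    refine integral_mono hint (integrable_finsetSum _ fun k _ =>
      (hintk k fun st => pb.gap u v st.x.1 st.y.1).const_mul _) fun o => ?_
    simp only [hout]
    exact hpb.gap_sum_le u hv _ hw0 hw1 (fun k _ => (hfe o k).x_centre.1.1)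
      fun k _ => (hfe o k).y_centre.1.1
  refine hjen.trans ?_
  rw [integral_finsetSum _ fun k _ =>
      (hintk k fun st => pb.gap u v st.x.1 st.y.1).const_mul _]
  simp_rw [integral_const_mul, mul_assoc]
  rw [← Finset.mul_sum, inv_mul_eq_div]
  refine div_le_div_of_nonneg_right ?_ hA.le
  have h1 := htel t
  rw [hV0] at h1
  have e : ∑ k ∈ Finset.Icc 1 t, a k *
      ∫ o, pb.gap u v (run o k).x.1 (run o k).y.1 ∂prob = ∑ k ∈ Finset.range t, a (k + 1) *
      ∫ o, pb.gap u v (run o (k + 1)).x.1 (run o (k + 1)).y.1 ∂prob := by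
    rw [Finset.range_eq_Ico, Finset.sum_Ico_add' (fun k => a k *
      ∫ o, pb.gap u v (run o k).x.1 (run o k).y.1 ∂prob) 0 t 1]
    rfl
  rw [e]
  linarith

end Expectation

/-! ### Growth of the weights -/

section Weights

/-- The weight that follows the partial sum `A`. -/
def nextWeight (τ l g A : ℝ) : ℝ := A / (τ + l * A + g * √A)

/-- The partial sums of the weights, from the first one on. -/
def weightSum (τ l g M : ℝ) : ℕ → ℝ
  | 0 => M
  | k + 1 => weightSum τ l g M k + nextWeight τ l g (weightSum τ l g M k)

/-- The weights. -/
def weights (τ l g M : ℝ) : ℕ → ℝ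
  | 0 => 0
  | 1 => M
  | k + 2 => nextWeight τ l g (weightSum τ l g M k)

variable {τ l g M : ℝ}

lemma nextWeight_pos (hτ : 1 ≤ τ) (hl : 0 ≤ l) (hg : 0 ≤ g) {A : ℝ} (hA : 0 < A) :
    0 < nextWeight τ l g A := by
  have : 0 < τ := by linarith
  rw [nextWeight]
  positivity

lemma nextWeight_le (hτ : 1 ≤ τ) (hl : 0 ≤ l) (hg : 0 ≤ g) {A : ℝ} (hA : 0 < A) :
    nextWeight τ l g A ≤ A / τ := by
  have : 0 < τ := by linarith
  rw [nextWeight]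
  have h1 : 0 ≤ l * A := by positivity
  have h2 : 0 ≤ g * √A := by positivity
  gcongr
  linarith

lemma weightSum_pos (hτ : 1 ≤ τ) (hl : 0 ≤ l) (hg : 0 ≤ g) (hM : 0 < M) (k : ℕ) :
    0 < weightSum τ l g M k := by
  induction k with
  | zero => exact hM
  | succ k ih => exact add_pos ih (nextWeight_pos hτ hl hg ih)

lemma le_weightSum (hτ : 1 ≤ τ) (hl : 0 ≤ l) (hg : 0 ≤ g) (hM : 0 < M) (k : ℕ) :
    M ≤ weightSum τ l g M k := by
  induction k with
  | zero => exact le_rfl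
  | succ k ih =>
    have := nextWeight_pos hτ hl hg (weightSum_pos hτ hl hg hM k)
    rw [weightSum]
    linarith

lemma cumSum_weights (k : ℕ) : cumSum (weights τ l g M) (k + 1) = weightSum τ l g M k := by
  induction k with
  | zero => simp [cumSum, Finset.sum_range_succ, weights, weightSum]
  | succ k ih => rw [cumSum_succ, ih, weightSum, weights]

lemma weights_pos (hτ : 1 ≤ τ) (hl : 0 ≤ l) (hg : 0 ≤ g) (hM : 0 < M) :
    ∀ k, 1 ≤ k → 0 < weights τ l g M k
  | 1, _ => hM
  | k + 2, _ => nextWeight_pos hτ hl hg (weightSum_pos hτ hl hg hM k)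

/-- The denominator of `nextWeight` is increasing in A, so the weights grow by no larger factor than
the partial sums, that is, by at most 1 + 1/τ. -/
lemma weights_growth (hτ : 1 ≤ τ) (hl : 0 ≤ l) (hg : 0 ≤ g) (hM : 0 < M) :
    ∀ k, 1 ≤ k → weights τ l g M (k + 1) ≤ (1 + 1 / τ) * weights τ l g M k
  | 1, _ => by
    have hτ0 : 0 < τ := by linarith
    change nextWeight τ l g M ≤ (1 + 1 / τ) * M
    refine (nextWeight_le hτ hl hg hM).trans ?_
    rw [add_mul, one_div_mul_eq_div]
    linarith
  | k + 2, _ => by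
    have hτ0 : 0 < τ := by linarith
    have hA := weightSum_pos hτ hl hg hM k
    have hA' := weightSum_pos hτ hl hg hM (k + 1)
    have h1 := nextWeight_le hτ hl hg hA
    have h2 := nextWeight_pos hτ hl hg hA
    have h3 : weightSum τ l g M (k + 1) ≤ (1 + 1 / τ) * weightSum τ l g M k := by
      rw [weightSum, add_mul, one_div_mul_eq_div]
      linarith
    have h4 : weightSum τ l g M k ≤ weightSum τ l g M (k + 1) := by
      rw [weightSum]
      linarith
    change nextWeight τ l g (weightSum τ l g M (k + 1)) ≤
      (1 + 1 / τ) * nextWeight τ l g (weightSum τ l g M k)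
    rw [nextWeight, nextWeight, ← mul_div_assoc]
    gcongr

/-- The recursion says τ x/A + l x + g x/√A = 1 for the increment x. As x ≤ A, the terms x/A and
x/√A are at most 2 and 3 times the increments of ln A and √A, so the potential counts iterations. -/
lemma one_le_potential_sub (hτ : 1 ≤ τ) (hl : 0 ≤ l) (hg : 0 ≤ g) {A A' : ℝ} (hA : 0 < A)
    (hA' : A' = A + nextWeight τ l g A) :
    1 ≤ (2 * τ * Real.log A' + l * A' + 3 * g * √A') -
      (2 * τ * Real.log A + l * A + 3 * g * √A) := by
  have hτ0 : 0 < τ := by linarith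
  set x := nextWeight τ l g A with hx
  have hx0 : 0 < x := nextWeight_pos hτ hl hg hA
  have hxA : x ≤ A := (nextWeight_le hτ hl hg hA).trans (div_le_self hA.le hτ)
  have hA'0 : 0 < A' := by linarith
  have hlog : x / A ≤ 2 * (Real.log A' - Real.log A) := by
    rw [← Real.log_div hA'0.ne' hA.ne']
    have h1 := Real.one_sub_inv_le_log_of_pos (div_pos hA'0 hA)
    have h2 : x / A ≤ 2 * (1 - (A' / A)⁻¹) := by
      rw [inv_div, one_sub_div hA'0.ne', hA', add_sub_cancel_left, ← mul_div_assoc,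
        div_le_div_iff₀ hA (by linarith)]
      nlinarith
    linarith
  have hs : 0 < √A := Real.sqrt_pos.2 hA
  have hsq : x / √A ≤ 3 * (√A' - √A) := by
    rw [div_le_iff₀ hs]
    have h1 : √A * √A = A := Real.mul_self_sqrt hA.le
    have h2 : √A' * √A' = A' := Real.mul_self_sqrt hA'0.le
    have h3 : √A ≤ √A' := Real.sqrt_le_sqrt (by linarith)
    have h4 : √A' ≤ 2 * √A := by
      rw [Real.sqrt_le_left (by positivity)]
      nlinarith
    have h5 : x = (√A' - √A) * (√A' + √A) := by nlinarith
    rw [h5]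
    nlinarith
  have hone : τ * (x / A) + l * x + g * (x / √A) = 1 := by
    have hden : 0 < τ + l * A + g * √A := by positivity
    have h1 : A / √A = √A := Real.div_sqrt
    have e : x / √A = √A / (τ + l * A + g * √A) := by
      rw [hx, nextWeight, div_right_comm, h1]
    rw [e, hx, nextWeight]
    field_simp
  have h1 := mul_le_mul_of_nonneg_left hlog hτ0.le
  have h2 := mul_le_mul_of_nonneg_left hsq hg
  rw [hA'] at *
  linarith

/-- The partial sums of the weights reach the level `B` in due time. -/
lemma le_weightSum_of_le (hτ : 1 ≤ τ) (hl : 0 ≤ l) (hg : 0 ≤ g) (hM : 0 < M) {B : ℝ} (hB : 0 < B)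
    {k : ℕ} (hk : 2 * τ * Real.log (B / M) + l * B + 3 * g * √B ≤ k) :
    B ≤ weightSum τ l g M k := by
  have hτ0 : 0 < τ := by linarith
  have hpot : ∀ k : ℕ, (k : ℝ) ≤ (2 * τ * Real.log (weightSum τ l g M k) +
      l * weightSum τ l g M k + 3 * g * √(weightSum τ l g M k)) -
      (2 * τ * Real.log M + l * M + 3 * g * √M) := by
    intro k
    induction k with
    | zero => simp [weightSum]
    | succ k ih =>
      have := one_le_potential_sub hτ hl hg (weightSum_pos hτ hl hg hM k) rfl
      rw [weightSum]
      push_cast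
      linarith
  by_contra! h
  have hA := weightSum_pos hτ hl hg hM k
  have h1 := Real.log_lt_log hA h
  have h2 : √(weightSum τ l g M k) ≤ √B := Real.sqrt_le_sqrt h.le
  have h3 := hpot k
  rw [Real.log_div hB.ne' hM.ne'] at hk
  have h4 := mul_lt_mul_of_pos_left h1 (by positivity : 0 < 2 * τ)
  have h5 := mul_le_mul_of_nonneg_left h2 (by positivity : 0 ≤ 3 * g)
  have h6 := mul_le_mul_of_nonneg_left h.le hl
  have h7 : 0 ≤ l * M := by positivity
  have h8 : 0 ≤ 3 * g * √M := by positivity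
  linarith

set_option maxHeartbeats 1000000 in
/-- The parameters of the weights in the four regimes of the strong convexity moduli, as
conditions on real numbers. -/
lemma exists_weight_params {L G μ ν μ₀ ν₀ D ε N Λ : ℝ} (hL : 0 ≤ L) (hG : 0 ≤ G) (hμ : 0 ≤ μ)
    (hν : 0 ≤ ν) (hμ₀ : 0 < μ₀) (hν₀ : 0 < ν₀) (hD : 0 ≤ D) (hε : 0 < ε) (hN : 1 ≤ N)
    (hΛ : 1 ≤ Λ) {T : ℝ}
    (hT : T = if 0 < μ then
      if 0 < ν then (N + L / μ + G / √(μ * ν)) * Λ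
      else (N + L / μ) * Λ + G * √(√(μ₀ / ν₀) * D / (μ * ε))
      else if 0 < ν then
        N * Λ + L * √(ν₀ / μ₀) * D / ε + G * √(√(ν₀ / μ₀) * D / (ν * ε))
      else N * Λ + (L * √(ν₀ / μ₀) + G) * D / ε) :
    ∃ τ l g : ℝ, 20 * N ≤ τ ∧ 0 ≤ l ∧ 0 ≤ g ∧
      (∀ A, 0 < A → 34 * L * A ≤ (τ + l * A + g * √A) * (A * μ + μ₀)) ∧
      (∀ A, 0 < A → (34 * G * A) ^ 2 ≤
        (τ + l * A + g * √A) ^ 2 * ((A * μ + μ₀) * (A * ν + ν₀))) ∧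
      8 * τ * Λ + l * (√(μ₀ * ν₀) * D / (2 * ε)) + 3 * g * √(√(μ₀ * ν₀) * D / (2 * ε)) ≤
        299 * T ∧ 1 ≤ T := by
  have hNΛ : 1 ≤ N * Λ := by nlinarith
  have hN0 : 0 < N := by linarith
  have hΛ0 : 0 < Λ := by linarith
  have e1 : √(μ₀ * ν₀) = √μ₀ * √ν₀ := Real.sqrt_mul hμ₀.le _
  have e2 : √(ν₀ / μ₀) = √ν₀ / √μ₀ := Real.sqrt_div hν₀.le _
  have e3 : √(μ₀ / ν₀) = √μ₀ / √ν₀ := Real.sqrt_div hμ₀.le _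
  have sm : 0 < √μ₀ := Real.sqrt_pos.2 hμ₀
  have sn : 0 < √ν₀ := Real.sqrt_pos.2 hν₀
  have qm : √μ₀ ^ 2 = μ₀ := Real.sq_sqrt hμ₀.le
  have qn : √ν₀ ^ 2 = ν₀ := Real.sq_sqrt hν₀.le
  -- The denominator must dominate 34 L A / (A μ + μ₀) and 34 G A / √((A μ + μ₀)(A ν + ν₀)).
  -- Depending on which moduli vanish, these are at most a constant, a multiple of √A or a multiple
  -- of A, and contribute to τ, g or l accordingly.
  rcases hμ.eq_or_lt with hμ0 | hμ0 <;> rcases hν.eq_or_lt with hν0 | hν0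
  · rw [if_neg (by rw [← hμ0]; exact lt_irrefl _), if_neg (by rw [← hν0]; exact lt_irrefl _)] at hT
    refine ⟨20 * N, 34 * (L * √(ν₀ / μ₀) + G) / √(μ₀ * ν₀), 0, le_rfl, by positivity, le_rfl,
      fun A hA => ?_, fun A hA => ?_, ?_, ?_⟩
    · rw [← hμ0, e1, e2]
      have h : 34 * (L * (√ν₀ / √μ₀) + G) / (√μ₀ * √ν₀) * A * μ₀ =
          34 * L * A + 34 * G * A * √μ₀ / √ν₀ := by
        field_simp
        rw [qm]
        ring
      have h1 : 0 ≤ 34 * G * A * √μ₀ / √ν₀ := by positivity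
      nlinarith [mul_pos hN0 hμ₀]
    · rw [← hμ0, ← hν0]
      have h : (34 * G / √(μ₀ * ν₀) * A) ^ 2 * (μ₀ * ν₀) = (34 * G * A) ^ 2 := by
        rw [mul_pow, div_pow, Real.sq_sqrt (by positivity)]
        field_simp
      rw [← h]
      simp only [mul_zero, zero_add, zero_mul, add_zero]
      have h1 : 34 * G / √(μ₀ * ν₀) * A ≤ 20 * N + 34 * (L * √(ν₀ / μ₀) + G) / √(μ₀ * ν₀) * A := by
        have h2 : 34 * G / √(μ₀ * ν₀) ≤ 34 * (L * √(ν₀ / μ₀) + G) / √(μ₀ * ν₀) := by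
          have : 0 ≤ L * √(ν₀ / μ₀) := by positivity
          gcongr
          linarith
        nlinarith
      gcongr
    · rw [hT]
      have h : 34 * (L * √(ν₀ / μ₀) + G) / √(μ₀ * ν₀) * (√(μ₀ * ν₀) * D / (2 * ε)) =
          17 * ((L * √(ν₀ / μ₀) + G) * D / ε) := by
        have : √(μ₀ * ν₀) ≠ 0 := by positivity
        field_simp
        ring
      rw [h]
      have h1 : 0 ≤ (L * √(ν₀ / μ₀) + G) * D / ε := by positivity
      nlinarith
    · rw [hT]
      have h1 : 0 ≤ (L * √(ν₀ / μ₀) + G) * D / ε := by positivity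
      linarith
  · rw [if_neg (by rw [← hμ0]; exact lt_irrefl _), if_pos hν0] at hT
    refine ⟨20 * N, 34 * L / μ₀, 34 * G / √(μ₀ * ν), le_rfl, by positivity, by positivity,
      fun A hA => ?_, fun A hA => ?_, ?_, ?_⟩
    · rw [← hμ0]
      have h : 34 * L / μ₀ * A * μ₀ = 34 * L * A := by field_simp
      have h1 : 0 ≤ 34 * G / √(μ₀ * ν) * √A := by positivity
      nlinarith [mul_pos hN0 hμ₀]
    · rw [← hμ0]
      have h : (34 * G / √(μ₀ * ν) * √A) ^ 2 * (μ₀ * (A * ν)) = (34 * G * A) ^ 2 := by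
        rw [mul_pow, div_pow, Real.sq_sqrt (by positivity), Real.sq_sqrt hA.le]
        field_simp
      rw [← h, mul_zero, zero_add]
      have h1 : 0 ≤ 34 * L / μ₀ * A := by positivity
      gcongr <;> linarith
    · rw [hT]
      have h : 34 * L / μ₀ * (√(μ₀ * ν₀) * D / (2 * ε)) = 17 * (L * √(ν₀ / μ₀) * D / ε) := by
        rw [e1, e2, ← qm]
        simp only [Real.sqrt_sq sm.le]
        field_simp
        ring
      have h2 : 34 * G / √(μ₀ * ν) * √(√(μ₀ * ν₀) * D / (2 * ε)) ≤
          34 * (G * √(√(ν₀ / μ₀) * D / (ν * ε))) := by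
        rw [div_mul_eq_mul_div, mul_div_assoc, ← Real.sqrt_div (by positivity), mul_assoc]
        have h3 : √(μ₀ * ν₀) * D / (2 * ε) / (μ₀ * ν) ≤ √(ν₀ / μ₀) * D / (ν * ε) := by
          have : √(μ₀ * ν₀) * D / (2 * ε) / (μ₀ * ν) = (√(ν₀ / μ₀) * D / (ν * ε)) / 2 := by
            rw [e1, e2]
            nth_rewrite 2 [← qm]
            field_simp
          rw [this]
          exact half_le_self (by positivity)
        gcongr
      rw [h, mul_assoc 3]
      have h1 : 0 ≤ L * √(ν₀ / μ₀) * D / ε := by positivity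
      have h4 : 0 ≤ G * √(√(ν₀ / μ₀) * D / (ν * ε)) := by positivity
      nlinarith
    · rw [hT]
      have h1 : 0 ≤ L * √(ν₀ / μ₀) * D / ε := by positivity
      have h4 : 0 ≤ G * √(√(ν₀ / μ₀) * D / (ν * ε)) := by positivity
      linarith
  · rw [if_pos hμ0, if_neg (by rw [← hν0]; exact lt_irrefl _)] at hT
    have hLμ : 0 ≤ L / μ := by positivity
    refine ⟨20 * N + 34 * (L / μ), 0, 34 * G / √(μ * ν₀), by linarith, le_rfl, by positivity,
      fun A hA => ?_, fun A hA => ?_, ?_, ?_⟩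
    · have h : 34 * (L / μ) * (A * μ) = 34 * L * A := by field_simp
      rw [← h]
      have h1 : 0 ≤ 34 * G / √(μ * ν₀) * √A := by positivity
      have h2 : 0 < A * μ := by positivity
      have h3 : 0 ≤ 34 * (L / μ) := by positivity
      gcongr <;> linarith
    · rw [← hν0]
      have h : (34 * G / √(μ * ν₀) * √A) ^ 2 * ((A * μ) * ν₀) = (34 * G * A) ^ 2 := by
        rw [mul_pow, div_pow, Real.sq_sqrt (by positivity), Real.sq_sqrt hA.le]
        field_simp
      rw [← h, mul_zero, zero_add, zero_mul, add_zero]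
      gcongr <;> linarith
    · rw [hT]
      have h2 : 34 * G / √(μ * ν₀) * √(√(μ₀ * ν₀) * D / (2 * ε)) ≤
          34 * (G * √(√(μ₀ / ν₀) * D / (μ * ε))) := by
        rw [div_mul_eq_mul_div, mul_div_assoc, ← Real.sqrt_div (by positivity), mul_assoc]
        have h3 : √(μ₀ * ν₀) * D / (2 * ε) / (μ * ν₀) ≤ √(μ₀ / ν₀) * D / (μ * ε) := by
          have : √(μ₀ * ν₀) * D / (2 * ε) / (μ * ν₀) = (√(μ₀ / ν₀) * D / (μ * ε)) / 2 := by
            rw [e1, e3]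
            nth_rewrite 2 [← qn]
            field_simp
          rw [this]
          exact half_le_self (by positivity)
        gcongr
      rw [zero_mul, mul_assoc 3]
      have h4 : 0 ≤ G * √(√(μ₀ / ν₀) * D / (μ * ε)) := by positivity
      have h5 : 0 ≤ L / μ * Λ := by positivity
      nlinarith
    · rw [hT]
      have h4 : 0 ≤ G * √(√(μ₀ / ν₀) * D / (μ * ε)) := by positivity
      have h5 : 0 ≤ L / μ * Λ := by positivity
      nlinarith
  · rw [if_pos hμ0, if_pos hν0] at hT
    have hLμ : 0 ≤ L / μ := by positivity
    have hGμ : 0 ≤ G / √(μ * ν) := by positivity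
    refine ⟨20 * N + 34 * (L / μ) + 34 * (G / √(μ * ν)), 0, 0, by linarith, le_rfl, le_rfl,
      fun A hA => ?_, fun A hA => ?_, ?_, ?_⟩
    · have h : 34 * (L / μ) * (A * μ) = 34 * L * A := by field_simp
      rw [← h]
      have h2 : 0 < A * μ := by positivity
      have h3 : 0 ≤ 34 * (L / μ) := by positivity
      gcongr <;> linarith
    · have h : (34 * (G / √(μ * ν))) ^ 2 * ((A * μ) * (A * ν)) = (34 * G * A) ^ 2 := by
        rw [mul_pow, div_pow, Real.sq_sqrt (by positivity)]
        field_simp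
      rw [← h]
      gcongr <;> linarith
    · rw [hT, zero_mul, mul_zero, zero_mul]
      have h5 : 0 ≤ L / μ * Λ := by positivity
      have h6 : 0 ≤ G / √(μ * ν) * Λ := by positivity
      nlinarith
    · rw [hT]
      have h5 : 0 ≤ L / μ * Λ := by positivity
      have h6 : 0 ≤ G / √(μ * ν) * Λ := by positivity
      nlinarith

end Weights

/-! ### Iteration complexity -/

section Complexity

variable {E : Type v} [NormedAddCommGroup E] [NormedSpace ℝ E]
variable {n N : ℕ} {ρ : ℝ≥0∞} [Fact (1 ≤ ρ)]
variable {pb : Problem E n N ρ} {pm : Params E n N ρ}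
  {ruleX : ℝ → ℝ → (E →L[ℝ] ℝ) → E × (E →L[ℝ] ℝ) → E × (E →L[ℝ] ℝ)}
  {ruleY : ℝ → ℝ → (LpVec n ρ →L[ℝ] ℝ) → LpVec n ρ × (LpVec n ρ →L[ℝ] ℝ) →
    LpVec n ρ × (LpVec n ρ →L[ℝ] ℝ)}

lemma constL_nonneg : 0 ≤ constL pb pm := Real.sqrt_nonneg _

lemma constG_nonneg : 0 ≤ constG pb pm := (Real.sqrt_nonneg _).trans (le_max_left _ _)

/-- Here 34 = 2 · 17 compensates the factor 1/2 in `proxCoef`, and 34² ≥ 4 · 144. The first weight M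
is not produced by the recursion and has its own two conditions. -/
lemma weightsAdmissible {τ l g M : ℝ} (hpm : pm.IsAdmissible pb)
    (hτ : 20 * (N : ℝ) ≤ τ) (hl : 0 ≤ l) (hg : 0 ≤ g) (hM : 0 < M)
    (hL : ∀ A, 0 < A → 34 * constL pb pm * A ≤ (τ + l * A + g * √A) * (A * pb.μ + pm.μ₀))
    (hG : ∀ A, 0 < A → (34 * constG pb pm * A) ^ 2 ≤
        (τ + l * A + g * √A) ^ 2 * ((A * pb.μ + pm.μ₀) * (A * pb.ν + pm.ν₀)))
    (hLM : 34 * constL pb pm * M ≤ pm.μ₀)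
    (hGM : (34 * constG pb pm * M) ^ 2 ≤ pm.μ₀ * pm.ν₀) :
    WeightsAdmissible pb pm (weights τ l g M) := by
  have hN : (1 : ℝ) ≤ N := by
    obtain ⟨i₀⟩ := hpm.nonempty_fin
    exact_mod_cast i₀.pos
  have hτ1 : 1 ≤ τ := by linarith
  have hτ0 : 0 < τ := by linarith
  have hLG : ∀ k, 34 * (constL pb pm * weights τ l g M (k + 1)) ≤
        cumSum (weights τ l g M) k * pb.μ + pm.μ₀ ∧
      (34 * (constG pb pm * weights τ l g M (k + 1))) ^ 2 ≤
        (cumSum (weights τ l g M) k * pb.μ + pm.μ₀) *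
          (cumSum (weights τ l g M) k * pb.ν + pm.ν₀) := by
    intro k
    match k with
    | 0 =>
      simp only [cumSum, zero_add, Finset.range_one, Finset.sum_singleton, weights, zero_mul]
      rw [← mul_assoc, ← mul_assoc]
      exact ⟨hLM, hGM⟩
    | k + 1 =>
      rw [cumSum_weights]
      change 34 * (constL pb pm * nextWeight τ l g (weightSum τ l g M k)) ≤ _ ∧
        (34 * (constG pb pm * nextWeight τ l g (weightSum τ l g M k))) ^ 2 ≤ _
      have hA := weightSum_pos hτ1 hl hg hM k
      set A := weightSum τ l g M k
      have hden : 0 < τ + l * A + g * √A := by positivity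
      rw [nextWeight, ← mul_assoc, ← mul_assoc, ← mul_div_assoc, ← mul_div_assoc, div_pow,
        div_le_iff₀ hden, div_le_iff₀ (by positivity)]
      exact ⟨(hL A hA).trans (le_of_eq (mul_comm _ _)), (hG A hA).trans (le_of_eq (mul_comm _ _))⟩
  refine ⟨rfl, weights_pos hτ1 hl hg hM, fun k hk => ?_, fun k => ?_, fun k => ?_⟩
  · refine (weights_growth hτ1 hl hg hM k hk).trans ?_
    have := weights_pos hτ1 hl hg hM k hk
    gcongr
  · have := (hLG k).1
    rw [proxCoef]
    linarith
  · have h := (hLG k).2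
    rw [mul_pow] at h
    rw [proxCoef, proxCoef]
    have := sq_nonneg (constG pb pm * weights τ l g M (k + 1))
    linarith

/-- By `expected_gap_le` it suffices that A_t reach B = √(μ₀ν₀) D₀ / (2ε). The logarithm of the
bound is that of the ratio of B to the first weight. -/
theorem achievesComplexity (hpb : pb.IsAdmissible) (hpm : pm.IsAdmissible pb) (hρ : ρ ≤ 2)
    (hrX : IsProxRule pb.X pb.φ pb.genX ruleX) (hrY : IsProxRule pb.Y pb.ψ pb.genY ruleY)
    (htX : HasThreePoint pb.X pb.φ pb.genX pb.μ ruleX)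
    (htY : HasThreePoint pb.Y pb.ψ pb.genY pb.ν ruleY) :
    AchievesComplexity.{v, w} 300 pb pm ruleX ruleY := by
  intro u hu v hv ε hε
  have hN : (1 : ℝ) ≤ N := by
    obtain ⟨i₀⟩ := hpm.nonempty_fin
    exact_mod_cast i₀.pos
  have hL0 : 0 ≤ constL pb pm := constL_nonneg
  have hG0 : 0 ≤ constG pb pm := constG_nonneg
  have hμ₀ := hpm.μ₀_pos
  have hν₀ := hpm.ν₀_pos
  have hbx : 0 ≤ pb.genX.breg u pm.x₀ :=
    le_trans (by positivity) (hpb.genX_convex.sq_le_breg hpm.x₀_centre hu)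
  have hby : 0 ≤ pb.genY.breg v pm.y₀ :=
    le_trans (by positivity) (hpb.genY_convex.sq_le_breg hpm.y₀_centre hv)
  have hD : 0 ≤ initDist pb pm u v := by
    rw [initDist]
    positivity
  have hΛ : 1 ≤ logTerm pb pm u v ε := le_max_left _ _
  have hT : iterBound pb pm u v ε = if 0 < pb.μ then
      if 0 < pb.ν then
        (N + constL pb pm / pb.μ + constG pb pm / √(pb.μ * pb.ν)) * logTerm pb pm u v ε
      else (N + constL pb pm / pb.μ) * logTerm pb pm u v ε +
        constG pb pm * √(√(pm.μ₀ / pm.ν₀) * initDist pb pm u v / (pb.μ * ε))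
      else if 0 < pb.ν then
        N * logTerm pb pm u v ε + constL pb pm * √(pm.ν₀ / pm.μ₀) * initDist pb pm u v / ε +
          constG pb pm * √(√(pm.ν₀ / pm.μ₀) * initDist pb pm u v / (pb.ν * ε))
      else N * logTerm pb pm u v ε +
        (constL pb pm * √(pm.ν₀ / pm.μ₀) + constG pb pm) * initDist pb pm u v / ε := by
    rw [iterBound]
  obtain ⟨τ, l, g, hτ, hl, hg, hwL, hwG, hTle, hT1⟩ := exists_weight_params hL0 hG0
    hpb.μ_nonneg hpb.ν_nonneg hμ₀ hν₀ hD hε hN hΛ hT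
  have hτ1 : 1 ≤ τ := by linarith
  set κ := constL pb pm * √(pm.ν₀ / pm.μ₀) + constG pb pm with hκ
  set B := √(pm.μ₀ * pm.ν₀) * initDist pb pm u v / (2 * ε) with hB
  have hB0 : 0 ≤ B := by positivity
  have hs : 0 < √(pm.μ₀ * pm.ν₀) := by positivity
  have hLs : 0 ≤ constL pb pm * √(pm.ν₀ / pm.μ₀) := by positivity
  have hκ0 : 0 ≤ κ := add_nonneg hLs hG0
  -- The largest M with 34 κ M ≤ √(μ₀ν₀) meets both conditions on the first weight and gives B/M =
  -- 17 C₀/ε. For κ = 0 there is no restriction, and M = B + 1 reaches the target at once.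
  obtain ⟨M, hM, hMκ, hMB⟩ : ∃ M, 0 < M ∧ 34 * κ * M ≤ √(pm.μ₀ * pm.ν₀) ∧
      (M < B → 0 < κ ∧ B / M = 17 * (κ * initDist pb pm u v / ε)) := by
    rcases hκ0.eq_or_lt with h | h
    · refine ⟨B + 1, by linarith, ?_, fun h => by linarith⟩
      rw [← h]
      simp
    · refine ⟨√(pm.μ₀ * pm.ν₀) / (34 * κ), by positivity, le_of_eq (by field_simp),
        fun _ => ⟨h, ?_⟩⟩
      rw [hB]
      field_simp
      ring
  have hLM : 34 * constL pb pm * M ≤ pm.μ₀ := by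
    have h1 : 34 * (constL pb pm * √(pm.ν₀ / pm.μ₀)) * M ≤ √(pm.μ₀ * pm.ν₀) := by
      refine le_trans ?_ hMκ
      gcongr
      linarith
    have h2 : √(pm.μ₀ * pm.ν₀) = pm.μ₀ * √(pm.ν₀ / pm.μ₀) := by
      rw [Real.sqrt_mul hμ₀.le, Real.sqrt_div hν₀.le]
      nth_rewrite 2 [← Real.mul_self_sqrt hμ₀.le]
      have : √pm.μ₀ ≠ 0 := by positivity
      field_simp
    have h3 : 0 < √(pm.ν₀ / pm.μ₀) := by positivity
    rw [h2] at h1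
    refine le_of_mul_le_mul_right ?_ h3
    linarith
  have hGM : (34 * constG pb pm * M) ^ 2 ≤ pm.μ₀ * pm.ν₀ := by
    rw [← Real.sq_sqrt (mul_pos hμ₀ hν₀).le]
    have : 34 * constG pb pm * M ≤ 34 * κ * M := by
      gcongr
      linarith
    gcongr
    exact this.trans hMκ
  have hadm := weightsAdmissible hpm hτ hl hg hM hwL hwG hLM hGM
  refine ⟨weights τ l g M, hadm.zero, hadm.pos, fun Ω _ prob _ P Q R S hS t ht => ?_⟩
  have ht1 : 1 ≤ t := by
    have : (1 : ℝ) ≤ t := by linarith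
    exact_mod_cast this
  obtain ⟨h1, h2, h3⟩ := expected_gap_le hpb hpm hρ hrX hrY htX htY hadm hu hv hS ht1
  refine ⟨h1, h2, h3.trans ?_⟩
  obtain ⟨k, rfl⟩ : ∃ k, t = k + 1 := ⟨t - 1, by omega⟩
  rw [cumSum_weights]
  have hA := weightSum_pos hτ1 hl hg hM k
  have hreach : B ≤ weightSum τ l g M k := by
    rcases lt_or_ge M B with hlt | hge
    · obtain ⟨hκpos, hratio⟩ := hMB hlt
      have hBpos : 0 < B := hM.trans hlt
      have hpos : 0 < κ * initDist pb pm u v / ε := by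
        have := div_pos hBpos hM
        rw [hratio] at this
        linarith
      refine le_weightSum_of_le hτ1 hl hg hM hBpos ?_
      have hlog17 : Real.log 17 ≤ 3 := by
        rw [Real.log_le_iff_le_exp (by norm_num)]
        have h := Real.exp_one_gt_d9
        have e : Real.exp 3 = Real.exp 1 ^ 3 := by rw [← Real.exp_nat_mul]; norm_num
        rw [e]
        calc (17 : ℝ) ≤ 2.7 ^ 3 := by norm_num
          _ ≤ _ := by gcongr; linarith
      -- ln(17 C₀/ε) ≤ 3 + Λ ≤ 4 Λ, the source of 8 τ Λ in `exists_weight_params`.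
      have hlog : Real.log (B / M) ≤ 4 * logTerm pb pm u v ε := by
        rw [hratio, Real.log_mul (by norm_num) hpos.ne']
        have : Real.log (κ * initDist pb pm u v / ε) ≤ logTerm pb pm u v ε := le_max_right _ _
        linarith
      have h4 := mul_le_mul_of_nonneg_left hlog (by linarith : 0 ≤ 2 * τ)
      -- The first weight uses up one iteration, t = k + 1; since T ≥ 1, k ≥ 300 T - 1 ≥ 299 T.
      push_cast at ht
      linarith
    · exact hge.trans (le_weightSum hτ1 hl hg hM k)
  rw [div_le_iff₀ hA]
  have e : pm.μ₀ * pb.genX.breg u pm.x₀ + pm.ν₀ * pb.genY.breg v pm.y₀ =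
      √(pm.μ₀ * pm.ν₀) * initDist pb pm u v := by
    have e1 : √(pm.μ₀ * pm.ν₀) * √(pm.μ₀ / pm.ν₀) = pm.μ₀ := by
      rw [← Real.sqrt_mul (by positivity), show pm.μ₀ * pm.ν₀ * (pm.μ₀ / pm.ν₀) = pm.μ₀ ^ 2 by
        field_simp, Real.sqrt_sq hμ₀.le]
    have e2 : √(pm.μ₀ * pm.ν₀) * √(pm.ν₀ / pm.μ₀) = pm.ν₀ := by
      rw [← Real.sqrt_mul (by positivity), show pm.μ₀ * pm.ν₀ * (pm.ν₀ / pm.μ₀) = pm.ν₀ ^ 2 by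
        field_simp, Real.sqrt_sq hν₀.le]
    rw [initDist, mul_add, ← mul_assoc, ← mul_assoc, e1, e2]
  rw [e]
  have h5 := mul_le_mul_of_nonneg_left hreach hε.le
  have h6 : ε * B = √(pm.μ₀ * pm.ν₀) * initDist pb pm u v / 2 := by
    rw [hB]
    field_simp
  linarith

end Complexity

end DualLinear
end

open DualLinear
-- Both claims rest on the same complexity bound and differ only in the source of the three-point
-- property: a suitable choice of subgradients, or differentiability along the feasible sets.
theorem mainTheorem3 :
    ∃ C : ℝ, 0 < C ∧
      ∀ (E : Type v) [NormedAddCommGroup E] [NormedSpace ℝ E] [FiniteDimensional ℝ E]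
        (n N : ℕ) (ρ : ℝ≥0∞) [Fact (1 ≤ ρ)], ρ ≤ 2 →
      ∀ (pb : Problem E n N ρ) (pm : Params E n N ρ), pb.IsAdmissible → pm.IsAdmissible pb →
        (∃ ruleX ruleY, IsProxRule pb.X pb.φ pb.genX ruleX ∧ IsProxRule pb.Y pb.ψ pb.genY ruleY ∧
          AchievesComplexity.{v, w} C pb pm ruleX ruleY) ∧
        (DifferentiableAlong pb.X pb.genX → DifferentiableAlong pb.Y pb.genY →
          ∀ ruleX ruleY, IsProxRule pb.X pb.φ pb.genX ruleX →
            IsProxRule pb.Y pb.ψ pb.genY ruleY →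
            AchievesComplexity.{v, w} C pb pm ruleX ruleY) := by
  refine ⟨300, by norm_num, ?_⟩
  intro E _ _ _ n N ρ _ hρ pb pm hpb hpm
  constructor
  · obtain ⟨ruleX, hrX, htX⟩ := exists_proxRule_threePoint hpb.convex_X hpb.μ_nonneg hpb.φ_convex
      hpb.genX_convex hpb.φ_relative hpb.prox_X
    obtain ⟨ruleY, hrY, htY⟩ := exists_proxRule_threePoint hpb.convex_Y hpb.ν_nonneg hpb.ψ_convex
      hpb.genY_convex hpb.ψ_relative hpb.prox_Y
    exact ⟨ruleX, ruleY, hrX, hrY, achievesComplexity hpb hpm hρ hrX hrY htX htY⟩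
  · intro hdX hdY ruleX ruleY hrX hrY
    exact achievesComplexity hpb hpm hρ hrX hrY
      (hrX.hasThreePoint hpb.convex_X hpb.μ_nonneg hpb.φ_convex hpb.genX_convex hpb.φ_relative hdX)
      (hrY.hasThreePoint hpb.convex_Y hpb.ν_nonneg hpb.ψ_convex hpb.genY_convex hpb.ψ_relative hdY)
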